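/- For a finite set $F\subset\mathbb R$ with $N(F)$ elements and a bounded interval $I$ put $$\mathcal G_F(I)=\frac1{N(F)}\,\#\Big\{(x,y)\in F^2:\ y\ne x,\ y-x\in \tfrac1{N(F)}I+\mathbb Z\Big\}.$$ A locally finite measure $\mathcal G$ on $\mathbb R$ is the pair correlation measure of a sequence $(F_n)$ of finite sets if $\mathcal G(I)=\lim_n\mathcal G_{F_n}(I)$ for every bounded interval $I$; if moreover $\mathcal G([0,\lambda])=\int_0^\lambda g(x)\,dx$ for all $\lambda>0$, then $g$ is called the pair correlation function of $(F_n)$. Let $m\ge 1$ be an integer, let $\varphi$ be Euler's function, and write $(a,b)$ for the greatest common divisor. For $Q\geq 1$ let $$\mathfrak F_Q^{(m)}=\Big\{\tfrac aq:\ 0<a\le q\le Q,\ (a,q)=1,\ (q,m)=1\Big\},\qquad C_m=\frac{\varphi(m)}m\prod_{p\nmid m}\Big(1-\frac1{p^2}\Big),$$ where the product is over the primes not dividing $m$. Then: (i) The pair correlation function $g_{(m)}$ of $(\mathfrak F_Q^{(m)})_{Q}$ exists, and for $\lambda>0$ $$g_{(m)}(\lambda)=\frac{\varphi(m)}m\cdot\frac{C_m}{\lambda^2}\sum_{1\le\Delta\le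 2\lambda/C_m}\varphi(\Delta)\,\frac{(\Delta,m)}{\varphi((\Delta,m))}\,\log\frac{2\lambda}{C_m\Delta}.$$ (ii) For all $\delta>0$ and $K\ge1$ we have, uniformly in $\lambda\in[1,K]$ and $Q\ge1$, $$\#\Big\{(\gamma,\gamma')\in(\mathfrak F_Q^{(m)})^2:\ 0<\gamma'-\gamma\le\frac{\lambda}{Q^2}\Big\}=C_m\,\frac{\varphi(m)}m\,Q^2\sum_{1\le\Delta\le\lambda}\frac{\varphi(\Delta)}{\Delta}\cdot\frac{(\Delta,m)}{\varphi((\Delta,m))}\Big(1-\frac\Delta\lambda-\frac\Delta\lambda\log\frac\lambda\Delta\Big)+O_{\delta,m,K}\big(Q^{3/2+\delta}\big).$$ (iii) For every interval $J\subseteq[0,1]$ with endpoints $\alpha<\beta$ (each of which may or may not belong to $J$), the function $g_{(m)}$ is also the pair correlation function of the Farey fractions in $J$ after the affine rescaling of $J$ to unit length, that is, of the sets $\big\{\frac{\gamma-\alpha}{\beta-\alpha}:\gamma\in\mathfrak F_Q^{(m)}\cap J\big\}$. -/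

import Mathlib

open Filter Topology MeasureTheory

noncomputable section

namespace FareyPair

/-- For a finite set `F` of reals with `N` elements,
`𝒢_F(I) = N⁻¹ #{(x, y) ∈ F² : y ≠ x, y - x ∈ N⁻¹ I + ℤ}`. -/
def pairCount (F : Finset ℝ) (I : Set ℝ) : ℝ :=
  (Set.ncard {z : ℝ × ℝ | z.1 ∈ F ∧ z.2 ∈ F ∧ z.2 ≠ z.1 ∧
      ∃ t ∈ I, ∃ k : ℤ, z.2 - z.1 = t / (F.card : ℝ) + (k : ℝ)} : ℝ) / (F.card : ℝ)

/-- `μ` is the pair correlation measure of the sequence `F`: it is finite on bounded sets and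
`𝒢_{F n}(I) → μ(I)` for every bounded interval `I` (open, closed, half-open, degenerate). -/
def IsPairCorrelationMeasure (F : ℕ → Finset ℝ) (μ : Measure ℝ) : Prop :=
  IsLocallyFiniteMeasure μ ∧
    ∀ I : Set ℝ, I.OrdConnected → Bornology.IsBounded I →
      Tendsto (fun n => pairCount (F n) I) atTop (𝓝 (μ I).toReal)

/-- `g` is the pair correlation function of the sequence `F`: the pair correlation measure `μ`
exists and `μ([0, x]) = ∫_0^x g` for all `x > 0`. -/
def IsPairCorrelationFunction (F : ℕ → Finset ℝ) (g : ℝ → ℝ) : Prop :=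
  ∃ μ : Measure ℝ, IsPairCorrelationMeasure F μ ∧
    ∀ x : ℝ, 0 < x → IntervalIntegrable g volume 0 x ∧
      (μ (Set.Icc 0 x)).toReal = ∫ t in (0 : ℝ)..x, g t

/-- The Farey fractions `a / q` with `0 < a ≤ q ≤ Q`, `(a, q) = 1` and `(q, m) = 1`. -/
def farey (m Q : ℕ) : Finset ℝ :=
  ((Finset.Icc 1 Q ×ˢ Finset.Icc 1 Q).filter
      (fun z : ℕ × ℕ => z.1 ≤ z.2 ∧ Nat.Coprime z.1 z.2 ∧ Nat.Coprime z.2 m)).image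
    (fun z : ℕ × ℕ => (z.1 : ℝ) / (z.2 : ℝ))

open Classical in
/-- The elements of `farey m Q` lying in an interval `J` with endpoints `α < β`, transported to
`[0, 1]` by the increasing affine bijection `[α, β] → [0, 1]`. -/
def fareyIn (m : ℕ) (α β : ℝ) (J : Set ℝ) (Q : ℕ) : Finset ℝ :=
  ((farey m Q).filter (fun x => x ∈ J)).image (fun x => (x - α) / (β - α))

/-- `C_m = (φ(m) / m) ∏_{p ∤ m} (1 - p⁻²)`, the product over the primes not dividing `m`. -/
def C (m : ℕ) : ℝ :=
  (Nat.totient m : ℝ) / (m : ℝ) *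
    ∏' p : {p : ℕ // p.Prime ∧ ¬ p ∣ m}, (1 - 1 / ((p : ℕ) : ℝ) ^ 2)

/-- `φ(Δ) (Δ, m) / φ((Δ, m))`. -/
def weight (m Δ : ℕ) : ℝ :=
  (Nat.totient Δ : ℝ) * ((Nat.gcd Δ m : ℝ) / (Nat.totient (Nat.gcd Δ m) : ℝ))

/-- `(φ(m)/m) (C_m/x²) ∑_{1 ≤ Δ ≤ 2x/C_m} φ(Δ) (Δ,m)/φ((Δ,m)) log (2x/(C_m Δ))`. -/
def g (m : ℕ) (x : ℝ) : ℝ :=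
  (Nat.totient m : ℝ) / (m : ℝ) * (C m / x ^ 2) *
    ∑ Δ ∈ Finset.Icc 1 ⌊2 * x / C m⌋₊, weight m Δ * Real.log (2 * x / (C m * (Δ : ℝ)))

/-- The number of pairs `(γ, γ')` in `(farey m Q)²` with `0 < γ' - γ ≤ x / Q²`. -/
def gapCount (m Q : ℕ) (x : ℝ) : ℕ :=
  Set.ncard {z : ℝ × ℝ | z.1 ∈ farey m Q ∧ z.2 ∈ farey m Q ∧
      0 < z.2 - z.1 ∧ z.2 - z.1 ≤ x / (Q : ℝ) ^ 2}

/-- `C_m (φ(m)/m) ∑_{1 ≤ Δ ≤ x} (φ(Δ)/Δ) (Δ,m)/φ((Δ,m)) (1 - Δ/x - (Δ/x) log (x/Δ))`. -/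
def gapDensity (m : ℕ) (x : ℝ) : ℝ :=
  C m * ((Nat.totient m : ℝ) / (m : ℝ)) *
    ∑ Δ ∈ Finset.Icc 1 ⌊x⌋₊, weight m Δ / (Δ : ℝ) *
      (1 - (Δ : ℝ) / x - (Δ : ℝ) / x * Real.log (x / (Δ : ℝ)))

end FareyPair

end

noncomputable section

namespace FareyPair

/-! Fractions `a/q < b/r` with `b q - a r = Δ` differ by `Δ/(q r)`. With denominators at most `Q`, a
gap of at most `x/Q²` forces `1 ≤ Δ ≤ x`, and for given `(a, q, Δ)` the second fraction is
determined by `r`, which lies in `[ΔQ²/(xq), Q]`, is prime to `m`, and satisfies `q ∣ a r + Δ` and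
`(b, r) = 1`. Möbius inversion over `e ∣ Δ` and `t ∣ m` removes both coprimality conditions and
leaves counts of `j` in an interval with `q ∣ a t j + Δ/e` (`sum_gapPairs_eq_sum_fiberSum`).

Summed over all reduced `a` mod `q`, such a count is `φ(q)/q` times the length of the interval, up
to `O(Δ d(q))`, where `d(q)` is the number of divisors; no exponential sum is needed
(`abs_sum_card_dvd_sub_le`). Averaging `φ(q)/q` over `q` prime to `m` against this length gives `C
m` times an explicit integral (`abs_sum_totient_div_mul_sub_le`, `integral_rampWeight`), and the
Möbius sums over `e` and `t` supply `weight m Δ / Δ` and `φ(m)/m`. The resulting error is `O(Q log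
Q)`, better than the claimed power (`abs_gapCount_sub_le`).

For a subinterval `J` the first members of the pairs must be shown to be equidistributed. Twisting
by `e(h a/q)` turns the count into an incomplete sum over inverses mod `q`; completing it gives
Kloosterman sums. The elementary bound `|K|⁴ ≤ 2|h| q³ d(q)³`, from the fourth moment, makes the
twisted sums `O(Q^(15/8)) = o(Q²)`, and Weyl's criterion applies (`tendsto_card_of_fourier`). As the
gaps tend to zero, requiring the second member to lie in `J` too changes nothing in the limit.

Finally, `J` contains `N ~ (C m / 2)(β - α) Q²` fractions, so a rescaled gap `t/N` corresponds to `x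
= (β - α) t Q²/N → 2t/C m`. The normalized number of pairs with scaled gap in `(0, t]` tends to
`(2/C m) gapDensity m (2t/C m)`, and the derivative of this function is `g m` (`integral_g`).
Reflection treats negative gaps, and separation of the points bounds the pairs that are close only
modulo `1` (`isPairCorrelationFunction_of_tendsto`). The full Farey set is the case `J = [0, 1]`. -/

/-! ### Kloosterman sums: the elementary fourth moment bound -/

/-- The Kloosterman sum `∑ e((b a + c a⁻¹) / q)` over the units `a` modulo `q`. -/
def kloosterman (q : ℕ) [NeZero q] (b c : ZMod q) : ℂ :=
  ∑ a : (ZMod q)ˣ, ZMod.stdAddChar (b * (a : ZMod q) + c * ((a⁻¹ : (ZMod q)ˣ) : ZMod q))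

lemma card_natCast_mul_eq_le (q : ℕ) [NeZero q] (h : ℕ) (hh : 0 < h) (b : ZMod q) :
    (Finset.univ.filter fun x : ZMod q => (h : ZMod q) * x = b).card ≤ h := by
  have hq : 0 < q := NeZero.pos q
  have key : (Finset.univ.filter fun x : ZMod q => (h : ZMod q) * x = b).card ≤
      (Finset.range h).card := by
    refine Finset.card_le_card_of_injOn (fun x => h * x.val / q) ?_ ?_
    · intro x _
      simp only [Finset.coe_range, Set.mem_Iio]
      rw [Nat.div_lt_iff_lt_mul hq]
      exact Nat.mul_lt_mul_of_pos_left (ZMod.val_lt x) hh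
    · intro x hx y hy hxy
      simp only [Finset.coe_filter, Finset.mem_univ, true_and, Set.mem_ofPred_eq] at hx hy
      have hmod : h * x.val % q = h * y.val % q := by
        have : ((h * x.val : ℕ) : ZMod q) = ((h * y.val : ℕ) : ZMod q) := by
          push_cast
          simp [hx, hy]
        exact (ZMod.natCast_eq_natCast_iff _ _ _).1 this
      have heq : h * x.val = h * y.val := by
        rw [← Nat.div_add_mod (h * x.val) q, ← Nat.div_add_mod (h * y.val) q, hmod]
        simp only at hxy
        rw [hxy]
      exact ZMod.val_injective q (Nat.eq_of_mul_eq_mul_left hh heq)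
  simpa using key

lemma card_intCast_mul_eq_le (q : ℕ) [NeZero q] (h : ℤ) (hh : h ≠ 0) (b : ZMod q) :
    (Finset.univ.filter fun x : ZMod q => (h : ZMod q) * x = b).card ≤ h.natAbs := by
  have hpos : 0 < h.natAbs := Int.natAbs_pos.2 hh
  rcases Int.natAbs_eq h with h1 | h1
  · have : (h : ZMod q) = (h.natAbs : ZMod q) := by
      conv_lhs => rw [h1]
      rw [Int.cast_natCast]
    rw [this]
    exact card_natCast_mul_eq_le q _ hpos b
  · have : (h : ZMod q) = -(h.natAbs : ZMod q) := by
      conv_lhs => rw [h1]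
      rw [Int.cast_neg, Int.cast_natCast]
    rw [this]
    refine le_trans (Finset.card_le_card ?_) (card_natCast_mul_eq_le q _ hpos (-b))
    intro x hx
    simp only [Finset.mem_filter, Finset.mem_univ, true_and] at hx ⊢
    rw [← hx]; ring

/-- The annihilator of `s` consists of the multiples of `M = q / gcd(s, q)`, and there are `gcd(s,
q)` of these below `q`. -/
lemma card_mul_eq_zero_le (q : ℕ) [NeZero q] (s : ZMod q) :
    (Finset.univ.filter fun w : ZMod q => s * w = 0).card ≤ Nat.gcd s.val q := by
  have hq : 0 < q := NeZero.pos q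
  have hg : 0 < Nat.gcd s.val q := Nat.gcd_pos_of_pos_right _ hq
  obtain ⟨M, hM⟩ := Nat.gcd_dvd_right s.val q
  obtain ⟨S, hS⟩ := Nat.gcd_dvd_left s.val q
  have hcop : Nat.Coprime M S := by
    have h1 := Nat.coprime_div_gcd_div_gcd hg
    rw [Nat.div_eq_of_eq_mul_right hg hS, Nat.div_eq_of_eq_mul_right hg hM] at h1
    exact h1.symm
  have hMpos : 0 < M := by
    rcases Nat.eq_zero_or_pos M with h | h
    · rw [h] at hM; omega
    · exact h
  have key : (Finset.univ.filter fun w : ZMod q => s * w = 0).card ≤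
      (Finset.range (Nat.gcd s.val q)).card := by
    have hdvd : ∀ w : ZMod q, s * w = 0 → M ∣ w.val := by
      intro w hw
      have h1 : ((s.val * w.val : ℕ) : ZMod q) = 0 := by push_cast; simpa using hw
      rw [ZMod.natCast_eq_zero_iff] at h1
      have h2 : Nat.gcd s.val q * M ∣ Nat.gcd s.val q * (S * w.val) := by
        rw [← mul_assoc, ← hS, ← hM]; exact h1
      exact hcop.dvd_of_dvd_mul_left (Nat.dvd_of_mul_dvd_mul_left hg h2)
    refine Finset.card_le_card_of_injOn (fun w => w.val / M) ?_ ?_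
    · intro w _
      simp only [Finset.coe_range, Set.mem_Iio]
      rw [Nat.div_lt_iff_lt_mul hMpos, ← hM]
      exact ZMod.val_lt w
    · intro x hx y hy hxy
      simp only [Finset.coe_filter, Finset.mem_univ, true_and, Set.mem_ofPred_eq] at hx hy
      refine ZMod.val_injective q ?_
      have h1 := Nat.div_mul_cancel (hdvd x hx)
      have h2 := Nat.div_mul_cancel (hdvd y hy)
      simp only at hxy
      rw [← h1, ← h2, hxy]
  simpa using key

/-- The gcd is one of the common divisors of `u` and `q`, so it is at most their sum; each `d ∣ q`
then contributes `d` for its `q/d` multiples, that is `q`. -/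
lemma sum_range_gcd_le (q : ℕ) (hq : 0 < q) :
    ∑ u ∈ Finset.range q, Nat.gcd u q ≤ q * q.divisors.card := by
  calc ∑ u ∈ Finset.range q, Nat.gcd u q
      ≤ ∑ u ∈ Finset.range q, ∑ d ∈ q.divisors, if d ∣ u then d else 0 := by
        refine Finset.sum_le_sum fun u _ => ?_
        have hmem : Nat.gcd u q ∈ q.divisors :=
          Nat.mem_divisors.2 ⟨Nat.gcd_dvd_right u q, hq.ne'⟩
        refine le_trans ?_ (Finset.single_le_sum
          (f := fun d => if d ∣ u then d else 0) (fun _ _ => Nat.zero_le _) hmem)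
        simp [Nat.gcd_dvd_left]
    _ = ∑ d ∈ q.divisors, ∑ u ∈ Finset.range q, if d ∣ u then d else 0 := Finset.sum_comm
    _ ≤ ∑ d ∈ q.divisors, q := by
        refine Finset.sum_le_sum fun d hd => ?_
        obtain ⟨e, he⟩ := Nat.dvd_of_mem_divisors hd
        have hdpos : 0 < d := Nat.pos_of_mem_divisors hd
        rw [← Finset.sum_filter, Finset.sum_const, smul_eq_mul]
        have : ((Finset.range q).filter fun u => d ∣ u).card ≤ (Finset.range e).card := by
          refine Finset.card_le_card_of_injOn (fun u => u / d) ?_ ?_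
          · intro u hu
            simp only [Finset.coe_filter, Finset.mem_range, Set.mem_ofPred_eq] at hu
            simp only [Finset.coe_range, Set.mem_Iio]
            rw [Nat.div_lt_iff_lt_mul hdpos, mul_comm, ← he]
            exact hu.1
          · intro x hx y hy hxy
            simp only [Finset.coe_filter, Finset.mem_range, Set.mem_ofPred_eq] at hx hy
            simp only at hxy
            rw [← Nat.div_mul_cancel hx.2, ← Nat.div_mul_cancel hy.2, hxy]
        rw [Finset.card_range] at this
        calc _ ≤ e * d := Nat.mul_le_mul_right _ this
          _ = q := by rw [he, mul_comm]
    _ = q * q.divisors.card := by simp [mul_comm]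

lemma sum_zmod_gcd_le (q : ℕ) [NeZero q] :
    ∑ u : ZMod q, Nat.gcd u.val q ≤ q * q.divisors.card := by
  refine le_trans (le_of_eq ?_) (sum_range_gcd_le q (NeZero.pos q))
  refine Finset.sum_bij (fun u _ => u.val) ?_ ?_ ?_ ?_
  · intro u _; simpa using ZMod.val_lt u
  · intro x _ y _ h; exact ZMod.val_injective q h
  · intro b hb
    exact ⟨(b : ZMod q), Finset.mem_univ _, ZMod.val_cast_of_lt (Finset.mem_range.1 hb)⟩
  · intro _ _; rfl

lemma card_triple_mul_eq_zero_le (q : ℕ) [NeZero q] :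
    (Finset.univ.filter fun z : ZMod q × ZMod q × ZMod q => z.1 * z.2.1 * z.2.2 = 0).card ≤
      (q * q.divisors.card) ^ 2 := by
  rw [Finset.card_filter, Fintype.sum_prod_type]
  calc ∑ u : ZMod q, ∑ z : ZMod q × ZMod q, (if u * z.1 * z.2 = 0 then 1 else 0)
      ≤ ∑ u : ZMod q, ∑ v : ZMod q, Nat.gcd u.val q * Nat.gcd v.val q := by
        refine Finset.sum_le_sum fun u _ => ?_
        rw [Fintype.sum_prod_type]
        refine Finset.sum_le_sum fun v _ => ?_
        rw [← Finset.card_filter]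
        refine (card_mul_eq_zero_le q (u * v)).trans ?_
        have : Nat.gcd (u * v).val q ∣ Nat.gcd u.val q * Nat.gcd v.val q := by
          rw [ZMod.val_mul, ← Nat.gcd_rec, Nat.gcd_comm u.val, Nat.gcd_comm v.val]
          exact Nat.gcd_mul_right_dvd_mul_gcd q _ _
        exact Nat.le_of_dvd (Nat.mul_pos (Nat.gcd_pos_of_pos_right _ (NeZero.pos q))
          (Nat.gcd_pos_of_pos_right _ (NeZero.pos q))) this
    _ = (∑ u : ZMod q, Nat.gcd u.val q) ^ 2 := by
        rw [sq, Finset.sum_mul_sum]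
    _ ≤ _ := Nat.pow_le_pow_left (sum_zmod_gcd_le q) 2

/-- Orthogonality: the second moment of a two-parameter exponential sum. -/
lemma sum_norm_sq_charSum (q : ℕ) [NeZero q] {P : Type*} [Fintype P] [DecidableEq P]
    (s s' : P → ZMod q) :
    ∑ b : ZMod q, ∑ c : ZMod q, ‖∑ p : P, ZMod.stdAddChar (b * s p + c * s' p)‖ ^ 2 =
      (q : ℝ) ^ 2 * ((Finset.univ.filter fun z : P × P =>
        s z.1 = s z.2 ∧ s' z.1 = s' z.2).card : ℝ) := by
  have hψ : ∀ x : ZMod q, ∑ b : ZMod q, (ZMod.stdAddChar (b * x) : ℂ) = if x = 0 then (q : ℂ) else 0 := by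
    intro x
    rw [AddChar.sum_mulShift x (ZMod.isPrimitive_stdAddChar q)]
    simp
  have hexp : ∀ b c : ZMod q, ((‖∑ p : P, ZMod.stdAddChar (b * s p + c * s' p)‖ ^ 2 : ℝ) : ℂ) =
      ∑ z : P × P, (ZMod.stdAddChar (b * (s z.1 - s z.2)) *
        ZMod.stdAddChar (c * (s' z.1 - s' z.2)) : ℂ) := by
    intro b c
    push_cast
    rw [← Complex.mul_conj', map_sum, Finset.sum_mul_sum, Fintype.sum_prod_type]
    refine Finset.sum_congr rfl fun p _ => Finset.sum_congr rfl fun r _ => ?_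
    rw [← AddChar.map_neg_eq_conj, ← AddChar.map_add_eq_mul, ← AddChar.map_add_eq_mul]
    congr 1; ring
  have : ((∑ b : ZMod q, ∑ c : ZMod q,
      ‖∑ p : P, ZMod.stdAddChar (b * s p + c * s' p)‖ ^ 2 : ℝ) : ℂ) =
      (q : ℂ) ^ 2 * ((Finset.univ.filter fun z : P × P =>
        s z.1 = s z.2 ∧ s' z.1 = s' z.2).card : ℂ) := by
    push_cast
    have h1 : ∀ b c : ZMod q, (‖∑ p : P, ZMod.stdAddChar (b * s p + c * s' p)‖ : ℂ) ^ 2 =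
      ∑ z : P × P, (ZMod.stdAddChar (b * (s z.1 - s z.2)) *
        ZMod.stdAddChar (c * (s' z.1 - s' z.2)) : ℂ) := by
      intro b c; rw [← hexp]; push_cast; rfl
    simp_rw [h1]
    have h2 : ∀ b : ZMod q, ∑ c : ZMod q, ∑ z : P × P,
        (ZMod.stdAddChar (b * (s z.1 - s z.2)) * ZMod.stdAddChar (c * (s' z.1 - s' z.2)) : ℂ) =
        ∑ z : P × P, ZMod.stdAddChar (b * (s z.1 - s z.2)) *
          (if s' z.1 - s' z.2 = 0 then (q : ℂ) else 0) := by
      intro b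
      rw [Finset.sum_comm]
      refine Finset.sum_congr rfl fun z _ => ?_
      rw [← Finset.mul_sum, hψ]
    simp_rw [h2]
    rw [Finset.sum_comm]
    simp_rw [← Finset.sum_mul, hψ]
    rw [Finset.card_filter]
    push_cast
    rw [Finset.mul_sum]
    refine Finset.sum_congr rfl fun z _ => ?_
    by_cases h3 : s z.1 = s z.2 <;> by_cases h4 : s' z.1 = s' z.2 <;>
      simp [h3, h4, sub_eq_zero, sq]
  exact_mod_cast this

/-- This lower bound for `φ(q)` turns a bound summed over a unit orbit into a pointwise one at the
cost of one divisor factor. -/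
lemma le_divisors_card_mul_totient (q : ℕ) (hq : 0 < q) : q ≤ q.divisors.card * q.totient := by
  calc q = ∑ d ∈ q.divisors, d.totient := (Nat.sum_totient q).symm
    _ ≤ ∑ d ∈ q.divisors, q.totient := Finset.sum_le_sum fun d hd =>
        Nat.le_of_dvd (Nat.totient_pos.2 hq) (Nat.totient_dvd_of_dvd (Nat.dvd_of_mem_divisors hd))
    _ = _ := by simp

/-- Clearing denominators, the two equations imply `(x₁ + x₂)(x₃ - x₁)(x₃ - x₂) = 0`. The three
factors determine the solution up to the choice of `x₃` with `2 x₃` given, so the energy is at most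
twice the number of triples with product zero. -/
lemma card_kloosterman_energy_le (q : ℕ) [NeZero q] :
    (Finset.univ.filter fun z : ((ZMod q)ˣ × (ZMod q)ˣ) × ((ZMod q)ˣ × (ZMod q)ˣ) =>
      ((z.1.1 : ZMod q) + z.1.2 = z.2.1 + z.2.2) ∧
      (((z.1.1⁻¹ : (ZMod q)ˣ) : ZMod q) + ((z.1.2⁻¹ : (ZMod q)ˣ) : ZMod q) =
        ((z.2.1⁻¹ : (ZMod q)ˣ) : ZMod q) + ((z.2.2⁻¹ : (ZMod q)ˣ) : ZMod q))).card ≤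
      2 * (q * q.divisors.card) ^ 2 := by
  classical
  set T := Finset.univ.filter fun z : ZMod q × ZMod q × ZMod q => z.1 * z.2.1 * z.2.2 = 0 with hT
  refine le_trans ?_ (Nat.mul_le_mul_left 2 (card_triple_mul_eq_zero_le q))
  rw [mul_comm]
  refine Finset.card_le_mul_card_image_of_maps_to
    (f := fun z : ((ZMod q)ˣ × (ZMod q)ˣ) × ((ZMod q)ˣ × (ZMod q)ˣ) =>
      (((z.1.1 : ZMod q) + z.1.2, (z.2.1 : ZMod q) - z.1.1, (z.2.1 : ZMod q) - z.1.2) :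
        ZMod q × ZMod q × ZMod q)) (t := T) ?_ 2 ?_ |>.trans (le_of_eq (mul_comm _ _))
  · rintro ⟨⟨x1, x2⟩, ⟨x3, x4⟩⟩ hz
    simp only [Finset.mem_filter, Finset.mem_univ, true_and] at hz
    obtain ⟨h1, h2⟩ := hz
    simp only [hT, Finset.mem_filter, Finset.mem_univ, true_and]
    have e1 : (x1 : ZMod q) * ((x1⁻¹ : (ZMod q)ˣ) : ZMod q) = 1 := Units.mul_inv x1
    have e2 : (x2 : ZMod q) * ((x2⁻¹ : (ZMod q)ˣ) : ZMod q) = 1 := Units.mul_inv x2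
    have e3 : (x3 : ZMod q) * ((x3⁻¹ : (ZMod q)ˣ) : ZMod q) = 1 := Units.mul_inv x3
    have e4 : (x4 : ZMod q) * ((x4⁻¹ : (ZMod q)ˣ) : ZMod q) = 1 := Units.mul_inv x4
    generalize (x1 : ZMod q) = a1 at *
    generalize (x2 : ZMod q) = a2 at *
    generalize (x3 : ZMod q) = a3 at *
    generalize (x4 : ZMod q) = a4 at *
    generalize ((x1⁻¹ : (ZMod q)ˣ) : ZMod q) = b1 at *
    generalize ((x2⁻¹ : (ZMod q)ˣ) : ZMod q) = b2 at *
    generalize ((x3⁻¹ : (ZMod q)ˣ) : ZMod q) = b3 at *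
    generalize ((x4⁻¹ : (ZMod q)ˣ) : ZMod q) = b4 at *
    have h3 : a3 * a4 * (a1 + a2) = a1 * a2 * (a3 + a4) := by
      have h5 : a1 * a2 * (a3 * a4) * (b1 + b2) = a1 * a2 * (a3 * a4) * (b3 + b4) := by rw [h2]
      have h6 : a1 * a2 * (a3 * a4) * (b1 + b2) = a3 * a4 * (a1 + a2) := by
        calc _ = a3 * a4 * ((a1 * b1) * a2 + a1 * (a2 * b2)) := by ring
          _ = _ := by rw [e1, e2]; ring
      have h7 : a1 * a2 * (a3 * a4) * (b3 + b4) = a1 * a2 * (a3 + a4) := by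
        calc _ = a1 * a2 * ((a3 * b3) * a4 + a3 * (a4 * b4)) := by ring
          _ = _ := by rw [e3, e4]; ring
      rw [← h6, h5, h7]
    have h4 : a4 = a1 + a2 - a3 := by rw [h1]; ring
    -- After substituting `a4 = a1 + a2 - a3`, the difference `a3 a4 - a1 a2` equals `-(a3 - a1)(a3
    -- - a2)`.
    have h8 : (a1 + a2) * (a3 - a1) * (a3 - a2) = 0 := by
      rw [← h1, h4] at h3
      linear_combination -h3
    exact h8
  · rintro ⟨w, u, v⟩ _
    -- On a fibre the sum `u + v + w` of the three coordinates is `2 x₃`, which leaves at most two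
    -- values of `x₃`; the other variables follow from `x₃`.
    refine le_trans (Finset.card_le_card_of_injOn
      (t := Finset.univ.filter fun x : ZMod q => ((2 : ℕ) : ZMod q) * x = u + v + w)
      (fun z => (z.2.1 : ZMod q)) ?_ ?_) (card_natCast_mul_eq_le q 2 two_pos _)
    · rintro ⟨⟨x1, x2⟩, ⟨x3, x4⟩⟩ hz
      simp only [Finset.coe_filter, Finset.mem_filter, Finset.mem_univ, true_and,
        Set.mem_ofPred_eq, Prod.mk.injEq] at hz ⊢
      obtain ⟨_, rfl, rfl, rfl⟩ := hz
      push_cast; ring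
    · rintro ⟨⟨x1, x2⟩, ⟨x3, x4⟩⟩ hz ⟨⟨y1, y2⟩, ⟨y3, y4⟩⟩ hy hxy
      simp only [Finset.coe_filter, Finset.mem_filter, Finset.mem_univ, true_and,
        Set.mem_ofPred_eq, Prod.mk.injEq] at hz hy hxy
      obtain ⟨⟨h1, -⟩, h2, h3, h4⟩ := hz
      obtain ⟨⟨k1, -⟩, k2, k3, k4⟩ := hy
      have f3 : x3 = y3 := Units.ext hxy
      have f1 : x1 = y1 := Units.ext (by linear_combination hxy - h3 + k3)
      have f2 : x2 = y2 := Units.ext (by linear_combination hxy - h4 + k4)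
      have f4 : x4 = y4 := Units.ext (by
        subst f1 f2 f3
        linear_combination k1 - h1)
      rw [f1, f2, f3, f4]

/-- The square of a Kloosterman sum is a character sum over pairs of units, so the fourth moment is
a second moment and orthogonality reduces it to the energy count. -/
lemma sum_norm_kloosterman_pow_four_le (q : ℕ) [NeZero q] :
    ∑ b : ZMod q, ∑ c : ZMod q, ‖kloosterman q b c‖ ^ 4 ≤
      (q : ℝ) ^ 2 * (2 * ((q : ℝ) * q.divisors.card) ^ 2) := by
  have h := sum_norm_sq_charSum q
    (fun p : (ZMod q)ˣ × (ZMod q)ˣ => (p.1 : ZMod q) + p.2)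
    (fun p => ((p.1⁻¹ : (ZMod q)ˣ) : ZMod q) + ((p.2⁻¹ : (ZMod q)ˣ) : ZMod q))
  have hK : ∀ b c : ZMod q, ‖kloosterman q b c‖ ^ 4 =
      ‖∑ p : (ZMod q)ˣ × (ZMod q)ˣ, ZMod.stdAddChar (b * ((p.1 : ZMod q) + (p.2 : ZMod q)) +
        c * (((p.1⁻¹ : (ZMod q)ˣ) : ZMod q) + ((p.2⁻¹ : (ZMod q)ˣ) : ZMod q)))‖ ^ 2 := by
    intro b c
    have : kloosterman q b c ^ 2 = ∑ p : (ZMod q)ˣ × (ZMod q)ˣ,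
        ZMod.stdAddChar (b * ((p.1 : ZMod q) + (p.2 : ZMod q)) +
        c * (((p.1⁻¹ : (ZMod q)ˣ) : ZMod q) + ((p.2⁻¹ : (ZMod q)ˣ) : ZMod q))) := by
      rw [sq, kloosterman, Finset.sum_mul_sum, Fintype.sum_prod_type]
      refine Finset.sum_congr rfl fun x _ => Finset.sum_congr rfl fun y _ => ?_
      rw [← AddChar.map_add_eq_mul]
      congr 1; ring
    rw [← this, norm_pow]; ring
  simp_rw [hK]
  rw [h]
  refine mul_le_mul_of_nonneg_left ?_ (by positivity)
  exact_mod_cast card_kloosterman_energy_le q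

/-- Substitute `a ↦ u a`. A single large value is thereby repeated along the orbit `(b u, c u⁻¹)`,
which the fourth moment cannot afford. -/
lemma kloosterman_mul_inv (q : ℕ) [NeZero q] (u : (ZMod q)ˣ) (b c : ZMod q) :
    kloosterman q (b * u) (c * ((u⁻¹ : (ZMod q)ˣ) : ZMod q)) = kloosterman q b c := by
  unfold kloosterman
  refine Fintype.sum_equiv (Equiv.mulLeft u) _ _ fun a => ?_
  congr 1
  simp only [Equiv.coe_mulLeft, mul_inv_rev, Units.val_mul]
  ring

/-- Kloosterman's bound, with the first parameter a fixed nonzero integer. -/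
lemma norm_kloosterman_pow_four_le (q : ℕ) [NeZero q] (h : ℤ) (hh : h ≠ 0) (c : ZMod q) :
    ‖kloosterman q h c‖ ^ 4 ≤ 2 * h.natAbs * (q : ℝ) ^ 3 * (q.divisors.card : ℝ) ^ 3 := by
  classical
  have hq : 0 < q := NeZero.pos q
  have h1 : (q.totient : ℝ) * ‖kloosterman q h c‖ ^ 4 ≤
      h.natAbs * ∑ b : ZMod q, ∑ c : ZMod q, ‖kloosterman q b c‖ ^ 4 := by
    calc (q.totient : ℝ) * ‖kloosterman q h c‖ ^ 4
        = ∑ u : (ZMod q)ˣ,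
          ‖kloosterman q (h * u) (c * ((u⁻¹ : (ZMod q)ˣ) : ZMod q))‖ ^ 4 := by
          simp_rw [kloosterman_mul_inv]
          simp [ZMod.card_units_eq_totient]
      _ = ∑ z : ZMod q × ZMod q, ∑ u ∈ Finset.univ.filter (fun u : (ZMod q)ˣ =>
            ((h : ZMod q) * u, c * ((u⁻¹ : (ZMod q)ˣ) : ZMod q)) = z),
          ‖kloosterman q (h * u) (c * ((u⁻¹ : (ZMod q)ˣ) : ZMod q))‖ ^ 4 :=
          (Finset.sum_fiberwise _ _ _).symm
      _ ≤ ∑ z : ZMod q × ZMod q, (h.natAbs : ℝ) * ‖kloosterman q z.1 z.2‖ ^ 4 := by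
          refine Finset.sum_le_sum fun z _ => ?_
          have : ∀ u ∈ Finset.univ.filter (fun u : (ZMod q)ˣ =>
              ((h : ZMod q) * u, c * ((u⁻¹ : (ZMod q)ˣ) : ZMod q)) = z),
              ‖kloosterman q (h * u) (c * ((u⁻¹ : (ZMod q)ˣ) : ZMod q))‖ ^ 4 =
              ‖kloosterman q z.1 z.2‖ ^ 4 := by
            intro u hu
            rw [Finset.mem_filter] at hu
            rw [← hu.2]
          rw [Finset.sum_congr rfl this, Finset.sum_const, nsmul_eq_mul]
          refine mul_le_mul_of_nonneg_right ?_ (by positivity)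
          -- The orbit map `u ↦ (h u, c u⁻¹)` need not be injective when `h` and `q` share factors,
          -- but at most `|h|` units have the same `h u`.
          have h2 := card_intCast_mul_eq_le q h hh z.1
          refine Nat.cast_le.2 (le_trans (Finset.card_le_card_of_injOn
            (fun u : (ZMod q)ˣ => (u : ZMod q)) ?_ ?_) h2)
          · intro u hu
            simp only [Finset.coe_filter, Finset.mem_univ, true_and, Set.mem_ofPred_eq] at hu ⊢
            rw [← hu]
          · intro x _ y _ hxy
            exact Units.ext hxy
      _ = _ := by rw [← Finset.mul_sum, Fintype.sum_prod_type]
  have h2 := sum_norm_kloosterman_pow_four_le q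
  have h3 : (q : ℝ) ≤ q.divisors.card * q.totient := by
    exact_mod_cast le_divisors_card_mul_totient q hq
  have hq' : (0 : ℝ) < q := by exact_mod_cast hq
  have h4 : (q : ℝ) * ‖kloosterman q h c‖ ^ 4 ≤
      (q : ℝ) * (2 * h.natAbs * (q : ℝ) ^ 3 * (q.divisors.card : ℝ) ^ 3) := by
    calc (q : ℝ) * ‖kloosterman q h c‖ ^ 4
        ≤ (q.divisors.card * q.totient) * ‖kloosterman q h c‖ ^ 4 :=
          mul_le_mul_of_nonneg_right h3 (by positivity)
      _ = q.divisors.card * (q.totient * ‖kloosterman q h c‖ ^ 4) := by ring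
      _ ≤ q.divisors.card * (h.natAbs * ((q : ℝ) ^ 2 * (2 * ((q : ℝ) * q.divisors.card) ^ 2))) := by
          refine mul_le_mul_of_nonneg_left (h1.trans ?_) (by positivity)
          exact mul_le_mul_of_nonneg_left h2 (by positivity)
      _ = _ := by ring
  exact le_of_mul_le_mul_left h4 hq'

/-! ### Completion of incomplete sums over inverses -/

lemma sum_Icc_coprime_eq_sum_units (q : ℕ) [NeZero q] {R : Type*} [AddCommMonoid R]
    (F : ZMod q → R) :
    ∑ a ∈ (Finset.Icc 1 q).filter (fun a => Nat.Coprime a q), F (a : ZMod q) =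
      ∑ u : (ZMod q)ˣ, F (u : ZMod q) := by
  have hq : 0 < q := NeZero.pos q
  refine Finset.sum_bij (fun a ha => ZMod.unitOfCoprime a (Finset.mem_filter.1 ha).2) ?_ ?_ ?_ ?_
  · intro a _; exact Finset.mem_univ _
  · intro a ha b hb hab
    have h1 : (a : ZMod q) = (b : ZMod q) := by
      have := congrArg (fun u : (ZMod q)ˣ => (u : ZMod q)) hab
      simpa using this
    rw [ZMod.natCast_eq_natCast_iff] at h1
    simp only [Finset.mem_filter, Finset.mem_Icc] at ha hb
    obtain ⟨⟨ha1, ha2⟩, -⟩ := ha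
    obtain ⟨⟨hb1, hb2⟩, -⟩ := hb
    have h2 : (a - 1) + 1 ≡ (b - 1) + 1 [MOD q] := by
      rwa [Nat.sub_add_cancel ha1, Nat.sub_add_cancel hb1]
    have h3 : a - 1 ≡ b - 1 [MOD q] := Nat.ModEq.add_right_cancel' 1 h2
    have h4 := h3.eq_of_lt_of_lt (by omega) (by omega)
    omega
  · intro u _
    -- Residues are represented in `1, …, q`, while `val` lies in `0, …, q - 1`. A unit has value
    -- `0` only for `q = 1`, and then its representative is `q`.
    by_cases h0 : (u : ZMod q).val = 0
    · have hu : (u : ZMod q) = 0 := (ZMod.val_eq_zero _).1 h0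
      have h1 : Nat.Coprime q q := by
        have := ZMod.val_coe_unit_coprime u
        rw [h0, Nat.coprime_zero_left] at this
        rw [this]; exact Nat.coprime_one_left 1
      refine ⟨q, Finset.mem_filter.2 ⟨Finset.mem_Icc.2 ⟨hq, le_rfl⟩, h1⟩, ?_⟩
      apply Units.ext
      simp [hu]
    · refine ⟨(u : ZMod q).val, Finset.mem_filter.2 ⟨Finset.mem_Icc.2
        ⟨Nat.pos_of_ne_zero h0, (ZMod.val_lt _).le⟩, ZMod.val_coe_unit_coprime u⟩, ?_⟩
      apply Units.ext
      simp
  · intro a _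
    simp

lemma norm_sum_Icc_pow_le (z : ℂ) (hz : ‖z‖ = 1) (hz1 : z ≠ 1) (A B : ℕ) :
    ‖∑ j ∈ Finset.Icc A B, z ^ j‖ ≤ 2 / ‖z - 1‖ := by
  have hpos : 0 < ‖z - 1‖ := norm_pos_iff.2 (sub_ne_zero.2 hz1)
  rcases le_or_gt A (B + 1) with h | h
  · have h1 : Finset.Icc A B = Finset.Ico A (B + 1) := by ext; simp
    rw [h1, geom_sum_Ico hz1 h, norm_div]
    refine div_le_div_of_nonneg_right ?_ hpos.le
    refine (norm_sub_le _ _).trans ?_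
    simp [hz]; norm_num
  · rw [Finset.Icc_eq_empty (by omega)]
    simp; positivity

/-- With `θ = n/q` the left side is `1/sin(πθ)`, and Jordan's inequality gives `sin(πθ) ≥ 2 min(θ, 1
- θ)`. Adding the two reciprocals avoids the minimum. -/
lemma two_div_norm_exp_sub_one_le (q n : ℕ) (hn : 0 < n) (hnq : n < q) :
    2 / ‖Complex.exp (2 * Real.pi * Complex.I * n / q) - 1‖ ≤
      (q : ℝ) / 2 * (1 / n + 1 / ((q : ℝ) - n)) := by
  have hn' : (0 : ℝ) < n := by exact_mod_cast hn
  have hnq' : (n : ℝ) < q := by exact_mod_cast hnq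
  have hq' : (0 : ℝ) < q := hn'.trans hnq'
  have hm : (0 : ℝ) < q - n := by linarith
  have hπ := Real.pi_pos
  set θ : ℝ := n / q with hθ
  have hθ0 : 0 < θ := by positivity
  have hθ1 : θ < 1 := by rw [hθ, div_lt_one hq']; exact hnq'
  have h1 : (2 * Real.pi * Complex.I * n / q : ℂ) = Complex.I * ((2 * Real.pi * θ : ℝ) : ℂ) := by
    rw [hθ]; push_cast; ring
  rw [h1, Complex.norm_exp_I_mul_ofReal_sub_one]
  have h2 : 2 * Real.pi * θ / 2 = Real.pi * θ := by ring
  rw [h2]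
  have hs : 0 < Real.sin (Real.pi * θ) :=
    Real.sin_pos_of_pos_of_lt_pi (by positivity) (by nlinarith)
  rw [Real.norm_of_nonneg (by positivity)]
  have h3 : 2 / (2 * Real.sin (Real.pi * θ)) = 1 / Real.sin (Real.pi * θ) := by
    field_simp
  rw [h3]
  have ha : (0:ℝ) < 1 / n := by positivity
  have hb : (0:ℝ) < 1 / ((q:ℝ) - n) := by positivity
  rcases le_or_gt θ (1 / 2) with h | h
  · have h4 := Real.mul_le_sin (x := Real.pi * θ) (by positivity) (by nlinarith)
    have h5 : 2 / Real.pi * (Real.pi * θ) = 2 * θ := by field_simp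
    rw [h5] at h4
    calc 1 / Real.sin (Real.pi * θ) ≤ 1 / (2 * θ) := one_div_le_one_div_of_le (by positivity) h4
      _ = (q : ℝ) / 2 * (1 / n) := by rw [hθ]; field_simp
      _ ≤ _ := by
        refine mul_le_mul_of_nonneg_left ?_ (by positivity)
        linarith
  · have h4 := Real.mul_le_sin (x := Real.pi * (1 - θ)) (by nlinarith) (by nlinarith)
    have h5 : 2 / Real.pi * (Real.pi * (1 - θ)) = 2 * (1 - θ) := by field_simp
    have h6 : Real.sin (Real.pi * (1 - θ)) = Real.sin (Real.pi * θ) := by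
      rw [← Real.sin_pi_sub]; congr 1; ring
    rw [h5, h6] at h4
    calc 1 / Real.sin (Real.pi * θ) ≤ 1 / (2 * (1 - θ)) :=
          one_div_le_one_div_of_le (by linarith) h4
      _ = (q : ℝ) / 2 * (1 / ((q : ℝ) - n)) := by
          have : 1 - θ = (q - n) / q := by rw [hθ]; field_simp
          rw [this]; field_simp
      _ ≤ _ := by
        refine mul_le_mul_of_nonneg_left ?_ (by positivity)
        linarith

lemma sum_Icc_one_div_le (n : ℕ) : ∑ k ∈ Finset.Icc 1 n, (1 : ℝ) / k ≤ 1 + Real.log n := by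
  have h := harmonic_le_one_add_log n
  rw [harmonic_eq_sum_Icc] at h
  push_cast at h
  simpa [one_div] using h

lemma sum_two_div_norm_exp_sub_one_le (q : ℕ) :
    ∑ n ∈ Finset.Ico 1 q, 2 / ‖Complex.exp (2 * Real.pi * Complex.I * n / q) - 1‖ ≤
      q * (1 + Real.log q) := by
  rcases Nat.eq_zero_or_pos q with h0 | hq
  · simp [h0]
  have hH : ∑ n ∈ Finset.Ico 1 q, (1 : ℝ) / n ≤ 1 + Real.log q :=
    le_trans (Finset.sum_le_sum_of_subset_of_nonneg (fun x hx => by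
      simp only [Finset.mem_Ico, Finset.mem_Icc] at hx ⊢; omega)
      (fun _ _ _ => by positivity)) (sum_Icc_one_div_le q)
  have hR : ∑ n ∈ Finset.Ico 1 q, (1 : ℝ) / ((q : ℝ) - n) = ∑ n ∈ Finset.Ico 1 q, (1 : ℝ) / n := by
    refine Finset.sum_bij (fun n _ => q - n) ?_ ?_ ?_ ?_
    · intro a ha; simp only [Finset.mem_Ico] at ha ⊢; omega
    · intro a ha b hb hab; simp only [Finset.mem_Ico] at ha hb; omega
    · intro b hb
      simp only [Finset.mem_Ico] at hb
      exact ⟨q - b, by simp only [Finset.mem_Ico]; omega, by omega⟩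
    · intro a ha
      simp only [Finset.mem_Ico] at ha
      rw [Nat.cast_sub ha.2.le]
  calc _ ≤ ∑ n ∈ Finset.Ico 1 q, (q : ℝ) / 2 * (1 / n + 1 / ((q : ℝ) - n)) := by
        refine Finset.sum_le_sum fun n hn => ?_
        rw [Finset.mem_Ico] at hn
        exact two_div_norm_exp_sub_one_le q n hn.1 hn.2
    _ = (q : ℝ) / 2 * (∑ n ∈ Finset.Ico 1 q, (1 : ℝ) / n + ∑ n ∈ Finset.Ico 1 q, (1 : ℝ) / n) := by
        rw [← Finset.mul_sum, Finset.sum_add_distrib, hR]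
    _ ≤ (q : ℝ) / 2 * ((1 + Real.log q) + (1 + Real.log q)) := by gcongr
    _ = _ := by ring

/-- The frequency `0` is bounded by the number of terms, at most `B + 1`; the others are geometric
sums. -/
lemma sum_norm_sum_Icc_stdAddChar_le (q : ℕ) [NeZero q] (A B : ℕ) :
    ∑ n : ZMod q, ‖∑ j ∈ Finset.Icc A B, (ZMod.stdAddChar (n * (j : ZMod q)) : ℂ)‖ ≤
      (B + 1) + q * (1 + Real.log q) := by
  have hq : 0 < q := NeZero.pos q
  have h1 : ∑ n : ZMod q, ‖∑ j ∈ Finset.Icc A B, (ZMod.stdAddChar (n * (j : ZMod q)) : ℂ)‖ =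
      ∑ n ∈ Finset.range q,
        ‖∑ j ∈ Finset.Icc A B, (ZMod.stdAddChar ((n : ZMod q) * (j : ZMod q)) : ℂ)‖ := by
    refine Finset.sum_bij (fun u _ => u.val) ?_ ?_ ?_ ?_
    · intro u _; simpa using ZMod.val_lt u
    · intro x _ y _ h; exact ZMod.val_injective q h
    · intro b hb
      exact ⟨(b : ZMod q), Finset.mem_univ _, ZMod.val_cast_of_lt (Finset.mem_range.1 hb)⟩
    · intro u _; simp
  rw [h1, Finset.range_eq_Ico, Finset.sum_eq_sum_Ico_succ_bot hq]
  refine add_le_add ?_ (le_trans (Finset.sum_le_sum fun n hn => ?_)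
    (sum_two_div_norm_exp_sub_one_le q))
  · refine (norm_sum_le _ _).trans ?_
    simp only [Nat.cast_zero, zero_mul, AddChar.map_zero_eq_one, norm_one, Finset.sum_const,
      Nat.card_Icc, nsmul_eq_mul, mul_one]
    have : B + 1 - A ≤ B + 1 := Nat.sub_le _ _
    exact_mod_cast this
  · rw [Finset.mem_Ico] at hn
    have hz : (ZMod.stdAddChar ((n : ZMod q)) : ℂ) =
        Complex.exp (2 * Real.pi * Complex.I * n / q) := by
      have := ZMod.stdAddChar_coe (N := q) (n : ℤ)
      push_cast at this
      exact this
    have hne : (ZMod.stdAddChar ((n : ZMod q)) : ℂ) ≠ 1 := by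
      intro h
      have h2 : (n : ZMod q) = 0 := ZMod.injective_stdAddChar (by
        rw [h, AddChar.map_zero_eq_one])
      rw [ZMod.natCast_eq_zero_iff] at h2
      exact absurd (Nat.le_of_dvd hn.1 h2) (by omega)
    have hpow : ∀ j : ℕ, (ZMod.stdAddChar ((n : ZMod q) * (j : ZMod q)) : ℂ) =
        (ZMod.stdAddChar (n : ZMod q) : ℂ) ^ j := by
      intro j
      rw [← AddChar.map_nsmul_eq_pow, nsmul_eq_mul, mul_comm]
    simp_rw [hpow]
    rw [← hz]
    exact norm_sum_Icc_pow_le _ (AddChar.norm_apply _ _) hne A B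

/-- The incomplete sum `∑ e(h a / q)` over `a` coprime to `q` and `A ≤ j ≤ B` with
`q ∣ a t j + D`, in terms of a bound for complete Kloosterman sums. -/
lemma norm_incomplete_sum_le (q : ℕ) [NeZero q] (h : ℤ) (t D A B : ℕ) (ht : Nat.Coprime t q)
    (M : ℝ) (hM : ∀ c : ZMod q, ‖kloosterman q h c‖ ≤ M) :
    ‖∑ a ∈ (Finset.Icc 1 q).filter (fun a => Nat.Coprime a q),
        Complex.exp (2 * Real.pi * Complex.I * h * ((a : ℝ) / (q : ℝ) : ℝ)) *
          (((Finset.Icc A B).filter fun j => q ∣ a * t * j + D).card : ℂ)‖ ≤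
      ((B + 1) / q + 1 + Real.log q) * M := by
  classical
  have hq : 0 < q := NeZero.pos q
  have hq' : (0 : ℝ) < q := by exact_mod_cast hq
  have hqc : (q : ℂ) ≠ 0 := by exact_mod_cast hq.ne'
  set F : ZMod q → ℂ := fun a => ZMod.stdAddChar ((h : ZMod q) * a) *
    (((Finset.Icc A B).filter fun j : ℕ => a * t * j + D = 0).card : ℂ) with hF
  have h1 : ∑ a ∈ (Finset.Icc 1 q).filter (fun a => Nat.Coprime a q),
        Complex.exp (2 * Real.pi * Complex.I * h * ((a : ℝ) / (q : ℝ) : ℝ)) *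
          (((Finset.Icc A B).filter fun j => q ∣ a * t * j + D).card : ℂ) =
      ∑ u : (ZMod q)ˣ, F (u : ZMod q) := by
    rw [← sum_Icc_coprime_eq_sum_units]
    refine Finset.sum_congr rfl fun a _ => ?_
    simp only [hF]
    congr 1
    · have := ZMod.stdAddChar_coe (N := q) (h * a : ℤ)
      push_cast at this
      rw [this]
      congr 1
      push_cast
      ring
    · congr 2
      ext j
      simp only [Finset.mem_filter, and_congr_right_iff]
      intro _
      rw [← ZMod.natCast_eq_zero_iff]
      push_cast
      rfl
  set v : (ZMod q)ˣ := ZMod.unitOfCoprime t ht with hv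
  have hvt : (t : ZMod q) = (v : ZMod q) := by simp [hv]
  -- Multiplying by inverses, the divisibility says `j = -D t⁻¹ u⁻¹` in `ZMod q`; orthogonality of
  -- additive characters detects this equation.
  have hcard : ∀ u : (ZMod q)ˣ,
      (((Finset.Icc A B).filter fun j : ℕ => (u : ZMod q) * t * j + D = 0).card : ℂ) =
      (1 / q : ℂ) * ∑ n : ZMod q, (∑ j ∈ Finset.Icc A B, ZMod.stdAddChar (n * (j : ZMod q))) *
        ZMod.stdAddChar ((n * (D : ZMod q) * ((v⁻¹ : (ZMod q)ˣ) : ZMod q)) * ((u⁻¹ : (ZMod q)ˣ) : ZMod q)) := by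
    intro u
    rw [Finset.card_filter]
    push_cast
    simp_rw [Finset.sum_mul]
    rw [Finset.sum_comm, Finset.mul_sum]
    refine Finset.sum_congr rfl fun j _ => ?_
    have h2 : ∀ n : ZMod q, (ZMod.stdAddChar (n * (j : ZMod q)) : ℂ) * ZMod.stdAddChar
        ((n * (D : ZMod q) * ((v⁻¹ : (ZMod q)ˣ) : ZMod q)) * ((u⁻¹ : (ZMod q)ˣ) : ZMod q)) =
        ZMod.stdAddChar (n * ((j : ZMod q) +
          (D : ZMod q) * ((v⁻¹ : (ZMod q)ˣ) : ZMod q) * ((u⁻¹ : (ZMod q)ˣ) : ZMod q))) := by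
      intro n
      rw [← AddChar.map_add_eq_mul]; congr 1; ring
    simp_rw [h2]
    rw [AddChar.sum_mulShift _ (ZMod.isPrimitive_stdAddChar q)]
    have e1 : (v : ZMod q) * ((v⁻¹ : (ZMod q)ˣ) : ZMod q) = 1 := Units.mul_inv v
    have e2 : (u : ZMod q) * ((u⁻¹ : (ZMod q)ˣ) : ZMod q) = 1 := Units.mul_inv u
    have h3 : (u : ZMod q) * t * j + D = 0 ↔ (j : ZMod q) +
          (D : ZMod q) * ((v⁻¹ : (ZMod q)ˣ) : ZMod q) * ((u⁻¹ : (ZMod q)ˣ) : ZMod q) = 0 := by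
      rw [hvt]
      generalize (u : ZMod q) = x at *
      generalize ((u⁻¹ : (ZMod q)ˣ) : ZMod q) = x' at *
      generalize (v : ZMod q) = y at *
      generalize ((v⁻¹ : (ZMod q)ˣ) : ZMod q) = y' at *
      constructor
      · intro h4
        linear_combination (x' * y') * h4 - (j : ZMod q) * (y * y') * e2 - (j : ZMod q) * e1
      · intro h4
        linear_combination (x * y) * h4 - (D : ZMod q) * (y * y') * e2 - (D : ZMod q) * e1
    by_cases h5 : (u : ZMod q) * t * j + D = 0
    · rw [if_pos h5, if_pos (h3.1 h5)]
      simp [hqc]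
    · rw [if_neg h5, if_neg (fun h6 => h5 (h3.2 h6))]
      simp
  -- Interchanging the sums, the variable `u` now enters only through `h u` and `u⁻¹`, so its sum is
  -- a complete Kloosterman sum for each `n`.
  have h4 : ∑ u : (ZMod q)ˣ, F (u : ZMod q) = (1 / q : ℂ) * ∑ n : ZMod q,
      (∑ j ∈ Finset.Icc A B, (ZMod.stdAddChar (n * (j : ZMod q)) : ℂ)) *
        kloosterman q h (n * (D : ZMod q) * ((v⁻¹ : (ZMod q)ˣ) : ZMod q)) := by
    simp only [hF, hcard, kloosterman]
    simp_rw [Finset.mul_sum]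
    rw [Finset.sum_comm]
    refine Finset.sum_congr rfl fun n _ => Finset.sum_congr rfl fun u _ => ?_
    rw [AddChar.map_add_eq_mul]
    ring
  rw [h1, h4, norm_mul]
  have hM0 : 0 ≤ M := (norm_nonneg _).trans (hM 0)
  have h5 : ‖(1 / q : ℂ)‖ = 1 / q := by simp
  rw [h5]
  calc (1 / (q : ℝ)) * ‖∑ n : ZMod q,
        (∑ j ∈ Finset.Icc A B, (ZMod.stdAddChar (n * (j : ZMod q)) : ℂ)) *
        kloosterman q h (n * (D : ZMod q) * ((v⁻¹ : (ZMod q)ˣ) : ZMod q))‖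
      ≤ (1 / (q : ℝ)) * ∑ n : ZMod q,
        ‖∑ j ∈ Finset.Icc A B, (ZMod.stdAddChar (n * (j : ZMod q)) : ℂ)‖ * M := by
        refine mul_le_mul_of_nonneg_left ((norm_sum_le _ _).trans
          (Finset.sum_le_sum fun n _ => ?_)) (by positivity)
        rw [norm_mul]
        exact mul_le_mul_of_nonneg_left (hM _) (norm_nonneg _)
    _ ≤ (1 / (q : ℝ)) * (((B + 1) + q * (1 + Real.log q)) * M) := by
        rw [← Finset.sum_mul]
        refine mul_le_mul_of_nonneg_left (mul_le_mul_of_nonneg_right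
          (sum_norm_sum_Icc_stdAddChar_le q A B) hM0) (by positivity)
    _ = _ := by field_simp; ring

/-! ### Möbius sums -/

lemma sum_divisors_moebius (n : ℕ) :
    ∑ d ∈ n.divisors, ArithmeticFunction.moebius d = if n = 1 then 1 else 0 := by
  have h := congrArg (fun f : ArithmeticFunction ℤ => f n) ArithmeticFunction.coe_zeta_mul_moebius
  simp only [ArithmeticFunction.coe_zeta_mul_apply, ArithmeticFunction.one_apply] at h
  exact h

lemma ite_coprime_eq_sum_moebius (j M : ℕ) (hM : 0 < M) :
    (if Nat.Coprime j M then (1 : ℝ) else 0) =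
      ∑ d ∈ M.divisors, if d ∣ j then (ArithmeticFunction.moebius d : ℝ) else 0 := by
  rw [← Finset.sum_filter]
  have h1 : M.divisors.filter (fun d => d ∣ j) = (Nat.gcd j M).divisors := by
    ext d
    simp only [Finset.mem_filter, Nat.mem_divisors, Nat.dvd_gcd_iff]
    constructor
    · rintro ⟨⟨h1, h2⟩, h3⟩
      exact ⟨⟨h3, h1⟩, (Nat.gcd_pos_of_pos_right _ hM).ne'⟩
    · rintro ⟨⟨h1, h2⟩, _⟩
      exact ⟨⟨h2, hM.ne'⟩, h1⟩
  rw [h1]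
  have h2 := sum_divisors_moebius (Nat.gcd j M)
  have h3 : ((∑ d ∈ (Nat.gcd j M).divisors, ArithmeticFunction.moebius d : ℤ) : ℝ) =
      ((if Nat.gcd j M = 1 then 1 else 0 : ℤ) : ℝ) := by rw [h2]
  push_cast at h3
  rw [h3]

lemma abs_moebius_le_one (n : ℕ) : |(ArithmeticFunction.moebius n : ℝ)| ≤ 1 := by
  exact_mod_cast ArithmeticFunction.abs_moebius_le_one (n := n)

/-- The arithmetic function `n ↦ 1 / n`. -/
def invArith : ArithmeticFunction ℝ := ⟨fun n => 1 / (n : ℝ), by simp⟩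

lemma invArith_isMultiplicative : invArith.IsMultiplicative := by
  refine ⟨by simp [invArith], ?_⟩
  intro a b _
  simp [invArith, mul_comm]

/-- Only squarefree `e` contribute, and the squarefree divisors of `n` prime to `m` are exactly the
divisors of `r`, the product of the primes of `n` not dividing `m`. -/
lemma sum_moebius_div_coprime (n m : ℕ) (hn : 0 < n) :
    ∑ e ∈ n.divisors.filter (fun e => Nat.Coprime e m), (ArithmeticFunction.moebius e : ℝ) / e =
      ∏ p ∈ n.primeFactors.filter (fun p => ¬ p ∣ m), (1 - 1 / (p : ℝ)) := by
  classical
  set S := n.primeFactors.filter (fun p => ¬ p ∣ m) with hS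
  have hSp : ∀ p ∈ S, p.Prime := fun p hp =>
    Nat.prime_of_mem_primeFactors (Finset.mem_filter.1 hp).1
  set r := ∏ p ∈ S, p with hr
  have hrpf : r.primeFactors = S := Nat.primeFactors_prod hSp
  have hrsq : Squarefree r := by
    refine Finset.squarefree_prod_of_pairwise_isCoprime ?_ (fun p hp => (hSp p hp).prime.squarefree)
    intro p hp q hq hpq
    exact Nat.coprime_iff_isRelPrime.1 ((Nat.coprime_primes (hSp p hp) (hSp q hq)).2 hpq)
  have hr0 : r ≠ 0 := hrsq.ne_zero
  have h1 := ArithmeticFunction.IsMultiplicative.prodPrimeFactors_one_sub_of_squarefree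
    invArith invArith_isMultiplicative hrsq
  rw [hrpf] at h1
  have h2 : ∏ p ∈ S, (1 - 1 / (p : ℝ)) = ∑ d ∈ r.divisors, (ArithmeticFunction.moebius d : ℝ) / d := by
    rw [show (∏ p ∈ S, (1 - 1 / (p : ℝ))) = ∏ p ∈ S, (1 - invArith p) from rfl, h1]
    refine Finset.sum_congr rfl fun d _ => ?_
    simp [invArith, div_eq_mul_inv]
  rw [h2]
  symm
  refine Finset.sum_subset ?_ ?_
  · intro d hd
    have hdr := Nat.dvd_of_mem_divisors hd
    have hrn : r ∣ n := (Finset.prod_dvd_prod_of_subset _ _ _ (Finset.filter_subset _ _)).trans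
      (Nat.prod_primeFactors_dvd n)
    refine Finset.mem_filter.2 ⟨Nat.mem_divisors.2 ⟨hdr.trans hrn, hn.ne'⟩, ?_⟩
    refine Nat.Coprime.coprime_dvd_left hdr (Nat.Coprime.prod_left fun p hp => ?_)
    exact (Nat.Prime.coprime_iff_not_dvd (hSp p hp)).2 (Finset.mem_filter.1 hp).2
  · intro d hd hdr
    obtain ⟨hdn, hdm⟩ := Finset.mem_filter.1 hd
    have hdn' := Nat.dvd_of_mem_divisors hdn
    by_cases hsq : Squarefree d
    · exfalso
      apply hdr
      refine Nat.mem_divisors.2 ⟨?_, hr0⟩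
      rw [← Nat.prod_primeFactors_of_squarefree hsq]
      refine Finset.prod_dvd_prod_of_subset _ _ _ fun p hp => ?_
      have hpp := Nat.prime_of_mem_primeFactors hp
      have hpd := Nat.dvd_of_mem_primeFactors hp
      refine Finset.mem_filter.2 ⟨Nat.mem_primeFactors.2 ⟨hpp, hpd.trans hdn', hn.ne'⟩, fun hpm => ?_⟩
      exact hpp.one_lt.ne' (Nat.dvd_one.1 (hdm ▸ Nat.dvd_gcd hpd hpm))
    · rw [ArithmeticFunction.moebius_eq_zero_of_not_squarefree hsq]
      simp

lemma totient_div_eq_prod (n : ℕ) (hn : 0 < n) :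
    (n.totient : ℝ) / n = ∏ p ∈ n.primeFactors, (1 - 1 / (p : ℝ)) := by
  have h := Nat.totient_eq_mul_prod_factors n
  have h2 : (n.totient : ℝ) = n * ∏ p ∈ n.primeFactors, (1 - (p : ℝ)⁻¹) := by
    have h3 := congrArg (fun x : ℚ => (x : ℝ)) h
    push_cast at h3
    exact h3
  have hn' : (n : ℝ) ≠ 0 := by exact_mod_cast hn.ne'
  rw [h2, mul_div_cancel_left₀ _ hn']
  simp [one_div]

lemma sum_moebius_div (n : ℕ) (hn : 0 < n) :
    ∑ e ∈ n.divisors, (ArithmeticFunction.moebius e : ℝ) / e = (n.totient : ℝ) / n := by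
  have h := sum_moebius_div_coprime n 1 hn
  rw [totient_div_eq_prod n hn]
  rw [Finset.filter_true_of_mem (fun e _ => Nat.coprime_one_right e),
    Finset.filter_true_of_mem] at h
  · exact h
  · intro p hp h1
    exact (Nat.prime_of_mem_primeFactors hp).one_lt.ne' (Nat.dvd_one.1 h1)

/-- The primes of `gcd(n, m)` are those primes of `n` that divide `m`; dividing them out of the
product for `φ(n)/n` produces the factor `(n, m)/φ((n, m))`. -/
lemma sum_moebius_div_coprime_eq_weight (n m : ℕ) (hn : 0 < n) :
    ∑ e ∈ n.divisors.filter (fun e => Nat.Coprime e m), (ArithmeticFunction.moebius e : ℝ) / e =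
      weight m n / n := by
  rw [sum_moebius_div_coprime n m hn, weight]
  have hg : 0 < Nat.gcd n m := Nat.gcd_pos_of_pos_left _ hn
  have h1 := totient_div_eq_prod n hn
  have h2 := totient_div_eq_prod _ hg
  have hpf : (Nat.gcd n m).primeFactors = n.primeFactors.filter (fun p => p ∣ m) := by
    ext p
    simp only [Nat.mem_primeFactors, Finset.mem_filter, Nat.dvd_gcd_iff]
    constructor
    · rintro ⟨h1, ⟨h2, h3⟩, _⟩; exact ⟨⟨h1, h2, hn.ne'⟩, h3⟩
    · rintro ⟨⟨h1, h2, _⟩, h3⟩; exact ⟨h1, ⟨h2, h3⟩, hg.ne'⟩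
  rw [hpf] at h2
  rw [← Finset.prod_filter_mul_prod_filter_not _ (fun p => p ∣ m), ← h2] at h1
  have hφ : (0 : ℝ) < (Nat.gcd n m).totient := by exact_mod_cast Nat.totient_pos.2 hg
  have hg' : (0 : ℝ) < Nat.gcd n m := by exact_mod_cast hg
  have hn' : (0 : ℝ) < n := by exact_mod_cast hn
  rw [mul_div_right_comm, h1]
  field_simp

/-! ### Integers in real intervals -/

/-- The natural numbers `j` with `lo ≤ j ≤ hi`. -/
def natIcc (lo hi : ℝ) : Finset ℕ := Finset.Icc ⌈lo⌉₊ ⌊hi⌋₊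

lemma mem_natIcc {lo hi : ℝ} (hhi : 0 ≤ hi) {j : ℕ} :
    j ∈ natIcc lo hi ↔ lo ≤ j ∧ (j : ℝ) ≤ hi := by
  simp [natIcc, Nat.ceil_le, Nat.le_floor_iff hhi]

lemma abs_card_natIcc_sub_le {lo hi : ℝ} (hlo : 0 ≤ lo) (hhi : 0 ≤ hi) :
    |((natIcc lo hi).card : ℝ) - max 0 (hi - lo)| ≤ 1 := by
  have h1 := Nat.floor_le hhi
  have h2 := Nat.lt_floor_add_one hi
  have h3 := Nat.le_ceil lo
  have h4 := Nat.ceil_lt_add_one hlo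
  rw [natIcc, Nat.card_Icc]
  rcases le_total ⌈lo⌉₊ (⌊hi⌋₊ + 1) with h | h
  · rw [Nat.cast_sub h]
    push_cast
    have h' : ((⌈lo⌉₊ : ℕ) : ℝ) ≤ (⌊hi⌋₊ : ℝ) + 1 := by exact_mod_cast h
    rcases le_total 0 (hi - lo) with h5 | h5
    · rw [max_eq_right h5, abs_le]; constructor <;> linarith
    · rw [max_eq_left h5, abs_le]; constructor <;> linarith
  · rw [Nat.sub_eq_zero_of_le h]
    have h' : (⌊hi⌋₊ : ℝ) + 1 ≤ ((⌈lo⌉₊ : ℕ) : ℝ) := by exact_mod_cast h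
    rcases le_total 0 (hi - lo) with h5 | h5
    · rw [max_eq_right h5, abs_le]; push_cast; constructor <;> linarith
    · rw [max_eq_left h5]; simp

lemma card_natIcc_dvd {lo hi : ℝ} (hhi : 0 ≤ hi) {d : ℕ} (hd : 0 < d) (P : ℕ → Prop)
    [DecidablePred P] :
    ((natIcc lo hi).filter (fun j => d ∣ j ∧ P j)).card =
      ((natIcc (lo / d) (hi / d)).filter (fun i => P (d * i))).card := by
  have hd' : (0 : ℝ) < d := by exact_mod_cast hd
  symm
  refine Finset.card_bij (fun i _ => d * i) ?_ ?_ ?_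
  · intro i hi'
    rw [Finset.mem_filter, mem_natIcc (by positivity)] at hi'
    rw [Finset.mem_filter, mem_natIcc hhi]
    refine ⟨⟨?_, ?_⟩, dvd_mul_right _ _, hi'.2⟩
    · have := hi'.1.1; rw [div_le_iff₀ hd'] at this; push_cast; linarith
    · have := hi'.1.2; rw [le_div_iff₀ hd'] at this; push_cast; linarith
  · intro a _ b _ hab; exact Nat.eq_of_mul_eq_mul_left hd hab
  · intro b hb
    rw [Finset.mem_filter, mem_natIcc hhi] at hb
    obtain ⟨⟨h1, h2⟩, ⟨i, rfl⟩, h4⟩ := hb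
    refine ⟨i, ?_, rfl⟩
    rw [Finset.mem_filter, mem_natIcc (by positivity), div_le_iff₀ hd', le_div_iff₀ hd']
    push_cast at h1 h2
    exact ⟨⟨by linarith, by linarith⟩, h4⟩

lemma abs_card_natIcc_dvd_sub_le {lo hi : ℝ} (hlo : 0 ≤ lo) (hhi : 0 ≤ hi) {d : ℕ} (hd : 0 < d) :
    |(((natIcc lo hi).filter (fun j => d ∣ j)).card : ℝ) - max 0 (hi - lo) / d| ≤ 1 := by
  have hd' : (0 : ℝ) < d := by exact_mod_cast hd
  have h1 := card_natIcc_dvd (lo := lo) hhi hd (fun _ => True)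
  simp only [and_true, Finset.filter_true] at h1
  rw [h1]
  have h2 := abs_card_natIcc_sub_le (lo := lo / d) (hi := hi / d) (by positivity) (by positivity)
  have h3 : max 0 (hi - lo) / d = max 0 (hi / d - lo / d) := by
    rw [← sub_div, max_div_div_right hd'.le 0 (hi - lo) |>.symm, zero_div]
  rwa [h3]

/-- Möbius inversion over the divisors of `M`, each of which costs an error of at most `1`. -/
lemma abs_card_coprime_sub_le {lo hi : ℝ} (hlo : 0 ≤ lo) (hhi : 0 ≤ hi) {M : ℕ} (hM : 0 < M) :
    |(((natIcc lo hi).filter (fun j => Nat.Coprime j M)).card : ℝ) -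
      (M.totient : ℝ) / M * max 0 (hi - lo)| ≤ M.divisors.card := by
  have h1 : (((natIcc lo hi).filter (fun j => Nat.Coprime j M)).card : ℝ) =
      ∑ d ∈ M.divisors, (ArithmeticFunction.moebius d : ℝ) *
        ((natIcc lo hi).filter (fun j => d ∣ j)).card := by
    rw [Finset.card_filter]
    push_cast
    simp_rw [ite_coprime_eq_sum_moebius _ M hM]
    rw [Finset.sum_comm]
    refine Finset.sum_congr rfl fun d _ => ?_
    rw [← Finset.sum_filter, Finset.sum_const, nsmul_eq_mul, mul_comm]
  rw [h1, ← sum_moebius_div M hM, Finset.sum_mul, ← Finset.sum_sub_distrib]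
  calc _ ≤ ∑ d ∈ M.divisors, (1 : ℝ) := by
        refine (Finset.abs_sum_le_sum_abs _ _).trans (Finset.sum_le_sum fun d hd => ?_)
        have h2 : (ArithmeticFunction.moebius d : ℝ) *
            ((natIcc lo hi).filter (fun j => d ∣ j)).card -
            (ArithmeticFunction.moebius d : ℝ) / d * max 0 (hi - lo) =
            (ArithmeticFunction.moebius d : ℝ) *
            (((natIcc lo hi).filter (fun j => d ∣ j)).card - max 0 (hi - lo) / d) := by ring
        rw [h2, abs_mul]
        exact mul_le_one₀ (abs_moebius_le_one d) (abs_nonneg _)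
          (abs_card_natIcc_dvd_sub_le hlo hhi (Nat.pos_of_mem_divisors hd))
    _ = _ := by simp

/-! ### Solutions of `q ∣ a t j + D` with `a` coprime to `q` -/

/-- A unit with prescribed residue mod `M` is determined by the quotient of its representative by
`M`, which is less than `g`. -/
lemma card_unitsMap_fiber_le (g M : ℕ) [NeZero M] [NeZero (g * M)] (r : (ZMod M)ˣ) :
    (Finset.univ.filter fun u : (ZMod (g * M))ˣ =>
      ZMod.unitsMap (Dvd.intro_left g rfl) u = r).card ≤ g := by
  have hM : 0 < M := NeZero.pos M
  have key : (Finset.univ.filter fun u : (ZMod (g * M))ˣ =>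
      ZMod.unitsMap (Dvd.intro_left g rfl) u = r).card ≤ (Finset.range g).card := by
    have hmod : ∀ u : (ZMod (g * M))ˣ, ZMod.unitsMap (Dvd.intro_left g rfl) u = r →
        (u : ZMod (g * M)).val % M = (r : ZMod M).val := by
      intro u hu
      rw [← hu, ZMod.unitsMap_val, ZMod.cast_eq_val, ZMod.val_natCast]
    refine Finset.card_le_card_of_injOn (fun u => (u : ZMod (g * M)).val / M) ?_ ?_
    · intro u _
      simp only [Finset.coe_range, Set.mem_Iio]
      rw [Nat.div_lt_iff_lt_mul hM]
      exact ZMod.val_lt _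
    · intro x hx y hy hxy
      simp only [Finset.coe_filter, Finset.mem_univ, true_and, Set.mem_ofPred_eq] at hx hy
      simp only at hxy
      refine Units.ext (ZMod.val_injective _ ?_)
      rw [← Nat.div_add_mod (x : ZMod (g * M)).val M, ← Nat.div_add_mod (y : ZMod (g * M)).val M,
        hxy, hmod x hx, hmod y hy]
  simpa using key

lemma card_unitsMap_fiber_mul (g M : ℕ) [NeZero M] [NeZero (g * M)] (r : (ZMod M)ˣ) :
    (Finset.univ.filter fun u : (ZMod (g * M))ˣ =>
      ZMod.unitsMap (Dvd.intro_left g rfl) u = r).card * M.totient = (g * M).totient := by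
  classical
  have hs := ZMod.unitsMap_surjective (n := M) (m := g * M) (Dvd.intro_left g rfl)
  have h1 : ∀ s : (ZMod M)ˣ, (Finset.univ.filter fun u : (ZMod (g * M))ˣ =>
      ZMod.unitsMap (Dvd.intro_left g rfl) u = s).card =
      (Finset.univ.filter fun u : (ZMod (g * M))ˣ =>
      ZMod.unitsMap (Dvd.intro_left g rfl) u = r).card := fun s =>
    MonoidHom.card_fiber_eq_of_mem_range _ (hs s) (hs r)
  have h2 := Finset.card_eq_sum_card_fiberwise (s := (Finset.univ : Finset (ZMod (g * M))ˣ))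
    (t := Finset.univ) (f := ZMod.unitsMap (n := M) (Dvd.intro_left g rfl))
    (fun _ _ => Finset.mem_univ _)
  rw [Finset.card_univ, ZMod.card_units_eq_totient] at h2
  rw [h2, Finset.sum_congr rfl (fun s _ => h1 s), Finset.sum_const, Finset.card_univ,
    ZMod.card_units_eq_totient, smul_eq_mul, mul_comm]

/-- Cancelling `g` leaves a congruence mod `M` that prescribes the residue of `a`. All fibres of the
surjection of unit groups have the same size, so the answer depends on neither `i` nor `D`. -/
lemma card_coprime_dvd_eq (g M t D i : ℕ) [NeZero M] [NeZero (g * M)] (hg : 0 < g)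
    (ht : Nat.Coprime t M) (hD : Nat.Coprime D M) (hi : Nat.Coprime i M) :
    ((Finset.Icc 1 (g * M)).filter
      (fun a => Nat.Coprime a (g * M) ∧ g * M ∣ a * t * (g * i) + g * D)).card =
      (Finset.univ.filter fun u : (ZMod (g * M))ˣ =>
        ZMod.unitsMap (Dvd.intro_left g rfl) u = (1 : (ZMod M)ˣ)).card := by
  classical
  set d : (ZMod M)ˣ := ZMod.unitOfCoprime D hD with hd
  set s : (ZMod M)ˣ := ZMod.unitOfCoprime t ht with hs
  set k : (ZMod M)ˣ := ZMod.unitOfCoprime i hi with hk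
  have hsurj := ZMod.unitsMap_surjective (n := M) (m := g * M) (Dvd.intro_left g rfl)
  have h0 : (Finset.univ.filter fun u : (ZMod (g * M))ˣ =>
        ZMod.unitsMap (Dvd.intro_left g rfl) u = (-d * s⁻¹ * k⁻¹ : (ZMod M)ˣ)).card =
      (Finset.univ.filter fun u : (ZMod (g * M))ˣ =>
        ZMod.unitsMap (Dvd.intro_left g rfl) u = (1 : (ZMod M)ˣ)).card :=
    MonoidHom.card_fiber_eq_of_mem_range _ (hsurj _) (hsurj 1)
  rw [← h0, ← Finset.filter_filter, Finset.card_filter, Finset.card_filter]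
  have h3 := sum_Icc_coprime_eq_sum_units (g * M) (R := ℕ)
    (fun a => if a * t * ((g * i : ℕ) : ZMod (g * M)) + ((g * D : ℕ) : ZMod (g * M)) = 0
      then 1 else 0)
  refine Eq.trans (Finset.sum_congr rfl fun a _ => ?_) (h3.trans
    (Finset.sum_congr rfl fun u _ => ?_))
  · refine if_congr ?_ rfl rfl
    rw [← ZMod.natCast_eq_zero_iff, Nat.cast_add, Nat.cast_mul _ (g * i), Nat.cast_mul a t]
  · refine if_congr ?_ rfl rfl
    have h1 : (u : ZMod (g * M)) * t * ((g * i : ℕ) : ZMod (g * M)) +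
        ((g * D : ℕ) : ZMod (g * M)) = 0 ↔ (M ∣ (u : ZMod (g * M)).val * t * i + D) := by
      have h2 : (u : ZMod (g * M)) * t * ((g * i : ℕ) : ZMod (g * M)) +
          ((g * D : ℕ) : ZMod (g * M)) =
          ((g * ((u : ZMod (g * M)).val * t * i + D) : ℕ) : ZMod (g * M)) := by
        conv_lhs => rw [← ZMod.natCast_zmod_val (u : ZMod (g * M))]
        push_cast
        ring
      rw [h2, ZMod.natCast_eq_zero_iff]
      exact Nat.mul_dvd_mul_iff_left hg
    rw [h1, ← ZMod.natCast_eq_zero_iff, Units.ext_iff, ZMod.unitsMap_val, ZMod.cast_eq_val]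
    push_cast
    have et : (t : ZMod M) = (s : ZMod M) := by simp [hs]
    have ei : (i : ZMod M) = (k : ZMod M) := by simp [hk]
    have eD : (D : ZMod M) = (d : ZMod M) := by simp [hd]
    rw [et, ei, eD]
    have e1 : (s : ZMod M) * ((s⁻¹ : (ZMod M)ˣ) : ZMod M) = 1 := Units.mul_inv s
    have e2 : (k : ZMod M) * ((k⁻¹ : (ZMod M)ˣ) : ZMod M) = 1 := Units.mul_inv k
    generalize (s : ZMod M) = x at *
    generalize ((s⁻¹ : (ZMod M)ˣ) : ZMod M) = x' at *
    generalize (k : ZMod M) = y at *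
    generalize ((k⁻¹ : (ZMod M)ˣ) : ZMod M) = y' at *
    generalize (((u : ZMod (g * M)).val : ℕ) : ZMod M) = w
    constructor
    · intro h4
      linear_combination (x' * y') * h4 - w * (y * y') * e1 - w * e2
    · intro h4
      linear_combination (x * y) * h4 - (d : ZMod M) * (y * y') * e1 - (d : ZMod M) * e2

/-- The count of solutions `(a, j)` of `q ∣ a t j + D` with `a` a reduced residue and `j` in a
real interval. -/
lemma abs_sum_card_dvd_sub_le (q t D : ℕ) (hq : 0 < q) (hD : 0 < D) (ht : Nat.Coprime t q)
    {lo hi : ℝ} (hlo : 0 ≤ lo) (hhi : 0 ≤ hi) :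
    |∑ a ∈ (Finset.Icc 1 q).filter (fun a => Nat.Coprime a q),
        (((natIcc lo hi).filter fun j => q ∣ a * t * j + D).card : ℝ) -
      (q.totient : ℝ) / q * max 0 (hi - lo)| ≤ D * q.divisors.card := by
  classical
  obtain ⟨g, hg⟩ : ∃ g, g = Nat.gcd D q := ⟨_, rfl⟩
  have hgpos : 0 < g := hg ▸ Nat.gcd_pos_of_pos_left _ hD
  obtain ⟨M, hM⟩ : g ∣ q := hg ▸ Nat.gcd_dvd_right D q
  obtain ⟨D', hD'⟩ : g ∣ D := hg ▸ Nat.gcd_dvd_left D q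
  have hMpos : 0 < M := by
    rcases Nat.eq_zero_or_pos M with h | h
    · rw [h] at hM; omega
    · exact h
  have hcop : Nat.Coprime D' M := by
    have h1 := Nat.coprime_div_gcd_div_gcd (m := D) (n := q) (hg ▸ hgpos)
    rwa [← hg, Nat.div_eq_of_eq_mul_right hgpos hD', Nat.div_eq_of_eq_mul_right hgpos hM] at h1
  have : NeZero M := ⟨hMpos.ne'⟩
  have : NeZero (g * M) := ⟨(Nat.mul_pos hgpos hMpos).ne'⟩
  have htM : Nat.Coprime t M := Nat.Coprime.coprime_dvd_right (by rw [hM]; exact dvd_mul_left _ _) ht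
  set n0 := (Finset.univ.filter fun u : (ZMod (g * M))ˣ =>
      ZMod.unitsMap (Dvd.intro_left g rfl) u = (1 : (ZMod M)ˣ)).card with hn0
  have hn0mul : n0 * M.totient = q.totient := by
    rw [hM]; exact card_unitsMap_fiber_mul g M 1
  have hn0le : n0 ≤ g := card_unitsMap_fiber_le g M 1
  -- Since `a t` is prime to `q`, a solution forces `gcd(j, q) = gcd(D, q) = g`. So `j = g i` with
  -- `i` prime to `M = q/g`, and each such `j` admits the same number `n0` of residues `a`.
  have hj : ∀ j : ℕ, ((Finset.Icc 1 q).filter (fun a => Nat.Coprime a q ∧ q ∣ a * t * j + D)).card =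
      if g ∣ j ∧ Nat.Coprime (j / g) M then n0 else 0 := by
    intro j
    split_ifs with h
    · obtain ⟨⟨i, rfl⟩, h2⟩ := h
      rw [Nat.mul_div_cancel_left _ hgpos] at h2
      rw [hn0, ← card_coprime_dvd_eq g M t D' i hgpos htM hcop h2]
      congr 1
      rw [← hM, ← hD']
    · rw [Finset.card_eq_zero, Finset.filter_eq_empty_iff]
      rintro a - ⟨ha, hdvd⟩
      apply h
      have hat : Nat.Coprime (a * t) q := Nat.Coprime.mul_left ha ht
      have h1 : Nat.gcd j q = g := by
        rw [← Nat.Coprime.gcd_mul_left_cancel j hat, hg]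
        refine Nat.dvd_antisymm (Nat.dvd_gcd ?_ (Nat.gcd_dvd_right _ _))
          (Nat.dvd_gcd ?_ (Nat.gcd_dvd_right _ _))
        · exact (Nat.dvd_add_right (Nat.gcd_dvd_left _ _)).1 ((Nat.gcd_dvd_right _ _).trans hdvd)
        · exact (Nat.dvd_add_left (Nat.gcd_dvd_left _ _)).1 ((Nat.gcd_dvd_right _ _).trans hdvd)
      refine ⟨h1 ▸ Nat.gcd_dvd_left _ _, ?_⟩
      have h2 := Nat.coprime_div_gcd_div_gcd (m := j) (n := q) (by rw [h1]; exact hgpos)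
      rwa [h1, Nat.div_eq_of_eq_mul_right hgpos hM] at h2
  have hsum : ∑ a ∈ (Finset.Icc 1 q).filter (fun a => Nat.Coprime a q),
        (((natIcc lo hi).filter fun j => q ∣ a * t * j + D).card : ℝ) =
      n0 * (((natIcc (lo / g) (hi / g)).filter fun i => Nat.Coprime i M).card : ℝ) := by
    have h1 : ∑ a ∈ (Finset.Icc 1 q).filter (fun a => Nat.Coprime a q),
        ((natIcc lo hi).filter fun j => q ∣ a * t * j + D).card =
      ∑ j ∈ natIcc lo hi,
        ((Finset.Icc 1 q).filter (fun a => Nat.Coprime a q ∧ q ∣ a * t * j + D)).card := by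
      simp only [← Finset.filter_filter, Finset.card_filter _ (natIcc lo hi)]
      rw [Finset.sum_comm]
      simp only [Finset.card_filter]
    have h2 : ∑ j ∈ natIcc lo hi,
        ((Finset.Icc 1 q).filter (fun a => Nat.Coprime a q ∧ q ∣ a * t * j + D)).card =
        ((natIcc lo hi).filter (fun j => g ∣ j ∧ Nat.Coprime (j / g) M)).card * n0 := by
      simp_rw [hj]
      rw [← Finset.sum_filter, Finset.sum_const, smul_eq_mul]
    rw [card_natIcc_dvd hhi hgpos] at h2
    simp_rw [Nat.mul_div_cancel_left _ hgpos] at h2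
    have h3 := h1.trans h2
    have h4 := congrArg (fun n : ℕ => (n : ℝ)) h3
    push_cast at h4
    rw [h4, mul_comm]
  rw [hsum]
  have hg' : (0 : ℝ) < g := by exact_mod_cast hgpos
  have hM' : (0 : ℝ) < M := by exact_mod_cast hMpos
  have h1 := abs_card_coprime_sub_le (lo := lo / g) (hi := hi / g) (by positivity) (by positivity)
    hMpos
  have h3 : max 0 (hi / g - lo / g) = max 0 (hi - lo) / g := by
    rw [← sub_div, max_div_div_right hg'.le 0 (hi - lo) |>.symm, zero_div]
  -- The main terms agree because `n0 φ(M) = φ(q)` and `q = g M`; the error is `n0 ≤ g ≤ D` times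
  -- the number of divisors of `M`.
  have h4 : (q.totient : ℝ) / q * max 0 (hi - lo) =
      n0 * ((M.totient : ℝ) / M * max 0 (hi / g - lo / g)) := by
    have h7 : (q.totient : ℝ) = n0 * M.totient := by exact_mod_cast hn0mul.symm
    have h8 : (q : ℝ) = g * M := by exact_mod_cast hM
    rw [h3, h7, h8]; field_simp
  rw [h4, ← mul_sub, abs_mul, abs_of_nonneg (Nat.cast_nonneg n0)]
  have h5 : (n0 : ℝ) ≤ D := by exact_mod_cast hn0le.trans (Nat.le_of_dvd hD ⟨D', hD'⟩)
  have h6 : (M.divisors.card : ℝ) ≤ q.divisors.card := by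
    exact_mod_cast Finset.card_le_card (Nat.divisors_subset_of_dvd hq.ne' ⟨g, by rw [hM, mul_comm]⟩)
  exact mul_le_mul h5 (h1.trans h6) (abs_nonneg _) (by positivity)

/-! ### The constant `C m` -/

/-- `μ(n) / n²` for `n` coprime to `m`, and zero otherwise. -/
def mobSq (m n : ℕ) : ℝ :=
  if Nat.Coprime n m then (ArithmeticFunction.moebius n : ℝ) / (n : ℝ) ^ 2 else 0

lemma abs_mobSq_le (m n : ℕ) : |mobSq m n| ≤ 1 / (n : ℝ) ^ 2 := by
  unfold mobSq
  split_ifs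
  · rw [abs_div, abs_of_nonneg (by positivity : (0:ℝ) ≤ (n : ℝ) ^ 2)]
    exact div_le_div_of_nonneg_right (abs_moebius_le_one n) (by positivity)
  · simp

lemma summable_one_div_sq : Summable fun n : ℕ => 1 / (n : ℝ) ^ 2 :=
  Real.summable_one_div_nat_pow.2 one_lt_two

lemma summable_norm_mobSq (m : ℕ) : Summable fun n => ‖mobSq m n‖ :=
  Summable.of_nonneg_of_le (fun _ => norm_nonneg _) (fun n => abs_mobSq_le m n)
    summable_one_div_sq

lemma tsum_mobSq_prime_pow (m p : ℕ) (hp : p.Prime) :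
    ∑' e : ℕ, mobSq m (p ^ e) = if p ∣ m then 1 else 1 - 1 / (p : ℝ) ^ 2 := by
  have h0 : ∀ e ∉ Finset.range 2, mobSq m (p ^ e) = 0 := by
    intro e he
    have he2 : 2 ≤ e := by simpa [Nat.succ_le_iff] using he
    have h1 : ArithmeticFunction.moebius (p ^ e) = 0 := by
      rw [ArithmeticFunction.moebius_apply_prime_pow hp (by omega), if_neg (by omega)]
    simp [mobSq, h1]
  rw [tsum_eq_sum h0, Finset.sum_range_succ, Finset.sum_range_one, pow_zero, pow_one]
  have h1 : mobSq m 1 = 1 := by simp [mobSq]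
  rw [h1, mobSq]
  by_cases hpm : p ∣ m
  · rw [if_pos hpm, if_neg]
    · simp
    · rw [Nat.Prime.coprime_iff_not_dvd hp]; exact fun h => h hpm
  · rw [if_neg hpm, if_pos ((Nat.Prime.coprime_iff_not_dvd hp).2 hpm),
      ArithmeticFunction.moebius_apply_prime hp]
    push_cast; ring

/-- The Euler product of the absolutely convergent series has factor `1` at the primes dividing `m`,
so restricting the product to the other primes does not change it. -/
lemma C_eq_tsum (m : ℕ) : C m = (m.totient : ℝ) / m * ∑' n, mobSq m n := by
  have hmul : ∀ {a b : ℕ}, Nat.Coprime a b → mobSq m (a * b) = mobSq m a * mobSq m b := by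
    intro a b hab
    unfold mobSq
    rw [ArithmeticFunction.isMultiplicative_moebius.map_mul_of_coprime hab]
    by_cases h1 : Nat.Coprime a m
    · by_cases h2 : Nat.Coprime b m
      · rw [if_pos (Nat.coprime_mul_iff_left.2 ⟨h1, h2⟩), if_pos h1, if_pos h2]
        push_cast
        ring
      · rw [if_neg (fun h => h2 (Nat.coprime_mul_iff_left.1 h).2), if_neg h2, mul_zero]
    · rw [if_neg (fun h => h1 (Nat.coprime_mul_iff_left.1 h).1), if_neg h1, zero_mul]
  have h1 := EulerProduct.eulerProduct_hasProd (f := mobSq m) (by simp [mobSq]) hmul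
    (summable_norm_mobSq m) (by simp [mobSq])
  have h2 : (fun p : Nat.Primes => ∑' e : ℕ, mobSq m ((p : ℕ) ^ e)) =
      fun p : Nat.Primes => if (p : ℕ) ∣ m then 1 else 1 - 1 / ((p : ℕ) : ℝ) ^ 2 := by
    funext p
    exact tsum_mobSq_prime_pow m p p.2
  rw [h2] at h1
  set i : {p : ℕ // p.Prime ∧ ¬ p ∣ m} → Nat.Primes := fun p => ⟨p.1, p.2.1⟩ with hi
  have hinj : Function.Injective i := by
    intro a b hab
    have : (i a : ℕ) = (i b : ℕ) := congrArg Subtype.val hab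
    exact Subtype.ext this
  rw [← hinj.hasProd_iff] at h1
  · rw [C, ← h1.tprod_eq]
    congr 1
    refine tprod_congr fun p => ?_
    exact (if_neg p.2.2).symm
  · intro p hp
    by_cases hpm : (p : ℕ) ∣ m
    · simp [hpm]
    · exact absurd ⟨⟨p.1, p.2, hpm⟩, rfl⟩ hp

/-- The term at `1` is `1` and every other term is at least `-1/n²`, so the sum is at least `2 -
π²/6`. -/
lemma tsum_mobSq_pos (m : ℕ) : 0 < ∑' n, mobSq m n := by
  have h1 : HasSum (fun n : ℕ => 1 / (n : ℝ) ^ 2) (Real.pi ^ 2 / 6) := hasSum_zeta_two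
  have h2 : HasSum (fun n : ℕ => if n = 1 then (2 : ℝ) else 0) 2 := hasSum_ite_eq 1 2
  have h3 := (h2.sub h1)
  have h4 : ∀ n : ℕ, (if n = 1 then (2 : ℝ) else 0) - 1 / (n : ℝ) ^ 2 ≤ mobSq m n := by
    intro n
    by_cases hn : n = 1
    · subst hn; simp [mobSq]; norm_num
    · rw [if_neg hn, zero_sub]
      exact (abs_le.1 (abs_mobSq_le m n)).1
  have h5 := hasSum_le h4 h3 (summable_norm_mobSq m).of_norm.hasSum
  have h6 : Real.pi ^ 2 < 10 := by nlinarith [Real.pi_lt_d2, Real.pi_gt_three]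
  linarith

lemma C_pos (m : ℕ) (hm : 0 < m) : 0 < C m := by
  rw [C_eq_tsum]
  have h1 : (0 : ℝ) < m := by exact_mod_cast hm
  have h2 : (0 : ℝ) < m.totient := by exact_mod_cast Nat.totient_pos.2 hm
  have := tsum_mobSq_pos m
  positivity

lemma abs_tsum_mobSq_sub_le (m Q : ℕ) (hQ : 0 < Q) :
    |∑ d ∈ Finset.Icc 1 Q, mobSq m d - ∑' n, mobSq m n| ≤ 1 / Q := by
  have hs := (summable_norm_mobSq m).of_norm
  have htend := hs.hasSum.tendsto_sum_nat
  have h0 : mobSq m 0 = 0 := by simp [mobSq]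
  have hrange : ∀ N : ℕ, ∑ d ∈ Finset.range (N + 1), mobSq m d = ∑ d ∈ Finset.Icc 1 N, mobSq m d := by
    intro N
    rw [Finset.range_eq_Ico, Finset.sum_eq_sum_Ico_succ_bot (by omega), h0, zero_add]
    rfl
  have hbound : ∀ N ≥ Q, |∑ d ∈ Finset.Icc 1 Q, mobSq m d - ∑ d ∈ Finset.Icc 1 N, mobSq m d| ≤
      1 / Q := by
    intro N hN
    have h1 : ∑ d ∈ Finset.Icc 1 N, mobSq m d =
        ∑ d ∈ Finset.Icc 1 Q, mobSq m d + ∑ d ∈ Finset.Ioc Q N, mobSq m d := by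
      rw [← Finset.sum_union]
      · congr 1; ext x; simp; omega
      · rw [Finset.disjoint_left]; intro x hx hy
        simp at hx hy; omega
    rw [h1, sub_add_cancel_left, abs_neg]
    calc |∑ d ∈ Finset.Ioc Q N, mobSq m d| ≤ ∑ d ∈ Finset.Ioc Q N, ((d : ℝ) ^ 2)⁻¹ := by
          refine (Finset.abs_sum_le_sum_abs _ _).trans (Finset.sum_le_sum fun d _ => ?_)
          rw [← one_div]
          exact abs_mobSq_le m d
      _ ≤ (Q : ℝ)⁻¹ - (N : ℝ)⁻¹ := sum_Ioc_inv_sq_le_sub hQ.ne' hN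
      _ ≤ 1 / Q := by rw [one_div]; simp
  have h2 : Tendsto (fun N => |∑ d ∈ Finset.Icc 1 Q, mobSq m d - ∑ d ∈ Finset.Icc 1 N, mobSq m d|)
      atTop (𝓝 |∑ d ∈ Finset.Icc 1 Q, mobSq m d - ∑' n, mobSq m n|) := by
    refine (tendsto_const_nhds.sub ?_).abs
    have := htend.comp (tendsto_add_atTop_nat 1)
    refine this.congr fun N => ?_
    exact hrange N
  exact le_of_tendsto h2 (eventually_atTop.2 ⟨Q, hbound⟩)

/-! ### Weighted sums of `φ(q) / q` -/

lemma sum_Icc_filter_dvd {R : Type*} [AddCommMonoid R] (Q d : ℕ) (hd : 0 < d) (H : ℕ → R) :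
    ∑ q ∈ (Finset.Icc 1 Q).filter (fun q => d ∣ q), H q =
      ∑ k ∈ Finset.Icc 1 (Q / d), H (d * k) := by
  symm
  refine Finset.sum_bij (fun k _ => d * k) ?_ ?_ ?_ ?_
  · intro k hk
    rw [Finset.mem_Icc] at hk
    rw [Finset.mem_filter, Finset.mem_Icc]
    exact ⟨⟨Nat.mul_pos hd hk.1, by
      rw [mul_comm]; exact (Nat.le_div_iff_mul_le hd).1 hk.2⟩, dvd_mul_right _ _⟩
  · intro a _ b _ hab; exact Nat.eq_of_mul_eq_mul_left hd hab
  · intro b hb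
    rw [Finset.mem_filter, Finset.mem_Icc] at hb
    obtain ⟨⟨h1, h2⟩, ⟨k, rfl⟩⟩ := hb
    refine ⟨k, Finset.mem_Icc.2 ⟨Nat.pos_of_mul_pos_left h1, ?_⟩, rfl⟩
    rw [Nat.le_div_iff_mul_le hd, mul_comm]; exact h2
  · intro _ _; rfl

/-- Interchange the sums: each `d` has at most `Q/d` multiples up to `Q`. -/
lemma sum_card_divisors_le (Q : ℕ) :
    ∑ q ∈ Finset.Icc 1 Q, (q.divisors.card : ℝ) ≤ Q * (1 + Real.log Q) := by
  have h1 : ∀ q ∈ Finset.Icc 1 Q, (q.divisors.card : ℝ) =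
      ∑ d ∈ Finset.Icc 1 Q, if d ∣ q then (1 : ℝ) else 0 := by
    intro q hq
    rw [Finset.mem_Icc] at hq
    rw [Finset.sum_ite, Finset.sum_const_zero, add_zero, Finset.sum_const, nsmul_eq_mul, mul_one]
    congr 2
    ext d
    simp only [Nat.mem_divisors, Finset.mem_filter, Finset.mem_Icc]
    constructor
    · rintro ⟨h, h0⟩
      exact ⟨⟨Nat.pos_of_dvd_of_pos h hq.1, (Nat.le_of_dvd hq.1 h).trans hq.2⟩, h⟩
    · rintro ⟨_, h⟩; exact ⟨h, by omega⟩
  rw [Finset.sum_congr rfl h1, Finset.sum_comm]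
  calc _ ≤ ∑ d ∈ Finset.Icc 1 Q, (Q : ℝ) * (1 / d) := by
        refine Finset.sum_le_sum fun d hd => ?_
        rw [Finset.mem_Icc] at hd
        rw [← Finset.sum_filter, sum_Icc_filter_dvd Q d hd.1]
        simp only [Finset.sum_const, Nat.card_Icc, Nat.add_sub_cancel, nsmul_eq_mul, mul_one]
        rw [mul_one_div]
        exact Nat.cast_div_le
    _ ≤ _ := by
        rw [← Finset.mul_sum]
        exact mul_le_mul_of_nonneg_left (sum_Icc_one_div_le Q) (by positivity)

/-- Riemann sum with step `h` for a nonnegative increasing function. Only monotonicity is needed,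
which suits the ramp-shaped weights to which it is applied. -/
lemma abs_sum_mul_sub_integral_le {F : ℝ → ℝ} {B : ℝ} (Q h : ℕ) (hh : 0 < h)
    (hF : MonotoneOn F (Set.Icc 0 (Q : ℝ))) (h0 : 0 ≤ F 0) (hB : F Q ≤ B) :
    |∑ j ∈ Finset.Icc 1 (Q / h), F ((h * j : ℕ) : ℝ) - (1 / h) * ∫ t in (0 : ℝ)..Q, F t| ≤ B := by
  have hh' : (0 : ℝ) < h := by exact_mod_cast hh
  set n := Q / h with hn
  have hnQ : h * n ≤ Q := Nat.mul_div_le Q h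
  have hnQ' : (h : ℝ) * n ≤ Q := by exact_mod_cast hnQ
  have hQn : (Q : ℝ) ≤ h * n + h := by
    have : Q < h * n + h := by
      have := Nat.lt_mul_div_succ Q hh
      rw [hn]; linarith [this, Nat.mul_succ h (Q / h)]
    exact_mod_cast this.le
  have hQ0 : (0 : ℝ) ≤ Q := Nat.cast_nonneg Q
  have hmem0 : (0 : ℝ) ∈ Set.Icc (0 : ℝ) Q := ⟨le_rfl, hQ0⟩
  have hmemQ : (Q : ℝ) ∈ Set.Icc (0 : ℝ) Q := ⟨hQ0, le_rfl⟩
  have hnn : ∀ t ∈ Set.Icc (0 : ℝ) Q, 0 ≤ F t := fun t ht => h0.trans (hF hmem0 ht ht.1)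
  have hle : ∀ t ∈ Set.Icc (0 : ℝ) Q, F t ≤ B := fun t ht => (hF ht hmemQ ht.2).trans hB
  set f : ℝ → ℝ := fun u => F (h * u) with hf
  have hfm : MonotoneOn f (Set.Icc 0 (0 + (n : ℝ))) := by
    intro a ha b hb hab
    rw [zero_add] at ha hb
    refine hF ⟨?_, ?_⟩ ⟨?_, ?_⟩ ?_
    · have := ha.1; positivity
    · exact (mul_le_mul_of_nonneg_left ha.2 hh'.le).trans hnQ'
    · have := hb.1; positivity
    · exact (mul_le_mul_of_nonneg_left hb.2 hh'.le).trans hnQ'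
    · exact mul_le_mul_of_nonneg_left hab hh'.le
  have h1 := hfm.sum_le_integral
  have h2 := hfm.integral_le_sum
  simp only [zero_add] at h1 h2
  have hS : ∑ j ∈ Finset.Icc 1 n, F ((h * j : ℕ) : ℝ) = ∑ i ∈ Finset.range n, f ((i + 1 : ℕ) : ℝ) := by
    rw [Finset.range_eq_Ico, Finset.sum_Ico_add' (fun i => f ((i : ℕ) : ℝ)) 0 n 1]
    refine Finset.sum_congr (by ext; simp) fun j _ => ?_
    simp [hf]
  have hdiff : ∑ i ∈ Finset.range n, f ((i + 1 : ℕ) : ℝ) - ∑ i ∈ Finset.range n, f (i : ℝ) =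
      f n - f 0 := by
    rw [← Finset.sum_sub_distrib]
    have := Finset.sum_range_sub (fun i : ℕ => f (i : ℝ)) n
    simpa using this
  have hint : ∫ u in (0 : ℝ)..n, f u = (1 / h) * ∫ t in (0 : ℝ)..(h * n), F t := by
    rw [hf]
    simp only
    rw [intervalIntegral.integral_comp_mul_left F hh'.ne']
    simp
  have hi1 : IntervalIntegrable F volume 0 Q := by
    apply MonotoneOn.intervalIntegrable
    rwa [Set.uIcc_of_le hQ0]
  have hi2 : IntervalIntegrable F volume 0 (h * n) := by
    apply hi1.mono_set
    rw [Set.uIcc_of_le hQ0, Set.uIcc_of_le (by positivity)]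
    exact Set.Icc_subset_Icc_right hnQ'
  have hi3 : IntervalIntegrable F volume (h * n) Q := by
    apply hi1.mono_set
    rw [Set.uIcc_of_le hQ0, Set.uIcc_of_le hnQ']
    exact Set.Icc_subset_Icc_left (by positivity)
  have hsplit := intervalIntegral.integral_add_adjacent_intervals hi2 hi3
  have htail0 : 0 ≤ ∫ t in (h * n : ℝ)..Q, F t := by
    refine intervalIntegral.integral_nonneg hnQ' fun t ht => hnn t ⟨?_, ht.2⟩
    exact le_trans (by positivity) ht.1
  have htail1 : ∫ t in (h * n : ℝ)..Q, F t ≤ h * B := by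
    have hB0 : 0 ≤ B := (hnn _ hmemQ).trans hB
    calc ∫ t in (h * n : ℝ)..Q, F t ≤ ∫ t in (h * n : ℝ)..Q, B := by
          refine intervalIntegral.integral_mono_on hnQ' hi3 (by simp) fun t ht => hle t ⟨?_, ht.2⟩
          exact le_trans (by positivity) ht.1
      _ = (Q - h * n) * B := by simp
      _ ≤ h * B := mul_le_mul_of_nonneg_right (by linarith) hB0
  have hfn : f n - f 0 ≤ B := by
    have a1 : f n ≤ B := hle _ ⟨by positivity, hnQ'⟩
    have a2 : 0 ≤ f 0 := by simpa [hf] using h0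
    linarith
  have hfin : (1 / (h : ℝ)) * ∫ t in (0 : ℝ)..Q, F t =
      (∫ u in (0 : ℝ)..n, f u) + (1 / h) * ∫ t in (h * n : ℝ)..Q, F t := by
    rw [hint, ← hsplit]; ring
  have htail2 : (1 / (h : ℝ)) * ∫ t in (h * n : ℝ)..Q, F t ≤ B := by
    calc (1 / (h : ℝ)) * ∫ t in (h * n : ℝ)..Q, F t ≤ (1 / h) * (h * B) :=
          mul_le_mul_of_nonneg_left htail1 (by positivity)
      _ = B := by field_simp
  have htail3 : 0 ≤ (1 / (h : ℝ)) * ∫ t in (h * n : ℝ)..Q, F t := by positivity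
  -- The right Riemann sum exceeds the integral up to `h n` by at most `B`, and the missing tail, of
  -- length at most `h`, is also worth at most `B`. The two errors have opposite signs, so the total
  -- stays within `B` rather than `2B`.
  rw [hS, hfin, abs_le]
  constructor <;> linarith

lemma abs_sum_coprime_mul_sub_integral_le {F : ℝ → ℝ} {B : ℝ} (m Q d : ℕ) (hm : 0 < m) (hd : 0 < d)
    (hF : MonotoneOn F (Set.Icc 0 (Q : ℝ))) (h0 : 0 ≤ F 0) (hB : F Q ≤ B) :
    |∑ k ∈ (Finset.Icc 1 (Q / d)).filter (fun k => Nat.Coprime k m), F ((d * k : ℕ) : ℝ) -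
      (m.totient : ℝ) / m * ((1 / d) * ∫ t in (0 : ℝ)..Q, F t)| ≤ m.divisors.card * B := by
  have h1 : ∑ k ∈ (Finset.Icc 1 (Q / d)).filter (fun k => Nat.Coprime k m), F ((d * k : ℕ) : ℝ) =
      ∑ t ∈ m.divisors, (ArithmeticFunction.moebius t : ℝ) *
        ∑ j ∈ Finset.Icc 1 (Q / (d * t)), F ((d * t * j : ℕ) : ℝ) := by
    rw [Finset.sum_filter]
    calc _ = ∑ k ∈ Finset.Icc 1 (Q / d), ∑ t ∈ m.divisors,
          if t ∣ k then (ArithmeticFunction.moebius t : ℝ) * F ((d * k : ℕ) : ℝ) else 0 := by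
          refine Finset.sum_congr rfl fun k _ => ?_
          have := ite_coprime_eq_sum_moebius k m hm
          calc (if Nat.Coprime k m then F ((d * k : ℕ) : ℝ) else 0)
              = (if Nat.Coprime k m then (1 : ℝ) else 0) * F ((d * k : ℕ) : ℝ) := by
                split_ifs <;> simp
            _ = _ := by
                rw [this, Finset.sum_mul]
                refine Finset.sum_congr rfl fun t _ => ?_
                split_ifs <;> simp
      _ = _ := by
          rw [Finset.sum_comm]
          refine Finset.sum_congr rfl fun t ht => ?_
          rw [← Finset.sum_filter, sum_Icc_filter_dvd _ t (Nat.pos_of_mem_divisors ht),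
            Finset.mul_sum, Nat.div_div_eq_div_mul]
          simp_rw [mul_assoc]
  rw [h1, ← sum_moebius_div m hm, Finset.sum_mul, ← Finset.sum_sub_distrib]
  refine (Finset.abs_sum_le_sum_abs _ _).trans ?_
  calc _ ≤ ∑ t ∈ m.divisors, B := by
        refine Finset.sum_le_sum fun t ht => ?_
        have htpos := Nat.pos_of_mem_divisors ht
        have h2 := abs_sum_mul_sub_integral_le (F := F) Q (d * t) (Nat.mul_pos hd htpos) hF h0 hB
        have h3 : (ArithmeticFunction.moebius t : ℝ) *
            ∑ j ∈ Finset.Icc 1 (Q / (d * t)), F ((d * t * j : ℕ) : ℝ) -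
            (ArithmeticFunction.moebius t : ℝ) / t * ((1 / d) * ∫ t in (0 : ℝ)..Q, F t) =
            (ArithmeticFunction.moebius t : ℝ) *
            (∑ j ∈ Finset.Icc 1 (Q / (d * t)), F ((d * t * j : ℕ) : ℝ) -
              (1 / ((d * t : ℕ) : ℝ)) * ∫ t in (0 : ℝ)..Q, F t) := by
          have : (0 : ℝ) < t := by exact_mod_cast htpos
          have : (0 : ℝ) < d := by exact_mod_cast hd
          push_cast
          field_simp
        rw [h3, abs_mul]
        calc _ ≤ 1 * B := mul_le_mul (abs_moebius_le_one t) h2 (abs_nonneg _) zero_le_one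
          _ = B := one_mul B
    _ = _ := by simp

/-- The mean value of `φ(q) / q` over `q` coprime to `m`, against a monotone weight. -/
lemma abs_sum_totient_div_mul_sub_le {F : ℝ → ℝ} {B : ℝ} (m Q : ℕ) (hm : 0 < m) (hQ : 0 < Q)
    (hF : MonotoneOn F (Set.Icc 0 (Q : ℝ))) (h0 : 0 ≤ F 0) (hB : F Q ≤ B) :
    |∑ q ∈ (Finset.Icc 1 Q).filter (fun q => Nat.Coprime q m), (q.totient : ℝ) / q * F q -
      C m * ∫ t in (0 : ℝ)..Q, F t| ≤ (m.divisors.card + 1) * B * (1 + Real.log Q) := by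
  have hQ' : (0 : ℝ) < Q := by exact_mod_cast hQ
  set I := ∫ t in (0 : ℝ)..Q, F t with hI
  have hmem0 : (0 : ℝ) ∈ Set.Icc (0 : ℝ) Q := ⟨le_rfl, hQ'.le⟩
  have hmemQ : (Q : ℝ) ∈ Set.Icc (0 : ℝ) Q := ⟨hQ'.le, le_rfl⟩
  have hnn : ∀ t ∈ Set.Icc (0 : ℝ) Q, 0 ≤ F t := fun t ht => h0.trans (hF hmem0 ht ht.1)
  have hB0 : 0 ≤ B := (hnn _ hmemQ).trans hB
  have hI0 : 0 ≤ I := intervalIntegral.integral_nonneg hQ'.le hnn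
  have hI1 : I ≤ Q * B := by
    calc I ≤ ∫ t in (0 : ℝ)..Q, B := by
          refine intervalIntegral.integral_mono_on hQ'.le ?_ (by simp)
            fun t ht => (hF ht hmemQ ht.2).trans hB
          apply MonotoneOn.intervalIntegrable
          rwa [Set.uIcc_of_le hQ'.le]
      _ = Q * B := by simp
  -- Expand `φ(q)/q` as the sum of `μ(d)/d` over `d ∣ q` and write `q = d k`; coprimality to `m`
  -- splits between `d` and `k`.
  have h1 : ∑ q ∈ (Finset.Icc 1 Q).filter (fun q => Nat.Coprime q m), (q.totient : ℝ) / q * F q =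
      ∑ d ∈ (Finset.Icc 1 Q).filter (fun d => Nat.Coprime d m),
        (ArithmeticFunction.moebius d : ℝ) / d *
        ∑ k ∈ (Finset.Icc 1 (Q / d)).filter (fun k => Nat.Coprime k m), F ((d * k : ℕ) : ℝ) := by
    calc _ = ∑ q ∈ Finset.Icc 1 Q, ∑ d ∈ Finset.Icc 1 Q, if d ∣ q then
          (if Nat.Coprime q m then (ArithmeticFunction.moebius d : ℝ) / d * F q else 0) else 0 := by
          rw [Finset.sum_filter]
          refine Finset.sum_congr rfl fun q hq => ?_
          rw [Finset.mem_Icc] at hq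
          rw [← Finset.sum_filter]
          have hdiv : (Finset.Icc 1 Q).filter (fun d => d ∣ q) = q.divisors := by
            ext d
            simp only [Nat.mem_divisors, Finset.mem_filter, Finset.mem_Icc]
            constructor
            · rintro ⟨_, h⟩; exact ⟨h, by omega⟩
            · rintro ⟨h, _⟩
              exact ⟨⟨Nat.pos_of_dvd_of_pos h hq.1, (Nat.le_of_dvd hq.1 h).trans hq.2⟩, h⟩
          rw [hdiv]
          split_ifs
          · rw [← sum_moebius_div q hq.1, Finset.sum_mul]
          · simp
      _ = ∑ d ∈ Finset.Icc 1 Q, ∑ k ∈ Finset.Icc 1 (Q / d),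
          if Nat.Coprime (d * k) m then (ArithmeticFunction.moebius d : ℝ) / d * F ((d * k : ℕ) : ℝ)
            else 0 := by
          rw [Finset.sum_comm]
          refine Finset.sum_congr rfl fun d hd => ?_
          rw [Finset.mem_Icc] at hd
          rw [← Finset.sum_filter, sum_Icc_filter_dvd Q d hd.1]
      _ = _ := by
          rw [Finset.sum_filter]
          refine Finset.sum_congr rfl fun d hd => ?_
          rw [Finset.sum_filter, Finset.mul_sum]
          split_ifs with h
          · refine Finset.sum_congr rfl fun k _ => ?_
            by_cases hk : Nat.Coprime k m
            · rw [if_pos (Nat.coprime_mul_iff_left.2 ⟨h, hk⟩), if_pos hk]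
            · rw [if_neg (fun h => hk (Nat.coprime_mul_iff_left.1 h).2), if_neg hk, mul_zero]
          · refine Finset.sum_eq_zero fun k _ => ?_
            rw [if_neg (fun h' => h (Nat.coprime_mul_iff_left.1 h').1)]
  have h2 : |∑ d ∈ (Finset.Icc 1 Q).filter (fun d => Nat.Coprime d m),
        (ArithmeticFunction.moebius d : ℝ) / d *
        ∑ k ∈ (Finset.Icc 1 (Q / d)).filter (fun k => Nat.Coprime k m), F ((d * k : ℕ) : ℝ) -
      ∑ d ∈ (Finset.Icc 1 Q).filter (fun d => Nat.Coprime d m),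
        (ArithmeticFunction.moebius d : ℝ) / d * ((m.totient : ℝ) / m * ((1 / d) * I))| ≤
      m.divisors.card * B * (1 + Real.log Q) := by
    rw [← Finset.sum_sub_distrib]
    refine (Finset.abs_sum_le_sum_abs _ _).trans ?_
    calc _ ≤ ∑ d ∈ (Finset.Icc 1 Q).filter (fun d => Nat.Coprime d m),
          (m.divisors.card * B) * (1 / (d : ℝ)) := by
          refine Finset.sum_le_sum fun d hd => ?_
          have hdpos : 0 < d := (Finset.mem_Icc.1 (Finset.mem_filter.1 hd).1).1
          have h3 := abs_sum_coprime_mul_sub_integral_le (F := F) m Q d hm hdpos hF h0 hB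
          rw [← mul_sub, abs_mul, mul_comm]
          refine mul_le_mul h3 ?_ (abs_nonneg _) (by positivity)
          rw [abs_div, Nat.abs_cast]
          exact div_le_div_of_nonneg_right (abs_moebius_le_one d) (by positivity)
      _ ≤ ∑ d ∈ Finset.Icc 1 Q, (m.divisors.card * B) * (1 / (d : ℝ)) :=
          Finset.sum_le_sum_of_subset_of_nonneg (Finset.filter_subset _ _)
            (fun _ _ _ => by positivity)
      _ ≤ _ := by
          rw [← Finset.mul_sum]
          exact mul_le_mul_of_nonneg_left (sum_Icc_one_div_le Q) (by positivity)
  have h3 : ∑ d ∈ (Finset.Icc 1 Q).filter (fun d => Nat.Coprime d m),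
        (ArithmeticFunction.moebius d : ℝ) / d * ((m.totient : ℝ) / m * ((1 / d) * I)) =
      (m.totient : ℝ) / m * I * ∑ d ∈ Finset.Icc 1 Q, mobSq m d := by
    rw [Finset.sum_filter, Finset.mul_sum]
    refine Finset.sum_congr rfl fun d _ => ?_
    unfold mobSq
    split_ifs
    · rw [sq]; ring
    · simp
  -- Completing the truncated series for `C m` costs a tail of at most `1/Q`, against `I ≤ Q B`.
  have h4 : |(m.totient : ℝ) / m * I * ∑ d ∈ Finset.Icc 1 Q, mobSq m d - C m * I| ≤ B := by
    rw [C_eq_tsum]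
    have h5 : (m.totient : ℝ) / m * I * ∑ d ∈ Finset.Icc 1 Q, mobSq m d -
        (m.totient : ℝ) / m * (∑' n, mobSq m n) * I = ((m.totient : ℝ) / m) *
        (I * (∑ d ∈ Finset.Icc 1 Q, mobSq m d - ∑' n, mobSq m n)) := by ring
    rw [h5, abs_mul, abs_mul, abs_of_nonneg (by positivity : (0 : ℝ) ≤ (m.totient : ℝ) / m),
      abs_of_nonneg hI0]
    have h6 : (m.totient : ℝ) / m ≤ 1 := by
      rw [div_le_one (by exact_mod_cast hm)]
      exact_mod_cast Nat.totient_le m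
    have h7 : I * |∑ d ∈ Finset.Icc 1 Q, mobSq m d - ∑' n, mobSq m n| ≤ B := by
      calc _ ≤ (Q * B) * (1 / Q) := mul_le_mul hI1 (abs_tsum_mobSq_sub_le m Q hQ) (abs_nonneg _)
            (by positivity)
        _ = B := by field_simp
    calc _ ≤ 1 * B := mul_le_mul h6 h7 (by positivity) zero_le_one
      _ = B := one_mul B
  rw [h1]
  rw [h3] at h2
  have hlog : 0 ≤ Real.log Q := Real.log_nonneg (by exact_mod_cast hQ)
  have h8 := abs_sub_le (∑ d ∈ (Finset.Icc 1 Q).filter (fun d => Nat.Coprime d m),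
        (ArithmeticFunction.moebius d : ℝ) / d *
        ∑ k ∈ (Finset.Icc 1 (Q / d)).filter (fun k => Nat.Coprime k m), F ((d * k : ℕ) : ℝ))
    ((m.totient : ℝ) / m * I * ∑ d ∈ Finset.Icc 1 Q, mobSq m d) (C m * I)
  have h9 : B ≤ B * (1 + Real.log Q) := by nlinarith
  calc _ ≤ _ := h8
    _ ≤ m.divisors.card * B * (1 + Real.log Q) + B * (1 + Real.log Q) :=
        add_le_add h2 (h4.trans h9)
    _ = _ := by ring

/-! ### Parametrization of the pairs of Farey fractions -/

/-- The pairs `(a, q)` indexing `farey m Q`. -/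
def fareyIdx (m Q : ℕ) : Finset (ℕ × ℕ) :=
  (Finset.Icc 1 Q ×ˢ Finset.Icc 1 Q).filter
    (fun z : ℕ × ℕ => z.1 ≤ z.2 ∧ Nat.Coprime z.1 z.2 ∧ Nat.Coprime z.2 m)

lemma mem_fareyIdx {m Q a q : ℕ} : (a, q) ∈ fareyIdx m Q ↔
    1 ≤ a ∧ a ≤ q ∧ q ≤ Q ∧ Nat.Coprime a q ∧ Nat.Coprime q m := by
  simp only [fareyIdx, Finset.mem_filter, Finset.mem_product, Finset.mem_Icc]
  constructor
  · rintro ⟨⟨⟨h1, _⟩, _, h2⟩, h3, h4, h5⟩; exact ⟨h1, h3, h2, h4, h5⟩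
  · rintro ⟨h1, h2, h3, h4, h5⟩; exact ⟨⟨⟨h1, by omega⟩, by omega, h3⟩, h2, h4, h5⟩

lemma farey_eq_image (m Q : ℕ) :
    farey m Q = (fareyIdx m Q).image (fun z : ℕ × ℕ => (z.1 : ℝ) / (z.2 : ℝ)) := rfl

lemma injOn_fareyIdx (m Q : ℕ) :
    Set.InjOn (fun z : ℕ × ℕ => (z.1 : ℝ) / (z.2 : ℝ)) (fareyIdx m Q : Set (ℕ × ℕ)) := by
  rintro ⟨a, q⟩ h1 ⟨b, r⟩ h2 h
  rw [Finset.mem_coe, mem_fareyIdx] at h1 h2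
  obtain ⟨ha1, haq, hqQ, hcop, _⟩ := h1
  obtain ⟨hb1, hbr, hrQ, hcop', _⟩ := h2
  have hq : (0 : ℝ) < q := by exact_mod_cast (show 0 < q by omega)
  have hr : (0 : ℝ) < r := by exact_mod_cast (show 0 < r by omega)
  simp only at h
  rw [div_eq_div_iff hq.ne' hr.ne'] at h
  have h' : a * r = b * q := by exact_mod_cast h
  have hqr : q = r := by
    apply Nat.dvd_antisymm
    · exact hcop.symm.dvd_of_dvd_mul_left ⟨b, by rw [h', mul_comm]⟩
    · exact hcop'.symm.dvd_of_dvd_mul_left ⟨a, by rw [← h', mul_comm]⟩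
  subst hqr
  have : a = b := Nat.eq_of_mul_eq_mul_right (by omega) h'
  rw [this]

lemma mem_farey {m Q : ℕ} {y : ℝ} : y ∈ farey m Q ↔
    ∃ a q : ℕ, (1 ≤ a ∧ a ≤ q ∧ q ≤ Q ∧ Nat.Coprime a q ∧ Nat.Coprime q m) ∧ y = (a : ℝ) / q := by
  rw [farey_eq_image, Finset.mem_image]
  constructor
  · rintro ⟨⟨a, q⟩, h, rfl⟩; exact ⟨a, q, mem_fareyIdx.1 h, rfl⟩
  · rintro ⟨a, q, h, rfl⟩; exact ⟨(a, q), mem_fareyIdx.2 h, rfl⟩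

lemma farey_pos_le_one {m Q : ℕ} {y : ℝ} (hy : y ∈ farey m Q) : 0 < y ∧ y ≤ 1 := by
  obtain ⟨a, q, ⟨h1, h2, _⟩, rfl⟩ := mem_farey.1 hy
  have ha : (0 : ℝ) < a := by exact_mod_cast h1
  have hq : (0 : ℝ) < q := by exact_mod_cast (show 0 < q by omega)
  exact ⟨by positivity, by rw [div_le_one hq]; exact_mod_cast h2⟩

lemma sum_farey_eq {R : Type*} [AddCommMonoid R] (m Q : ℕ) (f : ℝ → R) :
    ∑ y ∈ farey m Q, f y = ∑ q ∈ (Finset.Icc 1 Q).filter (fun q => Nat.Coprime q m),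
      ∑ a ∈ (Finset.Icc 1 q).filter (fun a => Nat.Coprime a q), f ((a : ℝ) / q) := by
  rw [farey_eq_image, Finset.sum_image (injOn_fareyIdx m Q), Finset.sum_sigma']
  refine Finset.sum_bij (fun z _ => ⟨z.2, z.1⟩) ?_ ?_ ?_ ?_
  · rintro ⟨a, q⟩ h
    rw [mem_fareyIdx] at h
    simp only [Finset.mem_sigma, Finset.mem_filter, Finset.mem_Icc]
    exact ⟨⟨⟨by omega, h.2.2.1⟩, h.2.2.2.2⟩, ⟨h.1, h.2.1⟩, h.2.2.2.1⟩
  · rintro ⟨a, q⟩ _ ⟨b, r⟩ _ h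
    simp only [Sigma.mk.injEq, heq_eq_eq] at h
    rw [h.1, h.2]
  · rintro ⟨q, a⟩ h
    simp only [Finset.mem_sigma, Finset.mem_filter, Finset.mem_Icc] at h
    exact ⟨(a, q), mem_fareyIdx.2 ⟨h.2.1.1, h.2.1.2, h.1.1.2, h.2.2, h.1.2⟩, rfl⟩
  · intro _ _; rfl

open Classical in
/-- The pairs counted by `gapCount`. -/
def gapPairs (m Q : ℕ) (x : ℝ) : Finset (ℝ × ℝ) :=
  (farey m Q ×ˢ farey m Q).filter (fun z => 0 < z.2 - z.1 ∧ z.2 - z.1 ≤ x / (Q : ℝ) ^ 2)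

lemma gapCount_eq_card (m Q : ℕ) (x : ℝ) : gapCount m Q x = (gapPairs m Q x).card := by
  rw [gapCount, ← Set.ncard_coe_finset]
  congr 1
  ext z
  simp [gapPairs, and_assoc]

/-- The denominators `q'` of the fractions `a' / q'` with `a' q - a q' = Δ`. -/
def neighbours (m Q : ℕ) (x : ℝ) (a q Δ : ℕ) : Finset ℕ :=
  (natIcc (Δ * (Q : ℝ) ^ 2 / (x * q)) Q).filter
    (fun r => Nat.Coprime r m ∧ q ∣ a * r + Δ ∧ Nat.Coprime ((a * r + Δ) / q) r)

/-- The numerator `b = (a r + Δ)/q` is determined by `r`, and the gap `Δ/(q r)` is at most `x/Q²`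
exactly when `r ≥ ΔQ²/(xq)`. What needs proof is that the resulting fraction does not exceed `1`,
and here `x < Q` enters. -/
lemma card_neighbours_eq {m Q a q Δ : ℕ} {x : ℝ} (hx : 0 < x) (hxQ : x < Q)
    (haq : (a, q) ∈ fareyIdx m Q) (hΔ : 1 ≤ Δ) :
    ((fareyIdx m Q).filter (fun w : ℕ × ℕ => w.1 * q = a * w.2 + Δ ∧
      (w.1 : ℝ) / w.2 - (a : ℝ) / q ≤ x / (Q : ℝ) ^ 2)).card = (neighbours m Q x a q Δ).card := by
  rw [mem_fareyIdx] at haq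
  obtain ⟨ha1, haq, hqQ, hcop, hqm⟩ := haq
  have hq0 : 0 < q := by omega
  have hq : (0 : ℝ) < q := by exact_mod_cast hq0
  have hQ0 : 0 < Q := by omega
  have hQ : (0 : ℝ) < Q := by exact_mod_cast hQ0
  have hgap : ∀ b r : ℕ, 0 < r → b * q = a * r + Δ →
      ((b : ℝ) / r - (a : ℝ) / q ≤ x / (Q : ℝ) ^ 2 ↔ Δ * (Q : ℝ) ^ 2 / (x * q) ≤ r) := by
    intro b r hr0 hb
    have hr : (0 : ℝ) < r := by exact_mod_cast hr0
    have hb' : (b : ℝ) * q = a * r + Δ := by exact_mod_cast hb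
    have h1 : (b : ℝ) / r - (a : ℝ) / q = Δ / (r * q) := by
      rw [div_sub_div _ _ hr.ne' hq.ne']
      congr 1
      linarith
    rw [h1, div_le_div_iff₀ (by positivity) (by positivity), div_le_iff₀ (by positivity)]
    constructor <;> intro h <;> nlinarith
  refine Finset.card_bij (fun w _ => w.2) ?_ ?_ ?_
  · rintro ⟨b, r⟩ hw
    rw [Finset.mem_filter, mem_fareyIdx] at hw
    obtain ⟨⟨hb1, hbr, hrQ, hcop', hrm⟩, heq, hle⟩ := hw
    simp only at heq hle
    have hbq : (a * r + Δ) / q = b := by rw [← heq, Nat.mul_div_cancel _ hq0]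
    rw [neighbours, Finset.mem_filter, mem_natIcc hQ.le]
    refine ⟨⟨(hgap b r (by omega) heq).1 hle, by exact_mod_cast hrQ⟩, hrm,
      ⟨b, by rw [← heq, mul_comm]⟩, by rw [hbq]; exact hcop'⟩
  · rintro ⟨b, r⟩ hw ⟨b', r'⟩ hw' h
    rw [Finset.mem_filter] at hw hw'
    simp only at h
    subst h
    have h1 := hw.2.1
    have h2 := hw'.2.1
    simp only at h1 h2
    have : b = b' := Nat.eq_of_mul_eq_mul_right hq0 (h1.trans h2.symm)
    rw [this]
  · intro r hr
    rw [neighbours, Finset.mem_filter, mem_natIcc hQ.le] at hr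
    obtain ⟨⟨hlo, hhi⟩, hrm, ⟨b, hb⟩, hcop'⟩ := hr
    rw [hb, Nat.mul_div_cancel_left _ hq0] at hcop'
    have hrQ : r ≤ Q := by exact_mod_cast hhi
    have hr0 : 0 < r := by
      have h1 : (0 : ℝ) < Δ := by exact_mod_cast hΔ
      have h2 : (0 : ℝ) < Δ * (Q : ℝ) ^ 2 / (x * q) := by positivity
      exact_mod_cast h2.trans_le hlo
    have heq : b * q = a * r + Δ := by rw [hb, mul_comm]
    have hb1 : 1 ≤ b := by
      rcases Nat.eq_zero_or_pos b with h | h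
      · rw [h] at heq; omega
      · exact h
    -- The lower bound on `r` gives `ΔQ² ≤ r x q`, and `r ≤ Q`, `x < Q` make the right side smaller
    -- than `Q² q`.
    have hΔq : Δ < q := by
      rw [div_le_iff₀ (by positivity)] at hlo
      have h1 : (r : ℝ) * (x * q) < Q * (Q * q) := by
        have hr' : (0 : ℝ) < r := by exact_mod_cast hr0
        have h2 : x * q < Q * q := mul_lt_mul_of_pos_right hxQ hq
        exact mul_lt_mul' hhi h2 (by positivity) hQ
      have h3 : (Δ : ℝ) * (Q : ℝ) ^ 2 < q * (Q : ℝ) ^ 2 := by nlinarith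
      exact_mod_cast lt_of_mul_lt_mul_right h3 (by positivity)
    -- Otherwise `(r + 1) q ≤ a r + Δ ≤ q r + Δ`, contradicting `Δ < q`.
    have hbr : b ≤ r := by
      by_contra hcon
      have h1 : r + 1 ≤ b := by omega
      have h2 : (r + 1) * q ≤ b * q := Nat.mul_le_mul_right _ h1
      have h3 : a * r ≤ q * r := Nat.mul_le_mul_right _ haq
      nlinarith
    refine ⟨(b, r), ?_, rfl⟩
    rw [Finset.mem_filter, mem_fareyIdx]
    exact ⟨⟨hb1, hbr, hrQ, hcop', hrm⟩, heq, (hgap b r hr0 heq).2 hlo⟩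

lemma sum_gapPairs_eq_sum_neighbours {m Q : ℕ} {x : ℝ} (hx : 0 < x) (hxQ : x < Q) (f : ℝ → ℂ) :
    ∑ z ∈ gapPairs m Q x, f z.1 = ∑ Δ ∈ Finset.Icc 1 ⌊x⌋₊,
      ∑ q ∈ (Finset.Icc 1 Q).filter (fun q => Nat.Coprime q m),
        ∑ a ∈ (Finset.Icc 1 q).filter (fun a => Nat.Coprime a q),
          f ((a : ℝ) / q) * ((neighbours m Q x a q Δ).card : ℂ) := by
  classical
  have hQ : (0 : ℝ) < Q := hx.trans hxQ
  have h1 : ∑ z ∈ gapPairs m Q x, f z.1 = ∑ y ∈ farey m Q, f y *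
      (((farey m Q).filter (fun y' => 0 < y' - y ∧ y' - y ≤ x / (Q : ℝ) ^ 2)).card : ℂ) := by
    rw [gapPairs, Finset.sum_filter, Finset.sum_product]
    refine Finset.sum_congr rfl fun y _ => ?_
    rw [← Finset.sum_filter]
    simp only
    rw [Finset.sum_const, nsmul_eq_mul, mul_comm]
  rw [h1, sum_farey_eq, Finset.sum_comm]
  refine Finset.sum_congr rfl fun q hq => ?_
  rw [Finset.sum_comm]
  refine Finset.sum_congr rfl fun a ha => ?_
  rw [← Finset.mul_sum]
  congr 1
  simp only [Finset.mem_filter, Finset.mem_Icc] at hq ha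
  have haq : (a, q) ∈ fareyIdx m Q := mem_fareyIdx.2 ⟨ha.1.1, ha.1.2, hq.1.2, ha.2, hq.2⟩
  have hq0 : (0 : ℝ) < q := by exact_mod_cast hq.1.1
  have h2 : ((farey m Q).filter
      (fun y' => 0 < y' - (a : ℝ) / q ∧ y' - (a : ℝ) / q ≤ x / (Q : ℝ) ^ 2)).card =
      ((fareyIdx m Q).filter (fun w : ℕ × ℕ => 0 < (w.1 : ℝ) / w.2 - (a : ℝ) / q ∧
        (w.1 : ℝ) / w.2 - (a : ℝ) / q ≤ x / (Q : ℝ) ^ 2)).card := by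
    rw [farey_eq_image, Finset.filter_image, Finset.card_image_of_injOn]
    exact (injOn_fareyIdx m Q).mono (Finset.coe_subset.2 (Finset.filter_subset _ _))
  have h3 : ((fareyIdx m Q).filter (fun w : ℕ × ℕ => 0 < (w.1 : ℝ) / w.2 - (a : ℝ) / q ∧
        (w.1 : ℝ) / w.2 - (a : ℝ) / q ≤ x / (Q : ℝ) ^ 2)).card =
      ∑ Δ ∈ Finset.Icc 1 ⌊x⌋₊, (neighbours m Q x a q Δ).card := by
    have hpos : ∀ b r : ℕ, 0 < r → (0 < (b : ℝ) / r - (a : ℝ) / q ↔ a * r < b * q) := by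
      intro b r hr
      have hr' : (0 : ℝ) < r := by exact_mod_cast hr
      rw [sub_pos, div_lt_div_iff₀ hq0 hr']
      exact_mod_cast Iff.rfl
    -- Sort the second fractions by the determinant `Δ`. Truncated subtraction is harmless because a
    -- positive gap means `a r < b q`.
    rw [Finset.card_eq_sum_card_fiberwise (t := Finset.Icc 1 ⌊x⌋₊)
      (f := fun w : ℕ × ℕ => w.1 * q - a * w.2)]
    · refine Finset.sum_congr rfl fun Δ hΔ => ?_
      rw [Finset.mem_Icc] at hΔ
      rw [← card_neighbours_eq hx hxQ haq hΔ.1, Finset.filter_filter]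
      congr 1
      refine Finset.filter_congr ?_
      rintro ⟨b, r⟩ hw
      rw [mem_fareyIdx] at hw
      simp only
      rw [hpos b r (by omega)]
      constructor
      · rintro ⟨⟨k1, k2⟩, k3⟩; exact ⟨by omega, k2⟩
      · rintro ⟨k1, k2⟩; exact ⟨⟨by omega, k2⟩, by omega⟩
    · rintro ⟨b, r⟩ hw
      rw [Finset.mem_coe, Finset.mem_filter, mem_fareyIdx] at hw
      obtain ⟨hw1, hw2, hw3⟩ := hw
      simp only at hw2 hw3
      rw [hpos b r (by omega)] at hw2
      simp only [Finset.coe_Icc, Set.mem_Icc]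
      refine ⟨by omega, Nat.le_floor ?_⟩
      have hr' : (0 : ℝ) < r := by exact_mod_cast (show 0 < r by omega)
      rw [Nat.cast_sub hw2.le]
      push_cast
      rw [div_sub_div _ _ hr'.ne' hq0.ne', div_le_div_iff₀ (by positivity) (by positivity)] at hw3
      have hrQ : (r : ℝ) ≤ Q := by exact_mod_cast hw1.2.2.1
      have hqQ : (q : ℝ) ≤ Q := by exact_mod_cast hq.1.2
      -- The gap condition reads `Δ Q² ≤ x q r`, and `q r ≤ Q²` yields `Δ ≤ x`.
      have h5 : x * ((r : ℝ) * q) ≤ x * (Q : ℝ) ^ 2 := by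
        rw [sq]
        exact mul_le_mul_of_nonneg_left (mul_le_mul hrQ hqQ hq0.le hQ.le) hx.le
      have h6 : ((b : ℝ) * q - a * r) * (Q : ℝ) ^ 2 ≤ x * (Q : ℝ) ^ 2 := by
        calc _ = ((b : ℝ) * q - r * a) * (Q : ℝ) ^ 2 := by ring
          _ ≤ _ := hw3.trans h5
      exact le_of_mul_le_mul_right h6 (by positivity)
  rw [h2, h3]
  push_cast
  rfl

/-- A common divisor `e` of `b` and `r` divides `b q - a r = Δ`, so the inversion for `(b, r) = 1`
runs over divisors of `Δ` only, and `e ∣ r` with `(r, m) = 1` forces `(e, m) = 1`. A second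
inversion, over `t ∣ m`, treats the cofactor `r/e`. -/
lemma card_neighbours_moebius {m Q a q Δ : ℕ} {x : ℝ} (hm : 0 < m) (hq : 0 < q) (hΔ : 0 < Δ) :
    ((neighbours m Q x a q Δ).card : ℝ) =
      ∑ e ∈ Δ.divisors.filter (fun e => Nat.Coprime e m), (ArithmeticFunction.moebius e : ℝ) *
        ∑ t ∈ m.divisors, (ArithmeticFunction.moebius t : ℝ) *
          (((natIcc (Δ * (Q : ℝ) ^ 2 / (x * q) / e / t) ((Q : ℝ) / e / t)).filter
            (fun j => q ∣ a * t * j + Δ / e)).card : ℝ) := by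
  set lo := Δ * (Q : ℝ) ^ 2 / (x * q) with hlo
  have hQ : (0 : ℝ) ≤ Q := Nat.cast_nonneg Q
  have h1 : ((neighbours m Q x a q Δ).card : ℝ) =
      ∑ e ∈ Δ.divisors, (ArithmeticFunction.moebius e : ℝ) *
        (((natIcc lo Q).filter (fun r => e ∣ r ∧
          (Nat.Coprime r m ∧ q ∣ a * r + Δ ∧ e ∣ (a * r + Δ) / q))).card : ℝ) := by
    rw [neighbours, Finset.card_filter]
    push_cast
    have h2 : ∀ r : ℕ, (if Nat.Coprime r m ∧ q ∣ a * r + Δ ∧ Nat.Coprime ((a * r + Δ) / q) r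
        then (1 : ℝ) else 0) = ∑ e ∈ Δ.divisors, if e ∣ r ∧
          (Nat.Coprime r m ∧ q ∣ a * r + Δ ∧ e ∣ (a * r + Δ) / q) then
          (ArithmeticFunction.moebius e : ℝ) else 0 := by
      intro r
      by_cases h3 : Nat.Coprime r m ∧ q ∣ a * r + Δ
      · obtain ⟨h4, ⟨b, hb⟩⟩ := h3
        have hbq : (a * r + Δ) / q = b := by rw [hb, Nat.mul_div_cancel_left _ hq]
        have hsub : Δ.divisors.filter (fun e => e ∣ r ∧
            (Nat.Coprime r m ∧ q ∣ a * r + Δ ∧ e ∣ (a * r + Δ) / q)) = (Nat.gcd b r).divisors := by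
          ext e
          simp only [Finset.mem_filter, Nat.mem_divisors, hbq, Nat.dvd_gcd_iff]
          constructor
          · rintro ⟨_, h5, _, _, h6⟩
            refine ⟨⟨h6, h5⟩, fun h0 => ?_⟩
            rw [Nat.gcd_eq_zero_iff] at h0
            rw [h0.1, h0.2] at hb
            omega
          · rintro ⟨⟨h5, h6⟩, _⟩
            refine ⟨⟨?_, hΔ.ne'⟩, h6, h4, ⟨b, hb⟩, h5⟩
            have h7 : e ∣ a * r + Δ := hb ▸ h5.mul_left q
            exact (Nat.dvd_add_right (h6.mul_left a)).1 h7
        rw [← Finset.sum_filter, hsub, hbq]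
        have h8 := sum_divisors_moebius (Nat.gcd b r)
        have h9 := congrArg (fun n : ℤ => (n : ℝ)) h8
        push_cast at h9
        rw [h9]
        refine if_congr ⟨fun h => h.2.2, fun h => ⟨h4, ⟨b, hb⟩, h⟩⟩ rfl rfl
      · rw [if_neg (fun h => h3 ⟨h.1, h.2.1⟩)]
        symm
        exact Finset.sum_eq_zero fun e _ => if_neg fun h => h3 ⟨h.2.1, h.2.2.1⟩
    simp_rw [h2]
    rw [Finset.sum_comm]
    refine Finset.sum_congr rfl fun e _ => ?_
    rw [← Finset.sum_filter, Finset.sum_const, nsmul_eq_mul, mul_comm]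
  rw [h1, Finset.sum_filter]
  refine Finset.sum_congr rfl fun e he => ?_
  have he0 := Nat.pos_of_mem_divisors he
  obtain ⟨D, hD⟩ := Nat.dvd_of_mem_divisors he
  have hDe : Δ / e = D := by rw [hD, Nat.mul_div_cancel_left _ he0]
  rw [hDe, card_natIcc_dvd hQ he0]
  -- For `r = e k` both conditions together say `e q ∣ e (a k + D)`.
  have hiff : ∀ k : ℕ, (q ∣ a * (e * k) + Δ ∧ e ∣ (a * (e * k) + Δ) / q) ↔ q ∣ a * k + D := by
    intro k
    have h3 : a * (e * k) + Δ = e * (a * k + D) := by rw [hD]; ring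
    rw [h3]
    constructor
    · rintro ⟨h4, h5⟩
      have h6 := (Nat.dvd_div_iff_mul_dvd h4).1 h5
      rw [mul_comm q e] at h6
      exact Nat.dvd_of_mul_dvd_mul_left he0 h6
    · intro h4
      have h5 : q ∣ e * (a * k + D) := h4.mul_left e
      refine ⟨h5, (Nat.dvd_div_iff_mul_dvd h5).2 ?_⟩
      rw [mul_comm q e]
      exact Nat.mul_dvd_mul_left e h4
  simp_rw [hiff, Nat.coprime_mul_iff_left]
  split_ifs with hem
  · congr 1
    have h4 : (((natIcc (lo / e) ((Q : ℝ) / e)).filter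
        (fun k => (Nat.Coprime e m ∧ Nat.Coprime k m) ∧ q ∣ a * k + D)).card : ℝ) =
        ∑ t ∈ m.divisors, (ArithmeticFunction.moebius t : ℝ) *
        (((natIcc (lo / e) ((Q : ℝ) / e)).filter (fun k => t ∣ k ∧ q ∣ a * k + D)).card : ℝ) := by
      rw [Finset.card_filter]
      push_cast
      have h5 : ∀ k : ℕ, (if (Nat.Coprime e m ∧ Nat.Coprime k m) ∧ q ∣ a * k + D then (1 : ℝ) else 0)
          = ∑ t ∈ m.divisors, if t ∣ k ∧ q ∣ a * k + D then
            (ArithmeticFunction.moebius t : ℝ) else 0 := by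
        intro k
        by_cases h6 : q ∣ a * k + D
        · have h7 := ite_coprime_eq_sum_moebius k m hm
          simp only [h6, and_true]
          rw [← h7]
          exact if_congr ⟨fun h => h.2, fun h => ⟨hem, h⟩⟩ rfl rfl
        · simp [h6]
      simp_rw [h5]
      rw [Finset.sum_comm]
      refine Finset.sum_congr rfl fun t _ => ?_
      rw [← Finset.sum_filter, Finset.sum_const, nsmul_eq_mul, mul_comm]
    rw [h4]
    refine Finset.sum_congr rfl fun t ht => ?_
    rw [card_natIcc_dvd (by positivity) (Nat.pos_of_mem_divisors ht)]
    simp_rw [mul_assoc]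
  · rw [Finset.filter_false_of_mem (fun k _ h => hem h.1.1)]
    simp

/-- The sum over reduced residues attached to fixed `Δ`, `e`, `t` and denominator `q`. -/
def fiberSum (Q : ℕ) (x : ℝ) (f : ℝ → ℂ) (Δ e t q : ℕ) : ℂ :=
  ∑ a ∈ (Finset.Icc 1 q).filter (fun a => Nat.Coprime a q), f ((a : ℝ) / q) *
    (((natIcc (Δ * (Q : ℝ) ^ 2 / (x * q) / e / t) ((Q : ℝ) / e / t)).filter
      (fun j => q ∣ a * t * j + Δ / e)).card : ℂ)

lemma sum_gapPairs_eq_sum_fiberSum {m Q : ℕ} {x : ℝ} (hm : 0 < m) (hx : 0 < x) (hxQ : x < Q)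
    (f : ℝ → ℂ) :
    ∑ z ∈ gapPairs m Q x, f z.1 = ∑ Δ ∈ Finset.Icc 1 ⌊x⌋₊,
      ∑ e ∈ Δ.divisors.filter (fun e => Nat.Coprime e m), ∑ t ∈ m.divisors,
        (ArithmeticFunction.moebius e : ℂ) * (ArithmeticFunction.moebius t : ℂ) *
        ∑ q ∈ (Finset.Icc 1 Q).filter (fun q => Nat.Coprime q m), fiberSum Q x f Δ e t q := by
  rw [sum_gapPairs_eq_sum_neighbours hx hxQ]
  refine Finset.sum_congr rfl fun Δ hΔ => ?_
  rw [Finset.mem_Icc] at hΔ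
  have h1 : ∀ q ∈ (Finset.Icc 1 Q).filter (fun q => Nat.Coprime q m),
      ∑ a ∈ (Finset.Icc 1 q).filter (fun a => Nat.Coprime a q),
          f ((a : ℝ) / q) * ((neighbours m Q x a q Δ).card : ℂ) =
      ∑ e ∈ Δ.divisors.filter (fun e => Nat.Coprime e m), ∑ t ∈ m.divisors,
        (ArithmeticFunction.moebius e : ℂ) * (ArithmeticFunction.moebius t : ℂ) *
        fiberSum Q x f Δ e t q := by
    intro q hq
    simp only [Finset.mem_filter, Finset.mem_Icc] at hq
    have h2 : ∀ a : ℕ, ((neighbours m Q x a q Δ).card : ℂ) =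
        ∑ e ∈ Δ.divisors.filter (fun e => Nat.Coprime e m), ∑ t ∈ m.divisors,
        (ArithmeticFunction.moebius e : ℂ) * (ArithmeticFunction.moebius t : ℂ) *
        (((natIcc (Δ * (Q : ℝ) ^ 2 / (x * q) / e / t) ((Q : ℝ) / e / t)).filter
          (fun j => q ∣ a * t * j + Δ / e)).card : ℂ) := by
      intro a
      have h3 := card_neighbours_moebius (m := m) (Q := Q) (a := a) (x := x) hm hq.1.1 hΔ.1
      have h4 := congrArg (fun y : ℝ => (y : ℂ)) h3
      push_cast at h4
      rw [h4]
      refine Finset.sum_congr rfl fun e _ => ?_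
      rw [Finset.mul_sum]
      refine Finset.sum_congr rfl fun t _ => ?_
      ring
    simp_rw [h2, fiberSum, Finset.mul_sum]
    rw [Finset.sum_comm]
    refine Finset.sum_congr rfl fun e _ => ?_
    rw [Finset.sum_comm]
    refine Finset.sum_congr rfl fun t _ => Finset.sum_congr rfl fun a _ => ?_
    ring
  rw [Finset.sum_congr rfl h1, Finset.sum_comm]
  refine Finset.sum_congr rfl fun e _ => ?_
  rw [Finset.sum_comm]
  refine Finset.sum_congr rfl fun t _ => ?_
  rw [Finset.mul_sum]

/-! ### The limit density and its primitive -/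

/-- `1 - 1/y - (log y)/y` for `y ≥ 1`, extended by zero. -/
def gapKernel (y : ℝ) : ℝ := 1 - 1 / max 1 y - 1 / max 1 y * Real.log (max 1 y)

lemma gapKernel_of_le_one {y : ℝ} (hy : y ≤ 1) : gapKernel y = 0 := by
  simp [gapKernel, max_eq_left hy]

lemma continuous_gapKernel : Continuous gapKernel := by
  have h1 : Continuous fun y : ℝ => max 1 y := by fun_prop
  have h2 : ∀ y : ℝ, max 1 y ≠ 0 := fun y => (lt_of_lt_of_le one_pos (le_max_left 1 y)).ne'
  have h3 : Continuous fun y : ℝ => 1 / max 1 y := continuous_const.div h1 h2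
  exact (continuous_const.sub h3).sub (h3.mul (h1.log h2))

/-- A right derivative is all that the fundamental theorem of calculus asks for, and it spares the
gluing of the two formulas at `y = 1`. -/
lemma hasDerivWithinAt_gapKernel {y : ℝ} (hy : 0 < y) :
    HasDerivWithinAt gapKernel (Real.log (max 1 y) / y ^ 2) (Set.Ioi y) y := by
  rcases lt_or_ge y 1 with h | h
  · have h1 : gapKernel =ᶠ[𝓝 y] fun _ => 0 := by
      filter_upwards [Iio_mem_nhds h] with z hz
      exact gapKernel_of_le_one hz.le
    rw [max_eq_left h.le, Real.log_one, zero_div]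
    exact ((hasDerivAt_const y (0 : ℝ)).congr_of_eventuallyEq h1).hasDerivWithinAt
  · have h1 : HasDerivAt (fun z : ℝ => 1 - 1 / z - 1 / z * Real.log z) (Real.log y / y ^ 2) y := by
      have h2 : HasDerivAt (fun z : ℝ => 1 / z) (-1 / y ^ 2) y := by
        simpa [one_div, neg_div] using hasDerivAt_inv hy.ne'
      have h3 := ((hasDerivAt_const y (1 : ℝ)).sub h2).sub (h2.mul (Real.hasDerivAt_log hy.ne'))
      refine h3.congr_deriv ?_
      field_simp
      ring
    rw [max_eq_right h]
    refine h1.hasDerivWithinAt.congr (fun z hz => ?_) ?_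
    · rw [gapKernel, max_eq_right (h.trans (le_of_lt hz))]
    · rw [gapKernel, max_eq_right h]

/-- Terms with `Δ > x` vanish for the extended kernel, so the range of summation can be frozen near
any point. Continuity and differentiation then proceed term by term, without jumps of the floor. -/
lemma gapDensity_eq (m N : ℕ) {x : ℝ} (hx : x ≤ N) :
    gapDensity m x = C m * ((m.totient : ℝ) / m) *
      ∑ Δ ∈ Finset.Icc 1 N, weight m Δ / Δ * gapKernel (x / Δ) := by
  rw [gapDensity]
  congr 1
  have hsub : Finset.Icc 1 ⌊x⌋₊ ⊆ Finset.Icc 1 N :=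
    Finset.Icc_subset_Icc_right (Nat.floor_le_of_le hx)
  rw [← Finset.sum_subset hsub]
  · refine Finset.sum_congr rfl fun Δ hΔ => ?_
    rw [Finset.mem_Icc] at hΔ
    have hΔ0 : (0 : ℝ) < Δ := by exact_mod_cast hΔ.1
    have h1 : (Δ : ℝ) ≤ x := (Nat.le_floor_iff' (by omega)).1 hΔ.2
    have h2 : 1 ≤ x / Δ := by rwa [le_div_iff₀ hΔ0, one_mul]
    rw [gapKernel, max_eq_right h2, one_div_div]
  · intro Δ h1 h2
    rw [Finset.mem_Icc] at h1 h2
    have hΔ0 : (0 : ℝ) < Δ := by exact_mod_cast h1.1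
    have h3 : x < Δ := by
      by_contra h
      exact h2 ⟨h1.1, Nat.le_floor (not_lt.1 h)⟩
    rw [gapKernel_of_le_one ((div_le_one hΔ0).2 h3.le), mul_zero]

lemma continuous_gapDensity (m : ℕ) : Continuous (gapDensity m) := by
  rw [continuous_iff_continuousAt]
  intro x
  obtain ⟨N, hN⟩ := exists_nat_gt x
  have h1 : gapDensity m =ᶠ[𝓝 x] fun y => C m * ((m.totient : ℝ) / m) *
      ∑ Δ ∈ Finset.Icc 1 N, weight m Δ / Δ * gapKernel (y / Δ) := by
    filter_upwards [Iio_mem_nhds hN] with y hy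
    exact gapDensity_eq m N hy.le
  refine ContinuousAt.congr ?_ h1.symm
  refine Continuous.continuousAt ?_
  refine continuous_const.mul (continuous_finsetSum _ fun Δ _ => continuous_const.mul ?_)
  exact continuous_gapKernel.comp (continuous_id.div_const _)

lemma gapDensity_of_lt_one (m : ℕ) {x : ℝ} (hx : x < 1) : gapDensity m x = 0 := by
  rw [gapDensity, Nat.floor_eq_zero.2 hx]
  simp

lemma g_eq (m N : ℕ) {x : ℝ} (hx : 2 * x / C m ≤ N) :
    g m x = (m.totient : ℝ) / m * (C m / x ^ 2) *
      ∑ Δ ∈ Finset.Icc 1 N, weight m Δ * Real.log (max 1 (2 * x / C m / Δ)) := by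
  rw [g]
  congr 1
  have hsub : Finset.Icc 1 ⌊2 * x / C m⌋₊ ⊆ Finset.Icc 1 N :=
    Finset.Icc_subset_Icc_right (Nat.floor_le_of_le hx)
  rw [← Finset.sum_subset hsub]
  · refine Finset.sum_congr rfl fun Δ hΔ => ?_
    rw [Finset.mem_Icc] at hΔ
    have hΔ0 : (0 : ℝ) < Δ := by exact_mod_cast hΔ.1
    have h1 : (Δ : ℝ) ≤ 2 * x / C m := (Nat.le_floor_iff' (by omega)).1 hΔ.2
    have h2 : 1 ≤ 2 * x / C m / Δ := by rwa [le_div_iff₀ hΔ0, one_mul]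
    rw [max_eq_right h2, div_div]
  · intro Δ h1 h2
    rw [Finset.mem_Icc] at h1 h2
    have hΔ0 : (0 : ℝ) < Δ := by exact_mod_cast h1.1
    have h3 : 2 * x / C m < Δ := by
      by_contra h
      exact h2 ⟨h1.1, Nat.le_floor (not_lt.1 h)⟩
    rw [max_eq_left ((div_le_one hΔ0).2 h3.le), Real.log_one, mul_zero]

lemma weight_nonneg (m Δ : ℕ) : 0 ≤ weight m Δ := by
  unfold weight; positivity

lemma g_nonneg (m : ℕ) (hm : 0 < m) (x : ℝ) : 0 ≤ g m x := by
  obtain ⟨N, hN⟩ := exists_nat_gt (2 * x / C m)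
  rw [g_eq m N hN.le]
  have hC := C_pos m hm
  refine mul_nonneg (by positivity) (Finset.sum_nonneg fun Δ _ => ?_)
  exact mul_nonneg (weight_nonneg m Δ) (Real.log_nonneg (le_max_left _ _))

lemma continuous_g (m : ℕ) (hm : 0 < m) : Continuous (g m) := by
  have hC := C_pos m hm
  rw [continuous_iff_continuousAt]
  intro x
  -- Below `C m / 2`, negative arguments included, the sum is empty, which disposes of the pole of
  -- `1/x²` at `0`.
  rcases lt_or_ge x (C m / 2) with hx | hx
  · have h1 : g m =ᶠ[𝓝 x] fun _ => 0 := by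
      filter_upwards [Iio_mem_nhds hx] with y hy
      have h2 : 2 * y / C m < 1 := by
        rw [div_lt_one hC]
        have : y < C m / 2 := hy
        linarith
      rw [g, Nat.floor_eq_zero.2 h2]
      simp
    exact continuousAt_const.congr h1.symm
  · have hx0 : 0 < x := lt_of_lt_of_le (by positivity) hx
    obtain ⟨N, hN⟩ := exists_nat_gt (2 * x / C m)
    have hc : Continuous fun y : ℝ => 2 * y / C m := by fun_prop
    have h1 : g m =ᶠ[𝓝 x] fun y => (m.totient : ℝ) / m * (C m / y ^ 2) *
        ∑ Δ ∈ Finset.Icc 1 N, weight m Δ * Real.log (max 1 (2 * y / C m / Δ)) := by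
      filter_upwards [hc.continuousAt.eventually (Iio_mem_nhds hN)] with y hy
      exact g_eq m N (le_of_lt hy)
    refine ContinuousAt.congr ?_ h1.symm
    refine ContinuousAt.mul (continuousAt_const.mul
      (continuousAt_const.div (by fun_prop) (by positivity))) ?_
    refine Continuous.continuousAt (continuous_finsetSum _ fun Δ _ => continuous_const.mul ?_)
    refine Continuous.log (by fun_prop) fun y => (lt_of_lt_of_le one_pos (le_max_left 1 _)).ne'

/-- The primitive of `g m`. -/
lemma integral_g (m : ℕ) (hm : 0 < m) {x : ℝ} (hx : 0 ≤ x) :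
    ∫ t in (0 : ℝ)..x, g m t = 2 / C m * gapDensity m (2 * x / C m) := by
  have hC := C_pos m hm
  have h0 : gapDensity m (2 * 0 / C m) = 0 := gapDensity_of_lt_one m (by simp)
  have key := intervalIntegral.integral_eq_sub_of_hasDeriv_right_of_le hx
    (f := fun t => 2 / C m * gapDensity m (2 * t / C m)) (f' := g m) ?_ ?_
    ((continuous_g m hm).intervalIntegrable _ _)
  · rw [key, h0, mul_zero, sub_zero]
  · have : Continuous fun t => 2 / C m * gapDensity m (2 * t / C m) :=
      continuous_const.mul ((continuous_gapDensity m).comp (by fun_prop))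
    exact this.continuousOn
  · intro t ht
    have ht0 : 0 < t := ht.1
    obtain ⟨N, hN⟩ := exists_nat_gt (2 * t / C m)
    have hc : Continuous fun y : ℝ => 2 * y / C m := by fun_prop
    have h1 : (fun t => 2 / C m * gapDensity m (2 * t / C m)) =ᶠ[𝓝 t] fun t => 2 / C m *
        (C m * ((m.totient : ℝ) / m) *
          ∑ Δ ∈ Finset.Icc 1 N, weight m Δ / Δ * gapKernel (2 * t / C m / Δ)) := by
      filter_upwards [hc.continuousAt.eventually (Iio_mem_nhds hN)] with y hy
      rw [gapDensity_eq m N (le_of_lt hy)]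
    refine HasDerivWithinAt.congr_of_eventuallyEq ?_ (h1.filter_mono nhdsWithin_le_nhds) h1.eq_of_nhds
    have hterm : ∀ Δ ∈ Finset.Icc 1 N, HasDerivWithinAt
        (fun t => weight m Δ / Δ * gapKernel (2 * t / C m / Δ))
        (weight m Δ / Δ * (Real.log (max 1 (2 * t / C m / Δ)) / (2 * t / C m / Δ) ^ 2 *
          (2 / C m / Δ))) (Set.Ioi t) t := by
      intro Δ hΔ
      rw [Finset.mem_Icc] at hΔ
      have hΔ0 : (0 : ℝ) < Δ := by exact_mod_cast hΔ.1
      refine HasDerivWithinAt.const_mul _ ?_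
      have hlin : HasDerivWithinAt (fun t : ℝ => 2 * t / C m / Δ) (2 / C m / Δ) (Set.Ioi t) t := by
        have := (((hasDerivAt_id t).const_mul 2).div_const (C m)).div_const (Δ : ℝ)
        simpa using this.hasDerivWithinAt
      have hmaps : Set.MapsTo (fun t : ℝ => 2 * t / C m / Δ) (Set.Ioi t)
          (Set.Ioi (2 * t / C m / Δ)) := by
        intro s hs
        have hs' : t < s := hs
        change 2 * t / C m / Δ < 2 * s / C m / Δ
        gcongr
      exact HasDerivWithinAt.comp t (hasDerivWithinAt_gapKernel (by positivity)) hlin hmaps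
    have hsum := (HasDerivWithinAt.fun_sum hterm).const_mul (C m * ((m.totient : ℝ) / m))
      |>.const_mul (2 / C m)
    refine hsum.congr_deriv ?_
    rw [g_eq m N hN.le, Finset.mul_sum, Finset.mul_sum, Finset.mul_sum]
    refine Finset.sum_congr rfl fun Δ hΔ => ?_
    rw [Finset.mem_Icc] at hΔ
    have hΔ0 : (0 : ℝ) < Δ := by exact_mod_cast hΔ.1
    have hm' : (0 : ℝ) < m := by exact_mod_cast hm
    field_simp

/-! ### Asymptotics for the sums over pairs -/

/-- The length of the range of second denominators, as a function of the first one. -/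
def rampWeight (Q : ℕ) (x : ℝ) (Δ : ℕ) (s : ℝ) : ℝ :=
  -- At `s = 0` division by zero would make the second branch equal to `Q`; the cut-off keeps the
  -- function increasing on the whole line.
  if s ≤ 0 then 0 else max 0 ((Q : ℝ) - Δ * (Q : ℝ) ^ 2 / (x * s))

lemma monotone_rampWeight (Q : ℕ) {x : ℝ} (hx : 0 < x) (Δ : ℕ) : Monotone (rampWeight Q x Δ) := by
  intro a b hab
  unfold rampWeight
  by_cases ha : a ≤ 0
  · rw [if_pos ha]
    split_ifs
    · exact le_rfl
    · exact le_max_left _ _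
  · rw [if_neg ha, if_neg (by linarith)]
    have ha' : 0 < a := not_le.1 ha
    gcongr

lemma rampWeight_le (Q : ℕ) {x : ℝ} (hx : 0 < x) (Δ : ℕ) (s : ℝ) : rampWeight Q x Δ s ≤ Q := by
  unfold rampWeight
  split_ifs with h
  · positivity
  · have hs : 0 < s := not_le.1 h
    refine max_le (by positivity) ?_
    have : 0 ≤ Δ * (Q : ℝ) ^ 2 / (x * s) := by positivity
    linarith

lemma integral_rampWeight {Q Δ : ℕ} {x : ℝ} (hQ : 0 < Q) (hΔ : 0 < Δ) (hΔx : (Δ : ℝ) ≤ x) :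
    ∫ s in (0 : ℝ)..Q, rampWeight Q x Δ s =
      (Q : ℝ) ^ 2 * (1 - Δ / x - Δ / x * Real.log (x / Δ)) := by
  have hQ' : (0 : ℝ) < Q := by exact_mod_cast hQ
  have hΔ' : (0 : ℝ) < Δ := by exact_mod_cast hΔ
  have hx : 0 < x := hΔ'.trans_le hΔx
  -- The point where the ramp leaves zero: for a first denominator below `c` no second denominator
  -- up to `Q` is large enough.
  set c : ℝ := Δ * Q / x with hc
  have hc0 : 0 < c := by positivity
  have hcQ : c ≤ Q := by
    rw [hc, div_le_iff₀ hx]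
    nlinarith
  have hint : ∀ a b, IntervalIntegrable (rampWeight Q x Δ) volume a b := fun a b =>
    (monotone_rampWeight Q hx Δ).intervalIntegrable
  rw [← intervalIntegral.integral_add_adjacent_intervals (hint 0 c) (hint c Q)]
  have heq : ∀ s : ℝ, 0 < s → (Q : ℝ) - Δ * (Q : ℝ) ^ 2 / (x * s) = Q - c * Q * s⁻¹ := by
    intro s hs
    rw [hc]; field_simp
  have h1 : ∫ s in (0 : ℝ)..c, rampWeight Q x Δ s = 0 := by
    rw [intervalIntegral.integral_congr (g := fun _ => (0 : ℝ))]
    · simp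
    · intro s hs
      rw [Set.uIcc_of_le hc0.le] at hs
      simp only [rampWeight]
      split_ifs with h
      · rfl
      · have hs0 : 0 < s := not_le.1 h
        rw [heq s hs0]
        apply max_eq_left
        have : (Q : ℝ) ≤ c * Q * s⁻¹ := by
          rw [← div_eq_mul_inv, le_div_iff₀ hs0, mul_comm]
          exact mul_le_mul_of_nonneg_right hs.2 hQ'.le
        linarith
  have h2 : ∫ s in c..(Q : ℝ), rampWeight Q x Δ s = ∫ s in c..(Q : ℝ), ((Q : ℝ) - c * Q * s⁻¹) := by
    refine intervalIntegral.integral_congr fun s hs => ?_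
    rw [Set.uIcc_of_le hcQ] at hs
    have hs0 : 0 < s := hc0.trans_le hs.1
    simp only [rampWeight]
    rw [if_neg (not_le.2 hs0), heq s hs0]
    apply max_eq_right
    have : c * Q * s⁻¹ ≤ Q := by
      rw [← div_eq_mul_inv, div_le_iff₀ hs0, mul_comm]
      exact mul_le_mul_of_nonneg_left hs.1 hQ'.le
    linarith
  have h3 : (0 : ℝ) ∉ Set.uIcc c Q := by
    rw [Set.uIcc_of_le hcQ]
    exact fun h => absurd h.1 (not_le.2 hc0)
  have hinv : IntervalIntegrable (fun s : ℝ => c * Q * s⁻¹) volume c Q := by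
    refine ContinuousOn.intervalIntegrable (continuousOn_const.mul
      (continuousOn_id.inv₀ fun s hs => ?_))
    rintro rfl
    exact h3 hs
  rw [h1, h2, zero_add, intervalIntegral.integral_sub (by simp) hinv,
    intervalIntegral.integral_const, intervalIntegral.integral_const_mul,
    integral_inv h3, smul_eq_mul]
  have h4 : (Q : ℝ) / c = x / Δ := by rw [hc]; field_simp
  rw [h4, hc]
  field_simp

/-- This is the untwisted fibre sum: `abs_sum_card_dvd_sub_le` with `D = Δ/e`, on an interval whose
length is the ramp weight divided by `e t`. -/
lemma abs_fiberSum_one_sub_le {Q Δ e t q : ℕ} {x : ℝ} (hx : 0 < x)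
    (he : e ∈ Δ.divisors) (ht : 0 < t) (hq : 0 < q) (htq : Nat.Coprime t q) :
    |(∑ a ∈ (Finset.Icc 1 q).filter (fun a => Nat.Coprime a q),
      (((natIcc (Δ * (Q : ℝ) ^ 2 / (x * q) / e / t) ((Q : ℝ) / e / t)).filter
        (fun j => q ∣ a * t * j + Δ / e)).card : ℝ)) -
      (1 / (e : ℝ)) * (1 / (t : ℝ)) * ((q.totient : ℝ) / q * rampWeight Q x Δ q)| ≤
      Δ * q.divisors.card := by
  have he0 := Nat.pos_of_mem_divisors he
  have hΔ0 : 0 < Δ := Nat.pos_of_ne_zero (Nat.mem_divisors.1 he).2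
  have hD : 0 < Δ / e := Nat.div_pos (Nat.divisor_le he) he0
  have hq' : (0 : ℝ) < q := by exact_mod_cast hq
  have he' : (0 : ℝ) < e := by exact_mod_cast he0
  have ht' : (0 : ℝ) < t := by exact_mod_cast ht
  have h1 := abs_sum_card_dvd_sub_le q t (Δ / e) hq hD htq
    (lo := Δ * (Q : ℝ) ^ 2 / (x * q) / e / t) (hi := (Q : ℝ) / e / t) (by positivity) (by positivity)
  have h2 : max 0 ((Q : ℝ) / e / t - Δ * (Q : ℝ) ^ 2 / (x * q) / e / t) =
      (1 / (e : ℝ)) * (1 / (t : ℝ)) * rampWeight Q x Δ q := by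
    rw [rampWeight, if_neg (not_le.2 hq'), mul_max_of_nonneg _ _ (by positivity), mul_zero]
    congr 1
    field_simp
  rw [h2] at h1
  have h3 : (1 / (e : ℝ)) * (1 / (t : ℝ)) * ((q.totient : ℝ) / q * rampWeight Q x Δ q) =
      (q.totient : ℝ) / q * ((1 / (e : ℝ)) * (1 / (t : ℝ)) * rampWeight Q x Δ q) := by ring
  rw [h3]
  refine h1.trans ?_
  refine mul_le_mul_of_nonneg_right ?_ (by positivity)
  exact_mod_cast Nat.div_le_self Δ e

lemma coprime_of_mem_divisors {m t q : ℕ} (ht : t ∈ m.divisors) (hq : Nat.Coprime q m) :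
    Nat.Coprime t q :=
  (Nat.Coprime.coprime_dvd_right (Nat.dvd_of_mem_divisors ht) hq).symm

/-- The asymptotic count of gaps, with error `O(Q log Q)`. -/
lemma abs_gapCount_sub_le (m : ℕ) (hm : 0 < m) (K : ℝ) :
    ∃ A : ℝ, 0 ≤ A ∧ ∀ (Q : ℕ) (x : ℝ), 0 < x → x ≤ K → x < Q →
      |(gapCount m Q x : ℝ) - gapDensity m x * (Q : ℝ) ^ 2| ≤ A * (Q * (1 + Real.log Q)) := by
  set L := ⌊K⌋₊ with hL
  refine ⟨∑ Δ ∈ Finset.Icc 1 L, ∑ e ∈ Δ.divisors, ∑ t ∈ m.divisors,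
    ((Δ : ℝ) + (m.divisors.card + 1)), by positivity, ?_⟩
  intro Q x hx hxK hxQ
  have hQ' : (0 : ℝ) < Q := hx.trans hxQ
  have hQ0 : 0 < Q := by exact_mod_cast hQ'
  have hlog : 0 ≤ Real.log Q := Real.log_nonneg (by exact_mod_cast hQ0)
  set W : ℕ → ℕ → ℕ → ℝ := fun Δ e t =>
    ∑ q ∈ (Finset.Icc 1 Q).filter (fun q => Nat.Coprime q m),
      ∑ a ∈ (Finset.Icc 1 q).filter (fun a => Nat.Coprime a q),
      (((natIcc (Δ * (Q : ℝ) ^ 2 / (x * q) / e / t) ((Q : ℝ) / e / t)).filter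
        (fun j => q ∣ a * t * j + Δ / e)).card : ℝ) with hW
  set I : ℕ → ℝ := fun Δ => (Q : ℝ) ^ 2 * (1 - Δ / x - Δ / x * Real.log (x / Δ)) with hI
  have hcount : (gapCount m Q x : ℝ) = ∑ Δ ∈ Finset.Icc 1 ⌊x⌋₊,
      ∑ e ∈ Δ.divisors.filter (fun e => Nat.Coprime e m), ∑ t ∈ m.divisors,
        (ArithmeticFunction.moebius e : ℝ) * (ArithmeticFunction.moebius t : ℝ) * W Δ e t := by
    have h1 := sum_gapPairs_eq_sum_fiberSum (m := m) hm hx hxQ (fun _ => (1 : ℂ))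
    simp only [Finset.sum_const, nsmul_eq_mul, mul_one, ← gapCount_eq_card, fiberSum, one_mul] at h1
    simp only [hW]
    exact_mod_cast h1
  -- Re-expanding `weight m Δ / Δ` and `φ(m)/m` as Möbius sums puts the main term in the shape of
  -- the count, so the two can be compared term by term.
  have hmain : gapDensity m x * (Q : ℝ) ^ 2 = ∑ Δ ∈ Finset.Icc 1 ⌊x⌋₊,
      ∑ e ∈ Δ.divisors.filter (fun e => Nat.Coprime e m), ∑ t ∈ m.divisors,
        (ArithmeticFunction.moebius e : ℝ) * (ArithmeticFunction.moebius t : ℝ) *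
          ((1 / (e : ℝ)) * (1 / (t : ℝ)) * (C m * I Δ)) := by
    rw [gapDensity, Finset.mul_sum, Finset.sum_mul]
    refine Finset.sum_congr rfl fun Δ hΔ => ?_
    rw [Finset.mem_Icc] at hΔ
    rw [← sum_moebius_div_coprime_eq_weight Δ m hΔ.1, ← sum_moebius_div m hm]
    have h2 : ∀ A B : ℝ, ∀ S T : Finset ℕ, ∀ u v : ℕ → ℝ,
        C m * (∑ t ∈ T, v t) * ((∑ e ∈ S, u e) * A) * B =
        ∑ e ∈ S, ∑ t ∈ T, u e * v t * (C m * (B * A)) := by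
      intro A B S T u v
      simp_rw [← Finset.sum_mul, ← Finset.mul_sum, ← Finset.sum_mul]
      ring
    rw [h2]
    refine Finset.sum_congr rfl fun e _ => Finset.sum_congr rfl fun t _ => ?_
    simp only [hI]
    ring
  have hterm : ∀ Δ ∈ Finset.Icc 1 ⌊x⌋₊, ∀ e ∈ Δ.divisors, ∀ t ∈ m.divisors,
      |W Δ e t - (1 / (e : ℝ)) * (1 / (t : ℝ)) * (C m * I Δ)| ≤
        ((Δ : ℝ) + (m.divisors.card + 1)) * (Q * (1 + Real.log Q)) := by
    intro Δ hΔ e he t ht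
    rw [Finset.mem_Icc] at hΔ
    have hΔx : (Δ : ℝ) ≤ x := (Nat.le_floor_iff hx.le).1 hΔ.2
    have ht0 := Nat.pos_of_mem_divisors ht
    have he0 := Nat.pos_of_mem_divisors he
    set S := ∑ q ∈ (Finset.Icc 1 Q).filter (fun q => Nat.Coprime q m),
      (q.totient : ℝ) / q * rampWeight Q x Δ q with hS
    have h1 : |W Δ e t - (1 / (e : ℝ)) * (1 / (t : ℝ)) * S| ≤ Δ * (Q * (1 + Real.log Q)) := by
      simp only [hW, hS]
      rw [Finset.mul_sum, ← Finset.sum_sub_distrib]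
      refine (Finset.abs_sum_le_sum_abs _ _).trans ?_
      calc _ ≤ ∑ q ∈ (Finset.Icc 1 Q).filter (fun q => Nat.Coprime q m),
            (Δ : ℝ) * q.divisors.card := by
            refine Finset.sum_le_sum fun q hq => ?_
            rw [Finset.mem_filter, Finset.mem_Icc] at hq
            exact abs_fiberSum_one_sub_le hx he ht0 hq.1.1 (coprime_of_mem_divisors ht hq.2)
        _ ≤ ∑ q ∈ Finset.Icc 1 Q, (Δ : ℝ) * q.divisors.card :=
            Finset.sum_le_sum_of_subset_of_nonneg (Finset.filter_subset _ _)
              (fun _ _ _ => by positivity)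
        _ ≤ _ := by
            rw [← Finset.mul_sum]
            exact mul_le_mul_of_nonneg_left (sum_card_divisors_le Q) (by positivity)
    have h2 := abs_sum_totient_div_mul_sub_le (F := rampWeight Q x Δ) (B := Q) m Q hm hQ0
      ((monotone_rampWeight Q hx Δ).monotoneOn _) (by simp [rampWeight]) (rampWeight_le Q hx Δ Q)
    rw [integral_rampWeight hQ0 hΔ.1 hΔx] at h2
    have h3 : |(1 / (e : ℝ)) * (1 / (t : ℝ)) * S - (1 / (e : ℝ)) * (1 / (t : ℝ)) * (C m * I Δ)| ≤
        (m.divisors.card + 1) * (Q * (1 + Real.log Q)) := by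
      rw [← mul_sub, abs_mul]
      have h4 : |(1 / (e : ℝ)) * (1 / (t : ℝ))| ≤ 1 := by
        have h5 : (1 : ℝ) ≤ e := by exact_mod_cast he0
        have h6 : (1 : ℝ) ≤ t := by exact_mod_cast ht0
        rw [abs_of_nonneg (by positivity)]
        exact mul_le_one₀ ((div_le_one (by positivity)).2 h5) (by positivity)
          ((div_le_one (by positivity)).2 h6)
      calc _ ≤ 1 * ((m.divisors.card + 1) * Q * (1 + Real.log Q)) :=
            mul_le_mul h4 h2 (abs_nonneg _) zero_le_one
        _ = _ := by ring
    calc _ ≤ _ := abs_sub_le _ ((1 / (e : ℝ)) * (1 / (t : ℝ)) * S) _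
      _ ≤ _ := add_le_add h1 h3
      _ = _ := by ring
  clear_value W I
  rw [hcount, hmain, ← Finset.sum_sub_distrib]
  have hQlog : 0 ≤ (Q : ℝ) * (1 + Real.log Q) := by positivity
  calc _ ≤ ∑ Δ ∈ Finset.Icc 1 ⌊x⌋₊, ∑ e ∈ Δ.divisors, ∑ t ∈ m.divisors,
        ((Δ : ℝ) + (m.divisors.card + 1)) * (Q * (1 + Real.log Q)) := by
        refine (Finset.abs_sum_le_sum_abs _ _).trans (Finset.sum_le_sum fun Δ hΔ => ?_)
        rw [← Finset.sum_sub_distrib]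
        have hsub : ∑ e ∈ Δ.divisors.filter (fun e => Nat.Coprime e m), ∑ t ∈ m.divisors,
            ((Δ : ℝ) + (m.divisors.card + 1)) * (Q * (1 + Real.log Q)) ≤
            ∑ e ∈ Δ.divisors, ∑ t ∈ m.divisors,
            ((Δ : ℝ) + (m.divisors.card + 1)) * (Q * (1 + Real.log Q)) :=
          Finset.sum_le_sum_of_subset_of_nonneg (Finset.filter_subset _ _)
            (fun _ _ _ => by positivity)
        refine (Finset.abs_sum_le_sum_abs _ _).trans (le_trans ?_ hsub)
        refine Finset.sum_le_sum fun e he => ?_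
        rw [← Finset.sum_sub_distrib]
        refine (Finset.abs_sum_le_sum_abs _ _).trans (Finset.sum_le_sum fun t ht => ?_)
        rw [← mul_sub, abs_mul, abs_mul]
        calc _ ≤ 1 * (((Δ : ℝ) + (m.divisors.card + 1)) * (Q * (1 + Real.log Q))) := by
              refine mul_le_mul ?_ (hterm Δ hΔ e (Finset.mem_filter.1 he).1 t ht) (abs_nonneg _)
                zero_le_one
              exact mul_le_one₀ (abs_moebius_le_one e) (abs_nonneg _) (abs_moebius_le_one t)
          _ = _ := one_mul _
    _ ≤ ∑ Δ ∈ Finset.Icc 1 L, ∑ e ∈ Δ.divisors, ∑ t ∈ m.divisors,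
        ((Δ : ℝ) + (m.divisors.card + 1)) * (Q * (1 + Real.log Q)) :=
        Finset.sum_le_sum_of_subset_of_nonneg
          (Finset.Icc_subset_Icc_right (Nat.floor_le_floor hxK)) (fun _ _ _ => by positivity)
    _ = _ := by simp_rw [Finset.sum_mul]

/-! ### Exponential sums over the pairs. -/

lemma norm_kloosterman_le (q Q : ℕ) [NeZero q] (hqQ : q ≤ Q) (h : ℤ) (hh : h ≠ 0) (c : ZMod q) :
    ‖kloosterman q h c‖ ≤ 2 * h.natAbs * (Q : ℝ) ^ ((3 : ℝ) / 4) * q.divisors.card := by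
  have h1 := norm_kloosterman_pow_four_le q h hh c
  have hh1 : (1 : ℝ) ≤ h.natAbs := by exact_mod_cast Int.natAbs_pos.2 hh
  have hq1 : (1 : ℝ) ≤ q.divisors.card := by
    exact_mod_cast Finset.card_pos.2 ⟨1, Nat.one_mem_divisors.2 (NeZero.ne q)⟩
  have hqQ' : (q : ℝ) ≤ Q := by exact_mod_cast hqQ
  refine le_of_pow_le_pow_left₀ (n := 4) (by norm_num) (by positivity) (h1.trans ?_)
  have h2 : ((Q : ℝ) ^ ((3 : ℝ) / 4)) ^ 4 = (Q : ℝ) ^ 3 := by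
    rw [← Real.rpow_natCast, ← Real.rpow_mul (by positivity)]
    norm_num
  rw [mul_pow, mul_pow, h2]
  -- Factors that are at least `1` are raised to the fourth power, so that the fourth root is free
  -- of fractional powers of `|h|` and of the divisor count.
  have h3 : (2 * h.natAbs : ℝ) ≤ (2 * h.natAbs) ^ 4 := le_self_pow₀ (by linarith) (by norm_num)
  have h4 : (q.divisors.card : ℝ) ^ 3 ≤ (q.divisors.card : ℝ) ^ 4 :=
    pow_le_pow_right₀ hq1 (by norm_num)
  gcongr

lemma norm_fiberSum_exp_le {Q Δ e t q : ℕ} {x : ℝ} (hx : 0 < x) (hΔ : 1 ≤ Δ)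
    (he0 : 0 < e) (ht : 0 < t) (hq : 0 < q) (hqQ : q ≤ Q) (htq : Nat.Coprime t q)
    (h : ℤ) (hh : h ≠ 0) :
    ‖fiberSum Q x (fun y => Complex.exp (2 * Real.pi * Complex.I * h * (y : ℝ))) Δ e t q‖ ≤
      (2 * x + 1 + Real.log Q) *
        (2 * h.natAbs * (Q : ℝ) ^ ((3 : ℝ) / 4) * q.divisors.card) := by
  have : NeZero q := ⟨hq.ne'⟩
  have hq' : (0 : ℝ) < q := by exact_mod_cast hq
  have hQ0 : 0 < Q := by omega
  have hQ' : (0 : ℝ) < Q := by exact_mod_cast hQ0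
  have he' : (0 : ℝ) < e := by exact_mod_cast he0
  have ht' : (0 : ℝ) < t := by exact_mod_cast ht
  have hΔ' : (1 : ℝ) ≤ Δ := by exact_mod_cast hΔ
  have hlog : 0 ≤ Real.log Q := Real.log_nonneg (by exact_mod_cast hQ0)
  set M := 2 * h.natAbs * (Q : ℝ) ^ ((3 : ℝ) / 4) * q.divisors.card with hM
  have hM0 : 0 ≤ M := by positivity
  -- If `x q < Q`, the lower end of the interval for `j` exceeds its upper end, as `Δ ≥ 1`.
  -- Otherwise `q ≥ Q/x`, so the interval covers at most about `x` periods, which gives the term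
  -- `2x`.
  rcases lt_or_ge (x * q) Q with hlt | hge
  · have hempty : natIcc (Δ * (Q : ℝ) ^ 2 / (x * q) / e / t) ((Q : ℝ) / e / t) = ∅ := by
      rw [Finset.eq_empty_iff_forall_notMem]
      intro j hj
      rw [mem_natIcc (by positivity)] at hj
      have h1 := hj.1.trans hj.2
      rw [div_div, div_div (Q : ℝ), div_le_div_iff_of_pos_right (by positivity),
        div_le_iff₀ (by positivity)] at h1
      have h2 : (Q : ℝ) * (x * q) < Q * Q := mul_lt_mul_of_pos_left hlt hQ'
      nlinarith
    rw [fiberSum, hempty]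
    simp only [Finset.filter_empty, Finset.card_empty, Nat.cast_zero, mul_zero,
      Finset.sum_const_zero, norm_zero]
    positivity
  · refine (norm_incomplete_sum_le q h t (Δ / e) _ _ htq M
      (fun c => norm_kloosterman_le q Q hqQ h hh c)).trans ?_
    refine mul_le_mul_of_nonneg_right ?_ hM0
    have h1 : (⌊(Q : ℝ) / e / t⌋₊ : ℝ) ≤ Q := by
      refine (Nat.floor_le (by positivity)).trans ?_
      rw [div_div]
      refine div_le_self hQ'.le ?_
      exact_mod_cast Nat.mul_pos he0 ht
    have h2 : (1 : ℝ) ≤ Q := by exact_mod_cast hQ0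
    have h3 : ((⌊(Q : ℝ) / e / t⌋₊ : ℝ) + 1) / q ≤ 2 * x := by
      rw [div_le_iff₀ hq']
      linarith
    have h4 : Real.log q ≤ Real.log Q := Real.log_le_log hq' (by exact_mod_cast hqQ)
    linarith

/-- From `log Q ≤ 16 Q^(1/16)`. The exponent `1/16` is small enough that two logarithms, the factor
`Q^(3/4)` and the sum over `q ≤ Q` still stay below `Q²`. -/
lemma one_add_log_le_rpow {c : ℝ} (hc : 0 ≤ c) {Q : ℕ} (hQ : 0 < Q) :
    c + 1 + Real.log Q ≤ (c + 17) * (Q : ℝ) ^ ((1 : ℝ) / 16) := by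
  have h1 : (1 : ℝ) ≤ Q := by exact_mod_cast hQ
  have h2 : (1 : ℝ) ≤ (Q : ℝ) ^ ((1 : ℝ) / 16) := Real.one_le_rpow h1 (by norm_num)
  have h3 := Real.log_le_rpow_div (x := (Q : ℝ)) (by positivity) (ε := 1 / 16) (by norm_num)
  have h4 : (Q : ℝ) ^ ((1 : ℝ) / 16) / (1 / 16) = 16 * (Q : ℝ) ^ ((1 : ℝ) / 16) := by ring
  rw [h4] at h3
  nlinarith

/-- The exponential sums over the pairs are of lower order. -/
lemma norm_sum_gapPairs_exp_le (m : ℕ) (hm : 0 < m) (h : ℤ) (hh : h ≠ 0) {x : ℝ} (hx : 0 < x) :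
    ∃ A : ℝ, ∀ Q : ℕ, x < Q →
      ‖∑ z ∈ gapPairs m Q x, Complex.exp (2 * Real.pi * Complex.I * h * (z.1 : ℝ))‖ ≤
        A * (Q : ℝ) ^ ((15 : ℝ) / 8) := by
  refine ⟨∑ Δ ∈ Finset.Icc 1 ⌊x⌋₊, ∑ e ∈ Δ.divisors, ∑ t ∈ m.divisors,
    (2 * x + 17) * (2 * h.natAbs) * (0 + 17), ?_⟩
  intro Q hxQ
  have hQ' : (0 : ℝ) < Q := hx.trans hxQ
  have hQ0 : 0 < Q := by exact_mod_cast hQ'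
  have hlog : 0 ≤ Real.log Q := Real.log_nonneg (by exact_mod_cast hQ0)
  have hpow : (Q : ℝ) ^ ((15 : ℝ) / 8) =
      (Q : ℝ) ^ ((1 : ℝ) / 16) * (Q : ℝ) ^ ((3 : ℝ) / 4) * (Q * (Q : ℝ) ^ ((1 : ℝ) / 16)) := by
    have h1 : (Q : ℝ) * (Q : ℝ) ^ ((1 : ℝ) / 16) = (Q : ℝ) ^ (1 + (1 : ℝ) / 16) := by
      rw [Real.rpow_add hQ', Real.rpow_one]
    rw [h1, ← Real.rpow_add hQ', ← Real.rpow_add hQ']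
    norm_num
  have hsum := sum_gapPairs_eq_sum_fiberSum (m := m) hm hx hxQ
    (fun y => Complex.exp (2 * Real.pi * Complex.I * h * (y : ℝ)))
  rw [hsum]
  simp_rw [Finset.sum_mul]
  refine (norm_sum_le _ _).trans (Finset.sum_le_sum fun Δ hΔ => ?_)
  rw [Finset.mem_Icc] at hΔ
  refine (norm_sum_le _ _).trans (le_trans (Finset.sum_le_sum fun e he => ?_)
    (Finset.sum_le_sum_of_subset_of_nonneg (Finset.filter_subset _ _)
      (fun _ _ _ => by positivity)))
  have he0 := Nat.pos_of_mem_divisors (Finset.mem_filter.1 he).1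
  refine (norm_sum_le _ _).trans (Finset.sum_le_sum fun t ht => ?_)
  have ht0 := Nat.pos_of_mem_divisors ht
  have hμ : ∀ n : ℕ, ‖(ArithmeticFunction.moebius n : ℂ)‖ ≤ 1 := by
    intro n
    have := abs_moebius_le_one n
    rw [show (ArithmeticFunction.moebius n : ℂ) = ((ArithmeticFunction.moebius n : ℝ) : ℂ) by
      push_cast; rfl, Complex.norm_real]
    exact this
  rw [norm_mul, norm_mul]
  calc _ ≤ 1 * ∑ q ∈ Finset.Icc 1 Q, (2 * x + 1 + Real.log Q) *
        (2 * h.natAbs * (Q : ℝ) ^ ((3 : ℝ) / 4) * q.divisors.card) := by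
        refine mul_le_mul (mul_le_one₀ (hμ e) (norm_nonneg _) (hμ t)) ?_ (norm_nonneg _) zero_le_one
        refine (norm_sum_le _ _).trans (le_trans (Finset.sum_le_sum fun q hq => ?_)
          (Finset.sum_le_sum_of_subset_of_nonneg (Finset.filter_subset _ _)
            (fun _ _ _ => by positivity)))
        rw [Finset.mem_filter, Finset.mem_Icc] at hq
        exact norm_fiberSum_exp_le hx hΔ.1 he0 ht0 hq.1.1 hq.1.2
          (coprime_of_mem_divisors ht hq.2) h hh
    _ = (2 * x + 1 + Real.log Q) * (2 * h.natAbs * (Q : ℝ) ^ ((3 : ℝ) / 4)) *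
        ∑ q ∈ Finset.Icc 1 Q, (q.divisors.card : ℝ) := by
        rw [one_mul, Finset.mul_sum]
        refine Finset.sum_congr rfl fun q _ => ?_
        ring
    _ ≤ ((2 * x + 17) * (Q : ℝ) ^ ((1 : ℝ) / 16)) * (2 * h.natAbs * (Q : ℝ) ^ ((3 : ℝ) / 4)) *
        (Q * ((0 + 17) * (Q : ℝ) ^ ((1 : ℝ) / 16))) := by
        have h1 := one_add_log_le_rpow (c := 2 * x) (by positivity) hQ0
        have h2 := one_add_log_le_rpow (c := 0) le_rfl hQ0
        have h3 := sum_card_divisors_le Q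
        rw [zero_add] at h2
        refine mul_le_mul (mul_le_mul_of_nonneg_right h1 (by positivity))
          (h3.trans (mul_le_mul_of_nonneg_left h2 (by positivity)))
          (Finset.sum_nonneg fun _ _ => by positivity) (by positivity)
    _ = _ := by rw [hpow]; ring

/-! ### Weyl's criterion for weighted families of points in `(0, 1]` -/

lemma integral_fourier_zero_one (h : ℤ) :
    ∫ t in (0 : ℝ)..1, fourier (T := (1 : ℝ)) h (t : AddCircle (1 : ℝ)) = if h = 0 then 1 else 0 := by
  by_cases hh : h = 0
  · simp [hh]
  · rw [if_neg hh]
    have hc : (2 * Real.pi * Complex.I * h : ℂ) ≠ 0 := by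
      have : (Real.pi : ℂ) ≠ 0 := by exact_mod_cast Real.pi_ne_zero
      have : (h : ℂ) ≠ 0 := by exact_mod_cast hh
      simp_all
    have h1 : ∀ t : ℝ, fourier (T := (1 : ℝ)) h (t : AddCircle (1 : ℝ)) =
        Complex.exp (2 * Real.pi * Complex.I * h * t) := by
      intro t
      rw [fourier_coe_apply]
      simp
    simp_rw [h1]
    rw [integral_exp_mul_complex hc]
    have h2 : Complex.exp (2 * Real.pi * Complex.I * h * ((1 : ℝ) : ℂ)) = 1 := by
      rw [Complex.exp_eq_one_iff]
      exact ⟨h, by push_cast; ring⟩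
    rw [h2]
    simp

section Weyl

variable {ι : Type*} (S : ℕ → Finset ι) (p : ι → ℝ) (w : ℕ → ℝ) (c : ℝ)

/-- The limit holds for characters by hypothesis, hence for trigonometric polynomials, and these are
uniformly dense. The total masses converge, so a uniform approximation error is passed on with a
bounded factor. -/
lemma tendsto_sum_continuous_of_fourier (hw : ∀ n, 0 ≤ w n)
    (h0 : Tendsto (fun n => w n * ((S n).card : ℝ)) atTop (𝓝 c))
    (hh : ∀ h : ℤ, h ≠ 0 → Tendsto (fun n => (w n : ℂ) *
      ∑ i ∈ S n, Complex.exp (2 * Real.pi * Complex.I * h * (p i : ℝ))) atTop (𝓝 0))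
    (f : C(AddCircle (1 : ℝ), ℂ)) :
    Tendsto (fun n => (w n : ℂ) * ∑ i ∈ S n, f (p i : AddCircle (1 : ℝ))) atTop
      (𝓝 ((c : ℂ) * ∫ t in (0 : ℝ)..1, f (t : AddCircle (1 : ℝ)))) := by
  have hcont : ∀ f : C(AddCircle (1 : ℝ), ℂ), Continuous fun t : ℝ => f (t : AddCircle (1 : ℝ)) :=
    fun f => f.continuous.comp (AddCircle.continuous_mk' 1)
  have hspan : ∀ f ∈ Submodule.span ℂ (Set.range (@fourier (1 : ℝ))),
      Tendsto (fun n => (w n : ℂ) * ∑ i ∈ S n, f (p i : AddCircle (1 : ℝ))) atTop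
      (𝓝 ((c : ℂ) * ∫ t in (0 : ℝ)..1, f (t : AddCircle (1 : ℝ)))) := by
    intro f hf
    induction hf using Submodule.span_induction with
    | mem f hf =>
      obtain ⟨h, rfl⟩ := hf
      rw [integral_fourier_zero_one]
      by_cases h1 : h = 0
      · subst h1
        have h2 : Tendsto (fun n => ((w n * ((S n).card : ℝ) : ℝ) : ℂ)) atTop (𝓝 (c : ℂ)) :=
          (Complex.continuous_ofReal.tendsto c).comp h0
        simpa using h2
      · rw [if_neg h1, mul_zero]
        refine (hh h h1).congr fun n => ?_
        congr 1
        refine Finset.sum_congr rfl fun i _ => ?_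
        rw [fourier_coe_apply]
        simp
    | zero => simp
    | add f g _ _ hf hg =>
      simp only [ContinuousMap.add_apply, Finset.sum_add_distrib, mul_add]
      rw [intervalIntegral.integral_add ((hcont f).intervalIntegrable _ _)
        ((hcont g).intervalIntegrable _ _), mul_add]
      exact hf.add hg
    | smul a f _ hf =>
      simp only [ContinuousMap.smul_apply, smul_eq_mul, ← Finset.mul_sum]
      rw [intervalIntegral.integral_const_mul]
      have := hf.const_mul a
      refine (this.congr fun n => ?_).trans (le_of_eq ?_)
      · ring
      · congr 1; ring
  have hmem : f ∈ closure (Submodule.span ℂ (Set.range (@fourier (1 : ℝ))) :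
      Set C(AddCircle (1 : ℝ), ℂ)) := by
    rw [← Submodule.topologicalClosure_coe, span_fourier_closure_eq_top]
    trivial
  rw [Metric.tendsto_atTop]
  intro ε hε
  set δ := ε / (3 * (|c| + 1)) with hδ
  have hδ0 : 0 < δ := by positivity
  obtain ⟨g, hg, hfg⟩ := Metric.mem_closure_iff.1 hmem δ hδ0
  rw [dist_eq_norm] at hfg
  have hpt : ∀ y, ‖f y - g y‖ ≤ δ := fun y =>
    ((f - g).norm_coe_le_norm y).trans hfg.le
  have h1 := Metric.tendsto_atTop.1 (hspan g hg) (ε / 3) (by positivity)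
  have h2 := h0.eventually (Iio_mem_nhds (show c < |c| + 1 by linarith [le_abs_self c]))
  obtain ⟨N1, hN1⟩ := h1
  obtain ⟨N2, hN2⟩ := eventually_atTop.1 h2
  refine ⟨max N1 N2, fun n hn => ?_⟩
  have k1 := hN1 n (le_of_max_le_left hn)
  have k2 : w n * ((S n).card : ℝ) < |c| + 1 := hN2 n (le_of_max_le_right hn)
  rw [dist_eq_norm] at k1 ⊢
  have e1 : ‖(w n : ℂ) * ∑ i ∈ S n, f (p i : AddCircle (1 : ℝ)) -
      (w n : ℂ) * ∑ i ∈ S n, g (p i : AddCircle (1 : ℝ))‖ ≤ ε / 3 := by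
    rw [← mul_sub, ← Finset.sum_sub_distrib, norm_mul, Complex.norm_real,
      Real.norm_of_nonneg (hw n)]
    calc _ ≤ w n * ∑ i ∈ S n, δ := by
          refine mul_le_mul_of_nonneg_left ((norm_sum_le _ _).trans
            (Finset.sum_le_sum fun i _ => hpt _)) (hw n)
      _ = (w n * (S n).card) * δ := by simp; ring
      _ ≤ (|c| + 1) * δ := mul_le_mul_of_nonneg_right k2.le hδ0.le
      _ = ε / 3 := by rw [hδ]; field_simp
  have e2 : ‖(c : ℂ) * (∫ t in (0 : ℝ)..1, g (t : AddCircle (1 : ℝ))) -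
      (c : ℂ) * ∫ t in (0 : ℝ)..1, f (t : AddCircle (1 : ℝ))‖ < ε / 3 := by
    rw [← mul_sub, ← intervalIntegral.integral_sub ((hcont g).intervalIntegrable _ _)
      ((hcont f).intervalIntegrable _ _), norm_mul, Complex.norm_real, Real.norm_eq_abs]
    have h3 : ‖∫ t in (0 : ℝ)..1, (g (t : AddCircle (1 : ℝ)) - f (t : AddCircle (1 : ℝ)))‖ ≤
        δ * |1 - 0| := by
      refine intervalIntegral.norm_integral_le_of_norm_le_const fun t _ => ?_
      rw [norm_sub_rev]
      exact hpt _
    rw [sub_zero, abs_one, mul_one] at h3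
    calc _ ≤ |c| * δ := mul_le_mul_of_nonneg_left h3 (abs_nonneg c)
      _ < (|c| + 1) * δ := mul_lt_mul_of_pos_right (by linarith) hδ0
      _ = ε / 3 := by rw [hδ]; field_simp
  have e3 : ∀ a b d e : ℂ, ‖a - e‖ ≤ ‖a - b‖ + ‖b - d‖ + ‖d - e‖ := by
    intro a b d e
    calc ‖a - e‖ = ‖(a - b) + (b - d) + (d - e)‖ := by congr 1; ring
      _ ≤ _ := norm_add₃_le
  refine (e3 _ ((w n : ℂ) * ∑ i ∈ S n, g (p i : AddCircle (1 : ℝ)))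
    ((c : ℂ) * ∫ t in (0 : ℝ)..1, g (t : AddCircle (1 : ℝ))) _).trans_lt ?_
  linarith

/-- A trapezoid supported on `[α, β]`. -/
def trapezoid (α β ε x : ℝ) : ℝ := max 0 (min 1 (min (x - α) (β - x) / ε))

lemma continuous_trapezoid (α β ε : ℝ) : Continuous (trapezoid α β ε) := by
  unfold trapezoid
  fun_prop

lemma trapezoid_eq_zero {α β ε x : ℝ} (hε : 0 < ε) (hx : x ≤ α ∨ β ≤ x) :
    trapezoid α β ε x = 0 := by
  refine max_eq_left ((min_le_right _ _).trans (div_nonpos_of_nonpos_of_nonneg ?_ hε.le))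
  rcases hx with h | h
  · exact (min_le_left _ _).trans (by linarith)
  · exact (min_le_right _ _).trans (by linarith)

lemma trapezoid_le_one (α β ε x : ℝ) : trapezoid α β ε x ≤ 1 :=
  max_le zero_le_one (min_le_left _ _)

lemma le_integral_trapezoid {α β ε : ℝ} (hα : 0 ≤ α) (hβ : β ≤ 1) (hε : 0 < ε)
    (hαβ : α + ε ≤ β - ε) : β - α - 2 * ε ≤ ∫ t in (0 : ℝ)..1, trapezoid α β ε t := by
  have hi : ∀ a b, IntervalIntegrable (trapezoid α β ε) volume a b := fun a b =>
    (continuous_trapezoid α β ε).intervalIntegrable a b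
  have hnn : ∀ t, 0 ≤ trapezoid α β ε t := fun t => le_max_left _ _
  calc β - α - 2 * ε = ∫ _ in (α + ε)..(β - ε), (1 : ℝ) := by simp; ring
    _ ≤ ∫ t in (α + ε)..(β - ε), trapezoid α β ε t := by
        refine intervalIntegral.integral_mono_on hαβ (by simp) (hi _ _) fun t ht => ?_
        refine le_max_of_le_right (le_min le_rfl ?_)
        rw [le_div_iff₀ hε, one_mul]
        exact le_min (by linarith [ht.1]) (by linarith [ht.2])
    _ ≤ ∫ t in (0 : ℝ)..1, trapezoid α β ε t :=
        intervalIntegral.integral_mono_interval (by linarith) hαβ (by linarith)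
          (Eventually.of_forall hnn) (hi _ _)

-- A trapezoid below the indicator of `(α, β)` gives the lower bound. Lower bounds alone are enough,
-- since the upper ones follow by passing to complements.
open Classical in
lemma eventually_le_card_Ioo_of_fourier (hp : ∀ n, ∀ i ∈ S n, 0 < p i ∧ p i ≤ 1)
    (hw : ∀ n, 0 ≤ w n) (h0 : Tendsto (fun n => w n * ((S n).card : ℝ)) atTop (𝓝 c))
    (hh : ∀ h : ℤ, h ≠ 0 → Tendsto (fun n => (w n : ℂ) *
      ∑ i ∈ S n, Complex.exp (2 * Real.pi * Complex.I * h * (p i : ℝ))) atTop (𝓝 0))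
    {α β η : ℝ} (hα : 0 ≤ α) (hαβ : α ≤ β) (hβ : β ≤ 1) (hη : 0 < η) :
    ∀ᶠ n in atTop, c * (β - α) - η ≤
      w n * (((S n).filter fun i => p i ∈ Set.Ioo α β).card : ℝ) := by
  have hc : 0 ≤ c := ge_of_tendsto' h0 fun n => mul_nonneg (hw n) (Nat.cast_nonneg _)
  have hpos : ∀ n, 0 ≤ w n * (((S n).filter fun i => p i ∈ Set.Ioo α β).card : ℝ) := fun n =>
    mul_nonneg (hw n) (Nat.cast_nonneg _)
  rcases hαβ.eq_or_lt with heq | hlt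
  · refine Eventually.of_forall fun n => le_trans ?_ (hpos n)
    rw [heq, sub_self, mul_zero]; linarith
  -- The ramps must fit into the interval, and the mass `2 c ε` lost to them must stay below `η`.
  set ε := min ((β - α) / 2) (η / (4 * (c + 1))) with hε
  have hε0 : 0 < ε := lt_min (by linarith) (by positivity)
  have hε1 : ε ≤ (β - α) / 2 := min_le_left _ _
  have hε2 : ε ≤ η / (4 * (c + 1)) := min_le_right _ _
  have hz0 : trapezoid α β ε 0 = 0 := trapezoid_eq_zero hε0 (Or.inl hα)
  have hz1 : trapezoid α β ε 1 = 0 := trapezoid_eq_zero hε0 (Or.inr hβ)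
  set φ : ℝ → ℂ := fun x => (trapezoid α β ε x : ℂ) with hφ
  have hφc : Continuous φ := Complex.continuous_ofReal.comp (continuous_trapezoid α β ε)
  -- The trapezoid vanishes at both `0` and `1`, so it descends to a continuous function on the
  -- circle.
  set f : C(AddCircle (1 : ℝ), ℂ) := ⟨AddCircle.liftIco 1 0 φ,
    AddCircle.liftIco_continuous (by simp [hφ, hz0, hz1]) hφc.continuousOn⟩ with hf
  have hfv : ∀ x : ℝ, 0 ≤ x → x ≤ 1 → f (x : AddCircle (1 : ℝ)) = φ x := by
    intro x hx0 hx1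
    rcases hx1.eq_or_lt with h | h
    · have e1 : ((x : ℝ) : AddCircle (1 : ℝ)) = ((0 : ℝ) : AddCircle (1 : ℝ)) := by
        rw [h]
        simp
      rw [e1, h]
      change AddCircle.liftIco 1 0 φ _ = _
      rw [AddCircle.liftIco_coe_apply (by simp)]
      simp [hφ, hz0, hz1]
    · change AddCircle.liftIco 1 0 φ _ = _
      rw [AddCircle.liftIco_coe_apply ⟨hx0, by simpa using h⟩]
  have hlim := tendsto_sum_continuous_of_fourier S p w c hw h0 hh f
  have hint : ∫ t in (0 : ℝ)..1, f (t : AddCircle (1 : ℝ)) =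
      ((∫ t in (0 : ℝ)..1, trapezoid α β ε t : ℝ) : ℂ) := by
    rw [← intervalIntegral.integral_ofReal]
    refine intervalIntegral.integral_congr fun t ht => ?_
    rw [Set.uIcc_of_le zero_le_one] at ht
    exact hfv t ht.1 ht.2
  have hsum : ∀ n, (w n : ℂ) * ∑ i ∈ S n, f (p i : AddCircle (1 : ℝ)) =
      ((w n * ∑ i ∈ S n, trapezoid α β ε (p i) : ℝ) : ℂ) := by
    intro n
    push_cast
    congr 1
    exact Finset.sum_congr rfl fun i hi => hfv _ (hp n i hi).1.le (hp n i hi).2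
  simp_rw [hsum, hint] at hlim
  have hlim' : Tendsto (fun n => w n * ∑ i ∈ S n, trapezoid α β ε (p i)) atTop
      (𝓝 (c * ∫ t in (0 : ℝ)..1, trapezoid α β ε t)) := by
    have := (Complex.continuous_re.tendsto _).comp hlim
    simpa [Function.comp_def, ← Complex.ofReal_mul] using this
  have hI := le_integral_trapezoid hα hβ hε0 (by linarith)
  have hlow : c * (β - α) - η < c * ∫ t in (0 : ℝ)..1, trapezoid α β ε t := by
    have h1 := mul_le_mul_of_nonneg_left hI hc
    have h2 : c * (2 * ε) < η := by
      rw [le_div_iff₀ (by positivity)] at hε2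
      nlinarith
    nlinarith
  filter_upwards [hlim'.eventually (Ioi_mem_nhds hlow)] with n hn
  refine (le_of_lt hn).trans (mul_le_mul_of_nonneg_left ?_ (hw n))
  rw [Finset.card_filter]
  push_cast
  refine Finset.sum_le_sum fun i _ => ?_
  split_ifs with h
  · exact trapezoid_le_one _ _ _ _
  · refine le_of_eq (trapezoid_eq_zero hε0 ?_)
    by_contra hcon
    push Not at hcon
    exact h ⟨hcon.1, hcon.2⟩

-- The lower bound comes from `(α, β)`. For the upper bound, subtract from the total mass the lower
-- bounds for `(0, α)` and `(β, 1)`; thus endpoints carry no mass in the limit and it does not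
-- matter which of them belong to `J`.
open Classical in
lemma tendsto_card_of_fourier (hp : ∀ n, ∀ i ∈ S n, 0 < p i ∧ p i ≤ 1)
    (hw : ∀ n, 0 ≤ w n) (h0 : Tendsto (fun n => w n * ((S n).card : ℝ)) atTop (𝓝 c))
    (hh : ∀ h : ℤ, h ≠ 0 → Tendsto (fun n => (w n : ℂ) *
      ∑ i ∈ S n, Complex.exp (2 * Real.pi * Complex.I * h * (p i : ℝ))) atTop (𝓝 0))
    {α β : ℝ} {J : Set ℝ} (hα : 0 ≤ α) (hαβ : α ≤ β) (hβ : β ≤ 1) (hJ : Set.Ioo α β ⊆ J)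
    (hJ' : J ⊆ Set.Icc α β) :
    Tendsto (fun n => w n * (((S n).filter fun i => p i ∈ J).card : ℝ)) atTop
      (𝓝 (c * (β - α))) := by
  rw [Metric.tendsto_atTop']
  intro ε hε
  have k1 := eventually_le_card_Ioo_of_fourier S p w c hp hw h0 hh hα hαβ hβ
    (show 0 < ε / 4 by positivity)
  have k2 := eventually_le_card_Ioo_of_fourier S p w c hp hw h0 hh le_rfl hα (hαβ.trans hβ)
    (show 0 < ε / 4 by positivity)
  have k3 := eventually_le_card_Ioo_of_fourier S p w c hp hw h0 hh (hα.trans hαβ) hβ le_rfl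
    (show 0 < ε / 4 by positivity)
  have k4 := h0.eventually (Iio_mem_nhds (show c < c + ε / 4 by linarith))
  have key : ∀ᶠ n in atTop, dist (w n * (((S n).filter fun i => p i ∈ J).card : ℝ))
      (c * (β - α)) < ε := by
    filter_upwards [k1, k2, k3, k4] with n h1 h2 h3 h4
    have h4' : w n * ((S n).card : ℝ) < c + ε / 4 := h4
    have hlow : (((S n).filter fun i => p i ∈ Set.Ioo α β).card : ℝ) ≤
        ((S n).filter fun i => p i ∈ J).card := by
      exact_mod_cast Finset.card_le_card (Finset.monotone_filter_right _ fun i _ hi => hJ hi)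
    have hup : (((S n).filter fun i => p i ∈ J).card : ℝ) +
        ((S n).filter fun i => p i ∈ Set.Ioo 0 α).card +
        ((S n).filter fun i => p i ∈ Set.Ioo β 1).card ≤ (S n).card := by
      have hd1 : Disjoint ((S n).filter fun i => p i ∈ J)
          ((S n).filter fun i => p i ∈ Set.Ioo 0 α) := by
        refine Finset.disjoint_filter.2 fun i _ hi hi' => ?_
        exact absurd (hJ' hi).1 (not_le.2 hi'.2)
      have hd2 : Disjoint (((S n).filter fun i => p i ∈ J) ∪
          ((S n).filter fun i => p i ∈ Set.Ioo 0 α)) ((S n).filter fun i => p i ∈ Set.Ioo β 1) := by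
        rw [Finset.disjoint_union_left]
        constructor
        · refine Finset.disjoint_filter.2 fun i _ hi hi' => ?_
          exact absurd (hJ' hi).2 (not_le.2 hi'.1)
        · refine Finset.disjoint_filter.2 fun i _ hi hi' => ?_
          exact absurd (hi.2.trans_le hαβ) (not_lt.2 hi'.1.le)
      have h5 := Finset.card_le_card (Finset.union_subset (Finset.union_subset
        (Finset.filter_subset (fun i => p i ∈ J) (S n))
        (Finset.filter_subset (fun i => p i ∈ Set.Ioo 0 α) (S n)))
        (Finset.filter_subset (fun i => p i ∈ Set.Ioo β 1) (S n)))
      rw [Finset.card_union_of_disjoint hd2, Finset.card_union_of_disjoint hd1] at h5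
      exact_mod_cast h5
    have hlow' := mul_le_mul_of_nonneg_left hlow (hw n)
    have hup' := mul_le_mul_of_nonneg_left hup (hw n)
    rw [mul_add, mul_add] at hup'
    rw [Real.dist_eq, abs_lt]
    constructor
    · linarith
    · linarith
  obtain ⟨N, hN⟩ := eventually_atTop.1 key
  exact ⟨N, fun n hn => hN n (le_of_lt hn)⟩

end Weyl

/-! ### Distribution of the pairs and of the fractions in subintervals -/

lemma card_farey_le (m Q : ℕ) : (farey m Q).card ≤ Q * Q := by
  rw [farey_eq_image]
  refine Finset.card_image_le.trans ((Finset.card_filter_le _ _).trans ?_)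
  simp

lemma one_add_log_le_two_mul_rpow {Q : ℕ} (hQ : 0 < Q) :
    1 + Real.log Q ≤ 2 * (Q : ℝ) ^ ((1 : ℝ) / 2) := by
  have hQ' : (0 : ℝ) < Q := by exact_mod_cast hQ
  have h1 : Real.log Q = 2 * Real.log ((Q : ℝ) ^ ((1 : ℝ) / 2)) := by
    rw [Real.log_rpow hQ']; ring
  have h2 := Real.log_le_sub_one_of_pos (show 0 < (Q : ℝ) ^ ((1 : ℝ) / 2) by positivity)
  linarith

/-- The gap count with a power-saving error term, uniformly for bounded `x`. -/
lemma exists_abs_gapCount_sub_le_rpow (m : ℕ) (hm : 0 < m) {δ : ℝ} (hδ : 0 < δ) (K : ℝ) :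
    ∃ A : ℝ, ∀ Q : ℕ, 1 ≤ Q → ∀ x : ℝ, 1 ≤ x → x ≤ K →
      |(gapCount m Q x : ℝ) - gapDensity m x * (Q : ℝ) ^ 2| ≤ A * (Q : ℝ) ^ ((3 : ℝ) / 2 + δ) := by
  obtain ⟨A, hA0, hA⟩ := abs_gapCount_sub_le m hm K
  obtain ⟨B, hB⟩ := (isCompact_Icc (a := (1 : ℝ)) (b := K)).exists_bound_of_continuousOn
    (continuous_gapDensity m).continuousOn
  refine ⟨2 * A + (K ^ 4 + |B| * K ^ 2), fun Q hQ x hx1 hxK => ?_⟩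
  have hK1 : 1 ≤ K := hx1.trans hxK
  have hQ1 : (1 : ℝ) ≤ Q := by exact_mod_cast hQ
  have hQ' : (0 : ℝ) < Q := by linarith
  have hpow : (Q : ℝ) ^ ((3 : ℝ) / 2) ≤ (Q : ℝ) ^ ((3 : ℝ) / 2 + δ) :=
    Real.rpow_le_rpow_of_exponent_le hQ1 (by linarith)
  have hone : 1 ≤ (Q : ℝ) ^ ((3 : ℝ) / 2 + δ) := Real.one_le_rpow hQ1 (by linarith)
  rcases lt_or_ge x Q with h | h
  · have h1 := hA Q x (by linarith) hxK h
    have h2 : (Q : ℝ) * (1 + Real.log Q) ≤ 2 * (Q : ℝ) ^ ((3 : ℝ) / 2) := by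
      calc (Q : ℝ) * (1 + Real.log Q) ≤ Q * (2 * (Q : ℝ) ^ ((1 : ℝ) / 2)) :=
            mul_le_mul_of_nonneg_left (one_add_log_le_two_mul_rpow hQ) hQ'.le
        _ = 2 * ((Q : ℝ) ^ (1 : ℝ) * (Q : ℝ) ^ ((1 : ℝ) / 2)) := by rw [Real.rpow_one]; ring
        _ = _ := by rw [← Real.rpow_add hQ']; norm_num
    calc _ ≤ A * (Q * (1 + Real.log Q)) := h1
      _ ≤ A * (2 * (Q : ℝ) ^ ((3 : ℝ) / 2 + δ)) :=
          mul_le_mul_of_nonneg_left (h2.trans (by linarith)) hA0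
      _ = 2 * A * (Q : ℝ) ^ ((3 : ℝ) / 2 + δ) := by ring
      _ ≤ _ := by
          refine mul_le_mul_of_nonneg_right ?_ (by linarith)
          have : 0 ≤ K ^ 4 + |B| * K ^ 2 := by positivity
          linarith
  -- For `Q ≤ x ≤ K` the asymptotic count is not available, but both quantities are bounded in terms
  -- of `K`, and `Q^(3/2 + δ) ≥ 1`.
  · have hQK : (Q : ℝ) ≤ K := h.trans hxK
    have h1 : (gapCount m Q x : ℝ) ≤ K ^ 4 := by
      have h2 : gapCount m Q x ≤ (Q * Q) * (Q * Q) := by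
        rw [gapCount_eq_card]
        refine (Finset.card_filter_le _ _).trans ?_
        rw [Finset.card_product]
        exact Nat.mul_le_mul (card_farey_le m Q) (card_farey_le m Q)
      calc (gapCount m Q x : ℝ) ≤ (Q * Q) * (Q * Q) := by exact_mod_cast h2
        _ = (Q : ℝ) ^ 4 := by ring
        _ ≤ K ^ 4 := by gcongr
    have h3 : |gapDensity m x * (Q : ℝ) ^ 2| ≤ |B| * K ^ 2 := by
      rw [abs_mul, abs_of_nonneg (by positivity : (0 : ℝ) ≤ (Q : ℝ) ^ 2)]
      have h4 := (hB x ⟨hx1, hxK⟩).trans (le_abs_self B)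
      rw [Real.norm_eq_abs] at h4
      gcongr
    calc _ ≤ |(gapCount m Q x : ℝ)| + |gapDensity m x * (Q : ℝ) ^ 2| := abs_sub _ _
      _ ≤ K ^ 4 + |B| * K ^ 2 := by
          rw [Nat.abs_cast]; linarith
      _ ≤ (2 * A + (K ^ 4 + |B| * K ^ 2)) * 1 := by linarith
      _ ≤ _ := mul_le_mul_of_nonneg_left hone (by positivity)

lemma tendsto_rpow_sub_two {s : ℝ} (hs : s < 2) :
    Tendsto (fun Q : ℕ => 1 / (Q : ℝ) ^ 2 * (Q : ℝ) ^ s) atTop (𝓝 0) := by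
  have h1 : Tendsto (fun Q : ℕ => (Q : ℝ) ^ (-(2 - s))) atTop (𝓝 0) :=
    (tendsto_rpow_neg_atTop (by linarith)).comp tendsto_natCast_atTop_atTop
  refine h1.congr' ?_
  filter_upwards [eventually_gt_atTop 0] with Q hQ
  have hQ' : (0 : ℝ) < Q := by exact_mod_cast hQ
  rw [neg_sub, Real.rpow_sub hQ', Real.rpow_two]
  ring

lemma tendsto_zero_of_norm_le_rpow {E : Type*} [NormedRing E] [NormedAlgebra ℝ E]
    [NormOneClass E] {u : ℕ → E} {A s : ℝ} (hs : s < 2)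
    (hu : ∀ᶠ Q : ℕ in atTop, ‖u Q‖ ≤ A * (Q : ℝ) ^ s) :
    Tendsto (fun Q : ℕ => (1 / (Q : ℝ) ^ 2) • u Q) atTop (𝓝 0) := by
  have h1 := (tendsto_rpow_sub_two hs).const_mul A
  rw [mul_zero] at h1
  refine squeeze_zero_norm' ?_ h1
  filter_upwards [hu] with Q hQ
  rw [norm_smul, Real.norm_of_nonneg (by positivity)]
  calc _ ≤ 1 / (Q : ℝ) ^ 2 * (A * (Q : ℝ) ^ s) := mul_le_mul_of_nonneg_left hQ (by positivity)
    _ = _ := by ring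

lemma tendsto_div_sq_of_abs_sub_le {u : ℕ → ℝ} {A c : ℝ}
    (hu : ∀ᶠ Q : ℕ in atTop, |u Q - c * (Q : ℝ) ^ 2| ≤ A * (Q * (1 + Real.log Q))) :
    Tendsto (fun Q : ℕ => 1 / (Q : ℝ) ^ 2 * u Q) atTop (𝓝 c) := by
  have h1 : Tendsto (fun Q : ℕ => (1 / (Q : ℝ) ^ 2) • (u Q - c * (Q : ℝ) ^ 2)) atTop (𝓝 0) := by
    refine tendsto_zero_of_norm_le_rpow (A := |A| * 2) (s := 3 / 2) (by norm_num) ?_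
    filter_upwards [hu, eventually_gt_atTop 0] with Q hQ hQ0
    have hQ' : (0 : ℝ) < Q := by exact_mod_cast hQ0
    have hlog : 0 ≤ Real.log Q := Real.log_nonneg (by exact_mod_cast hQ0)
    rw [Real.norm_eq_abs]
    calc _ ≤ A * (Q * (1 + Real.log Q)) := hQ
      _ ≤ |A| * (Q * (1 + Real.log Q)) :=
          mul_le_mul_of_nonneg_right (le_abs_self A) (by positivity)
      _ ≤ |A| * (Q * (2 * (Q : ℝ) ^ ((1 : ℝ) / 2))) := by
          have := one_add_log_le_two_mul_rpow hQ0
          gcongr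
      _ = |A| * 2 * ((Q : ℝ) ^ (1 : ℝ) * (Q : ℝ) ^ ((1 : ℝ) / 2)) := by rw [Real.rpow_one]; ring
      _ = _ := by rw [← Real.rpow_add hQ']; norm_num
  have h2 := h1.add_const c
  rw [zero_add] at h2
  refine h2.congr' ?_
  filter_upwards [eventually_gt_atTop 0] with Q hQ0
  have hQ' : (0 : ℝ) < Q := by exact_mod_cast hQ0
  rw [smul_eq_mul]
  field_simp
  ring

lemma tendsto_gapCount_div_sq (m : ℕ) (hm : 0 < m) {x : ℝ} (hx : 0 < x) :
    Tendsto (fun Q : ℕ => 1 / (Q : ℝ) ^ 2 * (gapCount m Q x : ℝ)) atTop (𝓝 (gapDensity m x)) := by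
  obtain ⟨A, -, hA⟩ := abs_gapCount_sub_le m hm x
  refine tendsto_div_sq_of_abs_sub_le (A := A) ?_
  obtain ⟨N, hN⟩ := exists_nat_gt x
  filter_upwards [eventually_ge_atTop N] with Q hQ
  exact hA Q x hx le_rfl (hN.trans_le (by exact_mod_cast hQ))

open Classical in
lemma tendsto_card_gapPairs_filter (m : ℕ) (hm : 0 < m) {x : ℝ} (hx : 0 < x) {α β : ℝ} {J : Set ℝ}
    (hα : 0 ≤ α) (hαβ : α ≤ β) (hβ : β ≤ 1) (hJ : Set.Ioo α β ⊆ J) (hJ' : J ⊆ Set.Icc α β) :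
    Tendsto (fun Q : ℕ => 1 / (Q : ℝ) ^ 2 *
      (((gapPairs m Q x).filter fun z => z.1 ∈ J).card : ℝ)) atTop
      (𝓝 (gapDensity m x * (β - α))) := by
  refine tendsto_card_of_fourier (fun Q => gapPairs m Q x) (fun z => z.1)
    (fun Q : ℕ => 1 / (Q : ℝ) ^ 2) (gapDensity m x) ?_ (fun Q => by positivity) ?_ ?_ hα hαβ hβ hJ hJ'
  · intro Q z hz
    rw [gapPairs, Finset.mem_filter, Finset.mem_product] at hz
    exact farey_pos_le_one hz.1.1
  · simp_rw [← gapCount_eq_card]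
    exact tendsto_gapCount_div_sq m hm hx
  · intro h hh
    obtain ⟨A, hA⟩ := norm_sum_gapPairs_exp_le m hm h hh hx
    obtain ⟨N, hN⟩ := exists_nat_gt x
    have h1 := tendsto_zero_of_norm_le_rpow (E := ℂ) (A := A) (s := 15 / 8) (by norm_num)
      (u := fun Q => ∑ z ∈ gapPairs m Q x, Complex.exp (2 * Real.pi * Complex.I * h * (z.1 : ℝ))) (by
        filter_upwards [eventually_ge_atTop N] with Q hQ
        exact hA Q (hN.trans_le (by exact_mod_cast hQ)))
    simpa only [Complex.real_smul] using h1

/-- The number of fractions is the sum of `φ(q) = (φ(q)/q) · q`, so the mean value theorem for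
`φ(q)/q` applies with weight `F(t) = t`. -/
lemma tendsto_card_farey_div_sq (m : ℕ) (hm : 0 < m) :
    Tendsto (fun Q : ℕ => 1 / (Q : ℝ) ^ 2 * ((farey m Q).card : ℝ)) atTop (𝓝 (C m / 2)) := by
  refine tendsto_div_sq_of_abs_sub_le (A := m.divisors.card + 1) ?_
  filter_upwards [eventually_gt_atTop 0] with Q hQ
  have h1 : ((farey m Q).card : ℝ) = ∑ q ∈ (Finset.Icc 1 Q).filter (fun q => Nat.Coprime q m),
      (q.totient : ℝ) / q * q := by
    have h2 := sum_farey_eq m Q (fun _ => (1 : ℝ))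
    rw [Finset.sum_const, nsmul_eq_mul, mul_one] at h2
    rw [h2]
    refine Finset.sum_congr rfl fun q hq => ?_
    rw [Finset.mem_filter, Finset.mem_Icc] at hq
    have hq' : (q : ℝ) ≠ 0 := by exact_mod_cast (show q ≠ 0 by omega)
    have : NeZero q := ⟨by omega⟩
    rw [div_mul_cancel₀ _ hq', sum_Icc_coprime_eq_sum_units q (fun _ => (1 : ℝ))]
    simp [ZMod.card_units_eq_totient]
  have h3 := abs_sum_totient_div_mul_sub_le (F := fun t => t) (B := Q) m Q hm hQ
    (fun a _ b _ hab => hab) le_rfl le_rfl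
  rw [integral_id] at h3
  rw [h1]
  have h4 : C m / 2 * (Q : ℝ) ^ 2 = C m * (((Q : ℝ) ^ 2 - 0 ^ 2) / 2) := by ring
  rw [h4]
  refine h3.trans (le_of_eq (by ring))

-- The exponential sums over a single denominator are Ramanujan sums, that is Kloosterman sums with
-- second parameter `0`, so the bound already proved is more than enough.
open Classical in
lemma tendsto_card_farey_filter (m : ℕ) (hm : 0 < m) {α β : ℝ} {J : Set ℝ}
    (hα : 0 ≤ α) (hαβ : α ≤ β) (hβ : β ≤ 1) (hJ : Set.Ioo α β ⊆ J) (hJ' : J ⊆ Set.Icc α β) :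
    Tendsto (fun Q : ℕ => 1 / (Q : ℝ) ^ 2 * (((farey m Q).filter fun y => y ∈ J).card : ℝ)) atTop
      (𝓝 (C m / 2 * (β - α))) := by
  refine tendsto_card_of_fourier (fun Q => farey m Q) (fun y => y)
    (fun Q : ℕ => 1 / (Q : ℝ) ^ 2) (C m / 2) (fun Q y hy => farey_pos_le_one hy)
    (fun Q => by positivity) (tendsto_card_farey_div_sq m hm) ?_ hα hαβ hβ hJ hJ'
  intro h hh
  have h1 := tendsto_zero_of_norm_le_rpow (E := ℂ) (A := 2 * h.natAbs * (0 + 17)) (s := 15 / 8)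
    (by norm_num)
    (u := fun Q => ∑ y ∈ farey m Q, Complex.exp (2 * Real.pi * Complex.I * h * (y : ℝ))) (by
      filter_upwards [eventually_gt_atTop 0] with Q hQ
      have hQ' : (0 : ℝ) < Q := by exact_mod_cast hQ
      have hQ1 : (1 : ℝ) ≤ Q := by exact_mod_cast hQ
      rw [sum_farey_eq]
      have h2 : ∀ q ∈ (Finset.Icc 1 Q).filter (fun q => Nat.Coprime q m),
          ‖∑ a ∈ (Finset.Icc 1 q).filter (fun a => Nat.Coprime a q),
            Complex.exp (2 * Real.pi * Complex.I * h * (((a : ℝ) / q : ℝ) : ℂ))‖ ≤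
          2 * h.natAbs * (Q : ℝ) ^ ((3 : ℝ) / 4) * q.divisors.card := by
        intro q hq
        rw [Finset.mem_filter, Finset.mem_Icc] at hq
        have : NeZero q := ⟨by omega⟩
        refine le_trans (le_of_eq ?_) (norm_kloosterman_le q Q hq.1.2 h hh 0)
        congr 1
        rw [kloosterman]
        simp only [zero_mul, add_zero]
        rw [← sum_Icc_coprime_eq_sum_units q (fun b => (ZMod.stdAddChar ((h : ZMod q) * b) : ℂ))]
        refine Finset.sum_congr rfl fun a _ => ?_
        have h3 := ZMod.stdAddChar_coe (N := q) (h * a : ℤ)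
        push_cast at h3
        rw [h3]
        congr 1
        push_cast
        ring
      calc _ ≤ ∑ q ∈ (Finset.Icc 1 Q).filter (fun q => Nat.Coprime q m),
            2 * h.natAbs * (Q : ℝ) ^ ((3 : ℝ) / 4) * q.divisors.card :=
            (norm_sum_le _ _).trans (Finset.sum_le_sum h2)
        _ ≤ ∑ q ∈ Finset.Icc 1 Q, 2 * h.natAbs * (Q : ℝ) ^ ((3 : ℝ) / 4) * q.divisors.card :=
            Finset.sum_le_sum_of_subset_of_nonneg (Finset.filter_subset _ _)
              (fun _ _ _ => by positivity)
        _ = 2 * h.natAbs * (Q : ℝ) ^ ((3 : ℝ) / 4) * ∑ q ∈ Finset.Icc 1 Q, (q.divisors.card : ℝ) := by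
            rw [Finset.mul_sum]
        _ ≤ 2 * h.natAbs * (Q : ℝ) ^ ((3 : ℝ) / 4) *
            (Q * ((0 + 17) * (Q : ℝ) ^ ((1 : ℝ) / 16))) := by
            have h4 := one_add_log_le_rpow (c := 0) le_rfl hQ
            rw [zero_add] at h4
            refine mul_le_mul_of_nonneg_left ((sum_card_divisors_le Q).trans
              (mul_le_mul_of_nonneg_left h4 hQ'.le)) (by positivity)
        _ = 2 * h.natAbs * (0 + 17) * ((Q : ℝ) ^ ((3 : ℝ) / 4) * ((Q : ℝ) ^ (1 : ℝ) *
            (Q : ℝ) ^ ((1 : ℝ) / 16))) := by rw [Real.rpow_one]; ring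
        _ ≤ _ := by
            rw [← Real.rpow_add hQ', ← Real.rpow_add hQ']
            refine mul_le_mul_of_nonneg_left ?_ (by positivity)
            exact Real.rpow_le_rpow_of_exponent_le hQ1 (by norm_num))
  simpa only [Complex.real_smul] using h1

open Classical in
/-- Pairs with both members in `J`. -/
lemma tendsto_card_gapPairs_filter_both (m : ℕ) (hm : 0 < m) {x : ℝ} (hx : 0 < x) {α β : ℝ}
    {J : Set ℝ} (hα : 0 ≤ α) (hαβ : α < β) (hβ : β ≤ 1) (hJ : Set.Ioo α β ⊆ J)
    (hJ' : J ⊆ Set.Icc α β) :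
    Tendsto (fun Q : ℕ => 1 / (Q : ℝ) ^ 2 *
      (((gapPairs m Q x).filter fun z => z.1 ∈ J ∧ z.2 ∈ J).card : ℝ)) atTop
      (𝓝 (gapDensity m x * (β - α))) := by
  have hup := tendsto_card_gapPairs_filter m hm hx hα hαβ.le hβ hJ hJ'
  rw [tendsto_order]
  constructor
  · intro b hb
    have hcont : Tendsto (fun η : ℝ => gapDensity m x * (β - η - α)) (𝓝[>] 0)
        (𝓝 (gapDensity m x * (β - α))) := by
      have : Continuous fun η : ℝ => gapDensity m x * (β - η - α) := by fun_prop
      have h1 := this.tendsto 0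
      simp only [sub_zero] at h1
      exact h1.mono_left nhdsWithin_le_nhds
    have h1 := (hcont.eventually (Ioi_mem_nhds hb)).and
      (Ioo_mem_nhdsGT (show (0 : ℝ) < β - α by linarith))
    obtain ⟨η, hη1, hη2⟩ := h1.exists
    have hη0 : 0 < η := hη2.1
    have hηβ : η < β - α := hη2.2
    -- If the first member lies in `(α, β - η)` and the gap is below `η`, the second member lies in
    -- `(α, β)` automatically.
    obtain ⟨I, hI⟩ : ∃ I, I = Set.Ioo α (β - η) := ⟨_, rfl⟩
    have hlow := tendsto_card_gapPairs_filter m hm hx (J := I) hα (by linarith)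
      (by linarith) hI.ge (hI.le.trans Set.Ioo_subset_Icc_self)
    have hsmall : Tendsto (fun Q : ℕ => x / (Q : ℝ) ^ 2) atTop (𝓝 0) :=
      tendsto_const_nhds.div_atTop
        ((tendsto_pow_atTop (by norm_num)).comp tendsto_natCast_atTop_atTop)
    filter_upwards [hlow.eventually (Ioi_mem_nhds hη1),
      hsmall.eventually (Iio_mem_nhds hη0)] with Q h2 h3
    refine lt_of_lt_of_le h2 (mul_le_mul_of_nonneg_left ?_ (by positivity))
    refine Nat.cast_le.2 (Finset.card_le_card fun z hz => ?_)
    rw [Finset.mem_filter, hI] at hz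
    rw [Finset.mem_filter]
    have hz1 := hz.1
    rw [gapPairs, Finset.mem_filter] at hz1
    have h3' : x / (Q : ℝ) ^ 2 < η := h3
    exact ⟨hz.1, hJ ⟨hz.2.1, by linarith [hz.2.2]⟩, hJ ⟨by linarith [hz1.2.1, hz.2.1],
      by linarith [hz1.2.2, hz.2.2]⟩⟩
  · intro b hb
    filter_upwards [hup.eventually (Iio_mem_nhds hb)] with Q h2
    refine lt_of_le_of_lt (mul_le_mul_of_nonneg_left ?_ (by positivity)) h2
    exact Nat.cast_le.2 (Finset.card_le_card (Finset.monotone_filter_right _ fun z _ hz => hz.1))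

/-! ### From one-sided gap counts to the pair correlation measure -/

/-- Cells of length `δ` starting at `u` contain at most one point each. -/
lemma card_le_of_separated {s : Finset ℝ} {u L δ : ℝ} (hδ : 0 < δ) (hL : 0 ≤ L)
    (hs : ∀ x ∈ s, u ≤ x ∧ x ≤ u + L) (hsep : ∀ x ∈ s, ∀ y ∈ s, x ≠ y → δ ≤ |x - y|) :
    (s.card : ℝ) ≤ L / δ + 1 := by
  have h1 : s.card ≤ (Finset.range (⌊L / δ⌋₊ + 1)).card := by
    refine Finset.card_le_card_of_injOn (fun x => ⌊(x - u) / δ⌋₊) ?_ ?_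
    · intro x hx
      simp only [Finset.coe_range, Set.mem_Iio, Nat.lt_succ_iff]
      refine Nat.floor_le_floor ?_
      have := (hs x hx).2
      gcongr
      linarith
    · intro x hx y hy hxy
      by_contra hne
      have h2 := hsep x hx y hy hne
      have hx0 : 0 ≤ (x - u) / δ := div_nonneg (by linarith [(hs x hx).1]) hδ.le
      have hy0 : 0 ≤ (y - u) / δ := div_nonneg (by linarith [(hs y hy).1]) hδ.le
      simp only at hxy
      have a1 := Nat.floor_le hx0
      have a2 := Nat.lt_floor_add_one ((x - u) / δ)
      have b1 := Nat.floor_le hy0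
      have b2 := Nat.lt_floor_add_one ((y - u) / δ)
      rw [hxy] at a1 a2
      have h3 : |(x - u) / δ - (y - u) / δ| < 1 := by rw [abs_lt]; constructor <;> linarith
      rw [← sub_div, abs_div, abs_of_pos hδ, div_lt_one hδ] at h3
      have h4 : x - u - (y - u) = x - y := by ring
      rw [h4] at h3
      linarith
  rw [Finset.card_range] at h1
  have h2 : (s.card : ℝ) ≤ (⌊L / δ⌋₊ : ℝ) + 1 := by exact_mod_cast h1
  have h3 := Nat.floor_le (div_nonneg hL hδ.le)
  linarith

open Classical in
/-- Ordered pairs of distinct points of `F` whose difference, scaled by the cardinality of `F`,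
lies in `I`. -/
def nearPairs (F : Finset ℝ) (I : Set ℝ) : Finset (ℝ × ℝ) :=
  (F ×ˢ F).filter fun z => z.2 ≠ z.1 ∧ (F.card : ℝ) * (z.2 - z.1) ∈ I

lemma mem_nearPairs {F : Finset ℝ} {I : Set ℝ} {z : ℝ × ℝ} : z ∈ nearPairs F I ↔
    (z.1 ∈ F ∧ z.2 ∈ F) ∧ z.2 ≠ z.1 ∧ (F.card : ℝ) * (z.2 - z.1) ∈ I := by
  simp [nearPairs]

lemma nearPairs_mono (F : Finset ℝ) {I I' : Set ℝ} (h : I ⊆ I') :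
    nearPairs F I ⊆ nearPairs F I' := by
  intro z hz
  rw [mem_nearPairs] at hz ⊢
  exact ⟨hz.1, hz.2.1, h hz.2.2⟩

lemma card_nearPairs_union_le (F : Finset ℝ) (I I' : Set ℝ) :
    (nearPairs F (I ∪ I')).card ≤ (nearPairs F I).card + (nearPairs F I').card := by
  refine le_trans (Finset.card_le_card ?_) (Finset.card_union_le _ _)
  intro z hz
  rw [mem_nearPairs] at hz
  rw [Finset.mem_union, mem_nearPairs, mem_nearPairs]
  rcases hz.2.2 with h | h
  · exact Or.inl ⟨hz.1, hz.2.1, h⟩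
  · exact Or.inr ⟨hz.1, hz.2.1, h⟩

lemma card_nearPairs_union (F : Finset ℝ) {I I' : Set ℝ} (h : Disjoint I I') :
    (nearPairs F (I ∪ I')).card = (nearPairs F I).card + (nearPairs F I').card := by
  rw [← Finset.card_union_of_disjoint]
  · congr 1
    ext z
    rw [Finset.mem_union, mem_nearPairs, mem_nearPairs, mem_nearPairs, Set.mem_union]
    tauto
  · rw [Finset.disjoint_left]
    intro z hz hz'
    rw [mem_nearPairs] at hz hz'
    exact Set.disjoint_left.1 h hz.2.2 hz'.2.2

lemma card_nearPairs_neg (F : Finset ℝ) (I : Set ℝ) :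
    (nearPairs F (Neg.neg ⁻¹' I)).card = (nearPairs F I).card := by
  refine Finset.card_bij (fun z _ => (z.2, z.1)) ?_ ?_ ?_
  · intro z hz
    rw [mem_nearPairs] at hz ⊢
    refine ⟨⟨hz.1.2, hz.1.1⟩, hz.2.1.symm, ?_⟩
    have h1 : -((F.card : ℝ) * (z.2 - z.1)) ∈ I := hz.2.2
    have h2 : (F.card : ℝ) * (z.1 - z.2) = -((F.card : ℝ) * (z.2 - z.1)) := by ring
    simpa only [h2] using h1
  · rintro ⟨a, b⟩ _ ⟨c, d⟩ _ h
    simp only [Prod.mk.injEq] at h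
    rw [h.1, h.2]
  · rintro ⟨a, b⟩ hz
    rw [mem_nearPairs] at hz
    refine ⟨(b, a), ?_, rfl⟩
    rw [mem_nearPairs]
    refine ⟨⟨hz.1.2, hz.1.1⟩, hz.2.1.symm, ?_⟩
    have h2 : -((F.card : ℝ) * (a - b)) = (F.card : ℝ) * (b - a) := by ring
    change -((F.card : ℝ) * (a - b)) ∈ I
    rw [h2]
    exact hz.2.2

/-- A pair counted with a nonzero integer shift has one member within `T/N` of `0` and the other
within `T/N` of `1`. By separation each end holds at most `T/c + 1` points, so only boundedly many
pairs arise from working modulo `1`. -/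
lemma abs_pairCount_sub_le {F : Finset ℝ} {I : Set ℝ} {T c : ℝ} (hF : ∀ x ∈ F, 0 ≤ x ∧ x ≤ 1)
    (hN : 0 < F.card) (hT : 0 ≤ T) (hI : ∀ t ∈ I, |t| ≤ T) (hc : 0 < c)
    (hsep : ∀ x ∈ F, ∀ y ∈ F, x ≠ y → c / F.card ≤ |x - y|) :
    |pairCount F I - (nearPairs F I).card / F.card| ≤ 2 * (T / c + 1) ^ 2 / F.card := by
  classical
  have hN' : (0 : ℝ) < F.card := by exact_mod_cast hN
  set A := (F ×ˢ F).filter (fun z : ℝ × ℝ => z.2 ≠ z.1 ∧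
    ∃ t ∈ I, ∃ k : ℤ, z.2 - z.1 = t / (F.card : ℝ) + (k : ℝ)) with hA
  set L := F.filter (fun x => x ≤ T / F.card) with hL
  set R := F.filter (fun x => 1 - T / F.card ≤ x) with hR
  have hpc : pairCount F I = (A.card : ℝ) / F.card := by
    rw [pairCount, ← Set.ncard_coe_finset A]
    congr 3
    ext z
    simp [hA, and_assoc]
  have hsub1 : nearPairs F I ⊆ A := by
    intro z hz
    rw [mem_nearPairs] at hz
    rw [hA, Finset.mem_filter, Finset.mem_product]
    refine ⟨hz.1, hz.2.1, _, hz.2.2, 0, ?_⟩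
    push_cast
    field_simp
    ring
  have hsub2 : A ⊆ nearPairs F I ∪ (L ×ˢ R ∪ R ×ˢ L) := by
    intro z hz
    rw [hA, Finset.mem_filter, Finset.mem_product] at hz
    obtain ⟨⟨h1, h2⟩, hne, t, ht, k, hk⟩ := hz
    have hb1 := hF _ h1
    have hb2 := hF _ h2
    have htT := abs_le.1 (hI t ht)
    have ht1 : t / F.card ≤ T / F.card := by gcongr; exact htT.2
    have ht2 : -(T / F.card) ≤ t / F.card := by
      rw [← neg_div]; gcongr; exact htT.1
    rw [Finset.mem_union, Finset.mem_union, Finset.mem_product, Finset.mem_product, hL, hR]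
    simp only [Finset.mem_filter]
    rcases lt_trichotomy k 0 with h | h | h
    · have hk1 : (k : ℝ) ≤ -1 := by exact_mod_cast (show k ≤ -1 by omega)
      exact Or.inr (Or.inr ⟨⟨h1, by linarith⟩, h2, by linarith⟩)
    · left
      rw [mem_nearPairs]
      refine ⟨⟨h1, h2⟩, hne, ?_⟩
      rw [hk, h]
      have : (F.card : ℝ) * (t / F.card + ((0 : ℤ) : ℝ)) = t := by push_cast; field_simp; ring
      rw [this]; exact ht
    · have hk1 : (1 : ℝ) ≤ k := by exact_mod_cast (show 1 ≤ k by omega)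
      exact Or.inr (Or.inl ⟨⟨h1, by linarith⟩, h2, by linarith⟩)
  have hTN : 0 ≤ T / F.card := by positivity
  have hquot : T / F.card / (c / F.card) = T / c := by field_simp
  have hLc : (L.card : ℝ) ≤ T / c + 1 := by
    rw [← hquot]
    refine card_le_of_separated (u := 0) (by positivity) hTN ?_ ?_
    · intro x hx
      rw [hL, Finset.mem_filter] at hx
      exact ⟨(hF x hx.1).1, by linarith [hx.2]⟩
    · intro x hx y hy
      exact hsep x (Finset.mem_filter.1 hx).1 y (Finset.mem_filter.1 hy).1
  have hRc : (R.card : ℝ) ≤ T / c + 1 := by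
    rw [← hquot]
    refine card_le_of_separated (u := 1 - T / F.card) (by positivity) hTN ?_ ?_
    · intro x hx
      rw [hR, Finset.mem_filter] at hx
      exact ⟨hx.2, by linarith [(hF x hx.1).2]⟩
    · intro x hx y hy
      exact hsep x (Finset.mem_filter.1 hx).1 y (Finset.mem_filter.1 hy).1
  have hc1 : ((nearPairs F I).card : ℝ) ≤ A.card := by exact_mod_cast Finset.card_le_card hsub1
  have hc2 : (A.card : ℝ) ≤ (nearPairs F I).card + 2 * (T / c + 1) ^ 2 := by
    have h1 : A.card ≤ (nearPairs F I).card + (L.card * R.card + R.card * L.card) := by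
      refine (Finset.card_le_card hsub2).trans ((Finset.card_union_le _ _).trans ?_)
      refine Nat.add_le_add_left ((Finset.card_union_le _ _).trans ?_) _
      rw [Finset.card_product, Finset.card_product]
    have h2 : (A.card : ℝ) ≤ (nearPairs F I).card + (L.card * R.card + R.card * L.card) := by
      exact_mod_cast h1
    have h3 : (L.card : ℝ) * R.card ≤ (T / c + 1) * (T / c + 1) :=
      mul_le_mul hLc hRc (by positivity) (by positivity)
    nlinarith
  rw [hpc, ← sub_div, abs_div, abs_of_pos hN', abs_of_nonneg (by linarith)]
  gcongr
  linarith

/-- The even measure with density `g |t|`. -/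
def evenMeasure (g : ℝ → ℝ) : Measure ℝ := volume.withDensity fun t => ENNReal.ofReal (g |t|)

lemma evenMeasure_toReal {g : ℝ → ℝ} (hg : Continuous g) (hg0 : ∀ t, 0 ≤ g t) {a b : ℝ}
    (hab : a ≤ b) {I : Set ℝ} (h1 : Set.Ioo a b ⊆ I) (h2 : I ⊆ Set.Icc a b) :
    (evenMeasure g I).toReal = ∫ t in a..b, g |t| := by
  have hac : evenMeasure g ≪ volume := withDensity_absolutelyContinuous _ _
  have hcont : Continuous fun t : ℝ => g |t| := hg.comp continuous_abs
  have hIoc : evenMeasure g I = evenMeasure g (Set.Ioc a b) := by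
    have e1 : (Set.Ioo a b : Set ℝ) =ᵐ[evenMeasure g] Set.Ioc a b :=
      hac.ae_le Ioo_ae_eq_Ioc
    have e2 : (Set.Icc a b : Set ℝ) =ᵐ[evenMeasure g] Set.Ioc a b :=
      hac.ae_le Ioc_ae_eq_Icc.symm
    refine le_antisymm ?_ ?_
    · rw [← measure_congr e2]; exact measure_mono h2
    · rw [← measure_congr e1]; exact measure_mono h1
  rw [hIoc, evenMeasure, withDensity_apply _ measurableSet_Ioc,
    intervalIntegral.integral_of_le hab, integral_eq_lintegral_of_nonneg_ae]
  · exact Eventually.of_forall fun t => hg0 _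
  · exact hcont.aestronglyMeasurable

section Abstract

variable {F : ℕ → Finset ℝ} {g : ℝ → ℝ}

/-- For `I` with endpoints `a ≤ b`, the count is squeezed between those for `(a, b - ε]` and `(a -
ε, b]`, which are differences of counts over `(0, t]`. Continuity of the primitive of `g` closes the
gap, whichever endpoints belong to `I`. -/
lemma tendsto_nearPairs_of_pos (hg : Continuous g) (hg0 : ∀ t, 0 ≤ g t)
    (hN : ∀ᶠ n in atTop, 0 < (F n).card)
    (hH : ∀ t : ℝ, 0 < t → Tendsto (fun n => ((nearPairs (F n) (Set.Ioc 0 t)).card : ℝ) / (F n).card)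
      atTop (𝓝 (∫ s in (0 : ℝ)..t, g s)))
    {I : Set ℝ} (hI : I.OrdConnected) (hb : Bornology.IsBounded I) (hpos : I ⊆ Set.Ioi 0) :
    Tendsto (fun n => ((nearPairs (F n) I).card : ℝ) / (F n).card) atTop
      (𝓝 (evenMeasure g I).toReal) := by
  rcases I.eq_empty_or_nonempty with rfl | hne
  · have : ∀ n, nearPairs (F n) ∅ = ∅ := by
      intro n; ext z; simp [mem_nearPairs]
    simp [this]
  set a := sInf I with ha
  set b := sSup I with hbdef
  have hBA : BddAbove I := hb.bddAbove
  have hBB : BddBelow I := hb.bddBelow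
  have hsub : I ⊆ Set.Icc a b := fun t ht => ⟨csInf_le hBB ht, le_csSup hBA ht⟩
  have hsup : Set.Ioo a b ⊆ I := by
    intro t ht
    obtain ⟨u, hu, hut⟩ := exists_lt_of_csInf_lt hne ht.1
    obtain ⟨v, hv, htv⟩ := exists_lt_of_lt_csSup hne ht.2
    exact hI.out hu hv ⟨hut.le, htv.le⟩
  have hab : a ≤ b := csInf_le_csSup hne hBB hBA
  have ha0 : 0 ≤ a := le_csInf hne fun t ht => (hpos ht).le
  set G : ℝ → ℝ := fun t => ∫ s in (0 : ℝ)..(max t 0), g s with hG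
  have hGc : Continuous G := by
    have h1 : Continuous fun t : ℝ => ∫ s in (0 : ℝ)..t, g s :=
      intervalIntegral.continuous_primitive (fun a b => hg.intervalIntegrable a b) 0
    exact h1.comp (continuous_id.max continuous_const)
  have hHG : ∀ t : ℝ, Tendsto (fun n => ((nearPairs (F n) (Set.Ioc 0 t)).card : ℝ) / (F n).card)
      atTop (𝓝 (G t)) := by
    intro t
    rcases lt_or_ge 0 t with h | h
    · simp only [hG, max_eq_left h.le]; exact hH t h
    · have : ∀ n, nearPairs (F n) (Set.Ioc 0 t) = ∅ := by
        intro n; ext z; simp [mem_nearPairs, Set.Ioc_eq_empty (not_lt.2 h)]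
      simp [this, hG, max_eq_right h]
  have hμ : (evenMeasure g I).toReal = G b - G a := by
    rw [evenMeasure_toReal hg hg0 hab hsup hsub]
    simp only [hG, max_eq_left ha0, max_eq_left (ha0.trans hab)]
    rw [intervalIntegral.integral_interval_sub_left (hg.intervalIntegrable _ _)
      (hg.intervalIntegrable _ _)]
    refine intervalIntegral.integral_congr fun t ht => ?_
    rw [Set.uIcc_of_le hab] at ht
    rw [abs_of_nonneg (ha0.trans ht.1)]
  rw [hμ, tendsto_order]
  have hposset : I ⊆ Set.Ioc 0 b := fun t ht => ⟨hpos ht, (hsub ht).2⟩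
  constructor
  · intro y hy
    have h1 : Tendsto (fun ε : ℝ => G (b - ε) - G a) (𝓝[>] 0) (𝓝 (G b - G a)) := by
      have h2 : Continuous fun ε : ℝ => G (b - ε) - G a :=
        (hGc.comp (continuous_const.sub continuous_id)).sub continuous_const
      have h3 := h2.tendsto 0
      simp only [sub_zero] at h3
      exact h3.mono_left nhdsWithin_le_nhds
    obtain ⟨ε, hε1, hε0⟩ := ((h1.eventually (Ioi_mem_nhds hy)).and self_mem_nhdsWithin).exists
    filter_upwards [((hHG (b - ε)).sub (hHG a)).eventually (Ioi_mem_nhds hε1), hN] with n hn hNn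
    refine lt_of_lt_of_le hn ?_
    rw [← sub_div]
    gcongr
    have h2 : (nearPairs (F n) (Set.Ioc 0 (b - ε))).card ≤
        (nearPairs (F n) I).card + (nearPairs (F n) (Set.Ioc 0 a)).card := by
      refine le_trans (Finset.card_le_card (nearPairs_mono _ ?_)) (card_nearPairs_union_le _ _ _)
      intro t ht
      have hε0' : 0 < ε := hε0
      rcases le_or_gt t a with h | h
      · exact Or.inr ⟨ht.1, h⟩
      · exact Or.inl (hsup ⟨h, by linarith [ht.2]⟩)
    have h3 : ((nearPairs (F n) (Set.Ioc 0 (b - ε))).card : ℝ) ≤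
        (nearPairs (F n) I).card + (nearPairs (F n) (Set.Ioc 0 a)).card := by exact_mod_cast h2
    linarith
  · intro y hy
    have h1 : Tendsto (fun ε : ℝ => G b - G (a - ε)) (𝓝[>] 0) (𝓝 (G b - G a)) := by
      have h2 : Continuous fun ε : ℝ => G b - G (a - ε) :=
        continuous_const.sub (hGc.comp (continuous_const.sub continuous_id))
      have h3 := h2.tendsto 0
      simp only [sub_zero] at h3
      exact h3.mono_left nhdsWithin_le_nhds
    obtain ⟨ε, hε1, hε0⟩ := ((h1.eventually (Iio_mem_nhds hy)).and self_mem_nhdsWithin).exists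
    filter_upwards [((hHG b).sub (hHG (a - ε))).eventually (Iio_mem_nhds hε1), hN] with n hn hNn
    refine lt_of_le_of_lt ?_ hn
    rw [← sub_div]
    gcongr
    have hε0' : 0 < ε := hε0
    have hdisj : Disjoint I (Set.Ioc 0 (a - ε)) := by
      rw [Set.disjoint_left]
      intro t ht ht'
      linarith [(hsub ht).1, ht'.2]
    have h2 : (nearPairs (F n) I).card + (nearPairs (F n) (Set.Ioc 0 (a - ε))).card ≤
        (nearPairs (F n) (Set.Ioc 0 b)).card := by
      rw [← card_nearPairs_union _ hdisj]
      refine Finset.card_le_card (nearPairs_mono _ (Set.union_subset hposset ?_))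
      exact Set.Ioc_subset_Ioc_right (by linarith)
    have h3 : ((nearPairs (F n) I).card : ℝ) + (nearPairs (F n) (Set.Ioc 0 (a - ε))).card ≤
        (nearPairs (F n) (Set.Ioc 0 b)).card := by exact_mod_cast h2
    linarith

lemma evenMeasure_neg {g : ℝ → ℝ} (I : Set ℝ) (hI : MeasurableSet I) :
    evenMeasure g (Neg.neg ⁻¹' I) = evenMeasure g I := by
  rw [evenMeasure, withDensity_apply _ (measurable_neg hI), withDensity_apply _ hI,
    ← lintegral_indicator (measurable_neg hI), ← lintegral_indicator hI,
    ← lintegral_neg_eq_self]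
  refine lintegral_congr fun t => ?_
  have h : -t ∈ (Neg.neg ⁻¹' I : Set ℝ) ↔ t ∈ I := by rw [Set.mem_preimage, neg_neg]
  by_cases ht : t ∈ I
  · rw [Set.indicator_of_mem (h.2 ht), Set.indicator_of_mem ht, abs_neg]
  · rw [Set.indicator_of_notMem (mt h.1 ht), Set.indicator_of_notMem ht]

/-- Swapping the members of a pair carries negative differences to positive ones, matching the
evenness of the measure. The point `0` is invisible on both sides: members of a pair are distinct,
and the measure has no atoms. -/
lemma tendsto_nearPairs (hg : Continuous g) (hg0 : ∀ t, 0 ≤ g t)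
    (hN : ∀ᶠ n in atTop, 0 < (F n).card)
    (hH : ∀ t : ℝ, 0 < t → Tendsto (fun n => ((nearPairs (F n) (Set.Ioc 0 t)).card : ℝ) / (F n).card)
      atTop (𝓝 (∫ s in (0 : ℝ)..t, g s)))
    {I : Set ℝ} (hI : I.OrdConnected) (hb : Bornology.IsBounded I) :
    Tendsto (fun n => ((nearPairs (F n) I).card : ℝ) / (F n).card) atTop
      (𝓝 (evenMeasure g I).toReal) := by
  have hlf : IsLocallyFiniteMeasure (evenMeasure g) :=
    IsLocallyFiniteMeasure.withDensity_ofReal (hg.comp continuous_abs)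
  set P := I ∩ Set.Ioi 0 with hP
  set M := I ∩ Set.Iio 0 with hM
  have hPm : Tendsto (fun n => ((nearPairs (F n) P).card : ℝ) / (F n).card) atTop
      (𝓝 (evenMeasure g P).toReal) :=
    tendsto_nearPairs_of_pos hg hg0 hN hH (hI.inter Set.ordConnected_Ioi)
      (hb.subset Set.inter_subset_left) Set.inter_subset_right
  have hMoc : M.OrdConnected := hI.inter Set.ordConnected_Iio
  have hMM : Tendsto (fun n => ((nearPairs (F n) M).card : ℝ) / (F n).card) atTop
      (𝓝 (evenMeasure g M).toReal) := by
    have h1 := tendsto_nearPairs_of_pos (I := Neg.neg ⁻¹' M) hg hg0 hN hH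
      (hMoc.preimage_anti fun a b hab => neg_le_neg hab)
      ((hb.subset Set.inter_subset_left).neg) (by
        intro t ht
        have h2 : -t < 0 := ht.2
        exact neg_lt_zero.1 h2)
    rw [evenMeasure_neg M hMoc.measurableSet] at h1
    simpa only [card_nearPairs_neg] using h1
  have hdisj : Disjoint P M := by
    rw [Set.disjoint_left]
    intro t ht ht'
    exact lt_asymm (show 0 < t from ht.2) ht'.2
  have hcard : ∀ n, (nearPairs (F n) I).card = (nearPairs (F n) P).card + (nearPairs (F n) M).card := by
    intro n
    rw [← card_nearPairs_union _ hdisj]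
    congr 1
    ext z
    rw [mem_nearPairs, mem_nearPairs]
    constructor
    · rintro ⟨h1, h2, h3⟩
      refine ⟨h1, h2, ?_⟩
      have hn0 : (0 : ℝ) < (F n).card := by exact_mod_cast Finset.card_pos.2 ⟨_, h1.1⟩
      rcases lt_or_gt_of_ne (mul_ne_zero hn0.ne' (sub_ne_zero.2 h2)) with h | h
      · exact Or.inr ⟨h3, h⟩
      · exact Or.inl ⟨h3, h⟩
    · rintro ⟨h1, h2, h3⟩
      exact ⟨h1, h2, h3.elim (fun h => h.1) (fun h => h.1)⟩
  have hmeas : (evenMeasure g I).toReal = (evenMeasure g P).toReal + (evenMeasure g M).toReal := by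
    have hfin : ∀ J ⊆ I, evenMeasure g J ≠ ⊤ := fun J hJ =>
      (hb.subset hJ).measure_lt_top.ne
    rw [← ENNReal.toReal_add (hfin P Set.inter_subset_left) (hfin M Set.inter_subset_left),
      ← measure_union hdisj hMoc.measurableSet]
    congr 1
    refine le_antisymm ?_ (measure_mono (Set.union_subset Set.inter_subset_left
      Set.inter_subset_left))
    have h0 : evenMeasure g {0} = 0 :=
      withDensity_absolutelyContinuous _ _ (Real.volume_singleton)
    calc evenMeasure g I ≤ evenMeasure g ((P ∪ M) ∪ {0}) := by
          refine measure_mono fun t ht => ?_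
          rcases lt_trichotomy t 0 with h | h | h
          · exact Or.inl (Or.inr ⟨ht, h⟩)
          · exact Or.inr h
          · exact Or.inl (Or.inl ⟨ht, h⟩)
      _ ≤ evenMeasure g (P ∪ M) + evenMeasure g {0} := measure_union_le _ _
      _ = _ := by rw [h0, add_zero]
  rw [hmeas]
  refine (hPm.add hMM).congr fun n => ?_
  rw [hcard n, Nat.cast_add, add_div]

/-- A criterion for `g` to be the pair correlation function of a sequence of separated subsets of
the unit interval. -/
lemma isPairCorrelationFunction_of_tendsto (hg : Continuous g) (hg0 : ∀ t, 0 ≤ g t)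
    (hF : ∀ n, ∀ x ∈ F n, 0 ≤ x ∧ x ≤ 1)
    (hN : Tendsto (fun n => ((F n).card : ℝ)) atTop atTop) {c : ℝ} (hc : 0 < c)
    (hsep : ∀ᶠ n in atTop, ∀ x ∈ F n, ∀ y ∈ F n, x ≠ y → c / (F n).card ≤ |x - y|)
    (hH : ∀ t : ℝ, 0 < t → Tendsto (fun n => ((nearPairs (F n) (Set.Ioc 0 t)).card : ℝ) / (F n).card)
      atTop (𝓝 (∫ s in (0 : ℝ)..t, g s))) :
    IsPairCorrelationFunction F g := by
  have hN0 : ∀ᶠ n in atTop, 0 < (F n).card := by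
    filter_upwards [hN.eventually_gt_atTop 0] with n hn
    exact_mod_cast hn
  refine ⟨evenMeasure g, ⟨IsLocallyFiniteMeasure.withDensity_ofReal (hg.comp continuous_abs), ?_⟩, ?_⟩
  · intro I hI hb
    obtain ⟨T, hT0, hT⟩ := hb.exists_pos_norm_le
    have h1 := tendsto_nearPairs hg hg0 hN0 hH hI hb
    have h2 : Tendsto (fun n => pairCount (F n) I - ((nearPairs (F n) I).card : ℝ) / (F n).card)
        atTop (𝓝 0) := by
      have h3 : Tendsto (fun n => 2 * (T / c + 1) ^ 2 / ((F n).card : ℝ)) atTop (𝓝 0) :=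
        tendsto_const_nhds.div_atTop hN
      refine squeeze_zero_norm' ?_ h3
      filter_upwards [hN0, hsep] with n hn hs
      exact abs_pairCount_sub_le (hF n) hn hT0.le hT hc hs
    have h4 := h2.add h1
    rw [zero_add] at h4
    exact h4.congr fun n => by ring
  · intro x hx
    refine ⟨hg.intervalIntegrable _ _, ?_⟩
    rw [evenMeasure_toReal hg hg0 hx.le Set.Ioo_subset_Icc_self subset_rfl]
    refine intervalIntegral.integral_congr fun t ht => ?_
    rw [Set.uIcc_of_le hx.le] at ht
    rw [abs_of_nonneg ht.1]

end Abstract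

/-! ### Pair correlation of Farey fractions in an interval -/

/-- The gap parameter that belongs to a scaled distance `t` depends on the actual number of points
and hence moves with `Q`; monotonicity and continuity of the limit replace uniform convergence. -/
lemma tendsto_apply_of_monotone {M : ℕ → ℝ → ℝ} {f : ℝ → ℝ} (hM : ∀ n, Monotone (M n))
    (h : ∀ x, 0 < x → Tendsto (fun n => M n x) atTop (𝓝 (f x))) {x₀ : ℝ} (hx₀ : 0 < x₀)
    (hf : ContinuousAt f x₀) {x : ℕ → ℝ} (hx : Tendsto x atTop (𝓝 x₀)) :
    Tendsto (fun n => M n (x n)) atTop (𝓝 (f x₀)) := by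
  rw [tendsto_order]
  constructor
  · intro y hy
    have h1 : ∀ᶠ u in 𝓝[<] x₀, y < f u ∧ 0 < u :=
      ((hf.eventually (Ioi_mem_nhds hy)).and (Ioi_mem_nhds hx₀)).filter_mono nhdsWithin_le_nhds
    obtain ⟨u, ⟨hu, hu0⟩, hux⟩ := (h1.and self_mem_nhdsWithin).exists
    filter_upwards [(h u hu0).eventually (Ioi_mem_nhds hu), hx.eventually (Ioi_mem_nhds hux)]
      with n h2 h3
    exact lt_of_lt_of_le h2 (hM n (le_of_lt h3))
  · intro y hy
    have h1 : ∀ᶠ u in 𝓝[>] x₀, f u < y ∧ 0 < u :=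
      ((hf.eventually (Iio_mem_nhds hy)).and (Ioi_mem_nhds hx₀)).filter_mono nhdsWithin_le_nhds
    obtain ⟨u, ⟨hu, hu0⟩, hux⟩ := (h1.and self_mem_nhdsWithin).exists
    filter_upwards [(h u hu0).eventually (Iio_mem_nhds hu), hx.eventually (Iio_mem_nhds hux)]
      with n h2 h3
    exact lt_of_le_of_lt (hM n (le_of_lt h3)) h2

lemma gapPairs_mono (m Q : ℕ) {x y : ℝ} (h : x ≤ y) : gapPairs m Q x ⊆ gapPairs m Q y := by
  intro z hz
  simp only [gapPairs, Finset.mem_filter] at hz ⊢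
  exact ⟨hz.1, hz.2.1, hz.2.2.trans (by gcongr)⟩

lemma inv_sq_le_abs_sub_of_mem_farey {m Q : ℕ} {x y : ℝ} (hx : x ∈ farey m Q)
    (hy : y ∈ farey m Q) (hxy : x ≠ y) : 1 / (Q : ℝ) ^ 2 ≤ |x - y| := by
  obtain ⟨a, q, ⟨h1, h2, h3, -⟩, rfl⟩ := mem_farey.1 hx
  obtain ⟨b, r, ⟨k1, k2, k3, -⟩, rfl⟩ := mem_farey.1 hy
  have hq : (0 : ℝ) < q := by exact_mod_cast (show 0 < q by omega)
  have hr : (0 : ℝ) < r := by exact_mod_cast (show 0 < r by omega)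
  have hq' : (q : ℝ) ≤ Q := by exact_mod_cast h3
  have hr' : (r : ℝ) ≤ Q := by exact_mod_cast k3
  have hne : ((a * r - q * b : ℤ)) ≠ 0 := by
    intro h0
    apply hxy
    rw [div_eq_div_iff hq.ne' hr.ne']
    have h4 : ((a * r - q * b : ℤ) : ℝ) = 0 := by rw [h0]; simp
    push_cast at h4
    linarith
  have h5 : (1 : ℝ) ≤ |(a : ℝ) * r - q * b| := by exact_mod_cast Int.one_le_abs hne
  rw [div_sub_div _ _ hq.ne' hr.ne', abs_div, abs_of_pos (mul_pos hq hr)]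
  refine div_le_div₀ (abs_nonneg _) h5 (mul_pos hq hr) ?_
  rw [sq]
  exact mul_le_mul hq' hr' hr.le (hq.le.trans hq')

section Interval

variable {α β : ℝ} {J : Set ℝ}

lemma rescale_injective (hαβ : α < β) : Function.Injective fun x : ℝ => (x - α) / (β - α) := by
  intro x y h
  have h1 : β - α ≠ 0 := (sub_pos.2 hαβ).ne'
  simp only at h
  rw [div_left_inj' h1] at h
  linarith

open Classical in
lemma card_fareyIn (m Q : ℕ) (hαβ : α < β) :
    (fareyIn m α β J Q).card = ((farey m Q).filter (· ∈ J)).card :=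
  Finset.card_image_of_injective _ (rescale_injective hαβ)

-- Undoing the affine map multiplies gaps by `β - α`, so a scaled gap of at most `t` means `y - x ≤
-- (β - α) t / N`, which is then written in the form `x / Q²`.
open Classical in
lemma card_nearPairs_fareyIn {m Q : ℕ} (hαβ : α < β) (hQ : 0 < Q) (t : ℝ)
    (hN : 0 < (fareyIn m α β J Q).card) :
    (nearPairs (fareyIn m α β J Q) (Set.Ioc 0 t)).card =
      ((gapPairs m Q ((β - α) * t * ((Q : ℝ) ^ 2 / (fareyIn m α β J Q).card))).filter
        fun z => z.1 ∈ J ∧ z.2 ∈ J).card := by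
  have hN' : (0 : ℝ) < (fareyIn m α β J Q).card := by exact_mod_cast hN
  have hL : 0 < β - α := sub_pos.2 hαβ
  have hQ' : (0 : ℝ) < Q := by exact_mod_cast hQ
  set f : ℝ → ℝ := fun x => (x - α) / (β - α) with hf
  have hinj : Function.Injective f := rescale_injective hαβ
  conv_rhs => rw [← Finset.card_image_of_injective _ (hinj.prodMap hinj)]
  congr 1
  have key : ∀ x y : ℝ, (f y ≠ f x ∧ ((fareyIn m α β J Q).card : ℝ) * (f y - f x) ∈ Set.Ioc 0 t) ↔
      (0 < y - x ∧ y - x ≤ (β - α) * t * ((Q : ℝ) ^ 2 / (fareyIn m α β J Q).card) / (Q : ℝ) ^ 2) := by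
    intro x y
    have e1 : f y - f x = (y - x) / (β - α) := by simp only [hf]; rw [← sub_div]; congr 1; ring
    have e2 : (β - α) * t * ((Q : ℝ) ^ 2 / (fareyIn m α β J Q).card) / (Q : ℝ) ^ 2 =
        (β - α) * t / (fareyIn m α β J Q).card := by field_simp
    rw [Set.mem_Ioc, e1, e2, mul_pos_iff_of_pos_left hN', le_div_iff₀ hN',
      div_pos_iff_of_pos_right hL, mul_div_assoc', div_le_iff₀ hL]
    constructor
    · rintro ⟨_, h1, h2⟩; exact ⟨h1, by linarith⟩
    · rintro ⟨h1, h2⟩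
      exact ⟨fun h => (sub_pos.1 h1).ne' (hinj h), h1, by linarith⟩
  ext ⟨u, v⟩
  simp only [mem_nearPairs, Finset.mem_image, Finset.mem_filter, gapPairs, Finset.mem_product,
    Prod.map, Prod.mk.injEq, Prod.exists]
  constructor
  · rintro ⟨⟨hu, hv⟩, h2⟩
    obtain ⟨x, hx, rfl⟩ := Finset.mem_image.1 hu
    obtain ⟨y, hy, rfl⟩ := Finset.mem_image.1 hv
    rw [Finset.mem_filter] at hx hy
    exact ⟨x, y, ⟨⟨⟨hx.1, hy.1⟩, (key x y).1 h2⟩, hx.2, hy.2⟩, rfl, rfl⟩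
  · rintro ⟨x, y, ⟨⟨⟨hx, hy⟩, h2⟩, hxJ, hyJ⟩, rfl, rfl⟩
    exact ⟨⟨Finset.mem_image_of_mem _ (Finset.mem_filter.2 ⟨hx, hxJ⟩),
      Finset.mem_image_of_mem _ (Finset.mem_filter.2 ⟨hy, hyJ⟩)⟩, (key x y).2 h2⟩

/-- The pair correlation function of the rescaled Farey fractions in a subinterval of `[0, 1]`. -/
theorem isPairCorrelationFunction_fareyIn (m : ℕ) (hm : 0 < m) (hα : 0 ≤ α) (hαβ : α < β)
    (hβ : β ≤ 1) (hJ : Set.Ioo α β ⊆ J) (hJ' : J ⊆ Set.Icc α β) :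
    IsPairCorrelationFunction (fareyIn m α β J) (g m) := by
  classical
  have hL : 0 < β - α := sub_pos.2 hαβ
  have hC : 0 < C m := C_pos m hm
  have hcard : Tendsto (fun Q : ℕ => ((fareyIn m α β J Q).card : ℝ) / (Q : ℝ) ^ 2) atTop
      (𝓝 (C m / 2 * (β - α))) := by
    refine (tendsto_card_farey_filter m hm hα hαβ.le hβ hJ hJ').congr fun Q => ?_
    rw [card_fareyIn m Q hαβ]; ring
  have hlim : 0 < C m / 2 * (β - α) := by positivity
  have hsq : Tendsto (fun Q : ℕ => (Q : ℝ) ^ 2) atTop atTop :=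
    (tendsto_pow_atTop two_ne_zero).comp tendsto_natCast_atTop_atTop
  have hN : Tendsto (fun Q => ((fareyIn m α β J Q).card : ℝ)) atTop atTop := by
    refine (hcard.pos_mul_atTop hlim hsq).congr' ?_
    filter_upwards [eventually_gt_atTop 0] with Q hQ
    have : (Q : ℝ) ^ 2 ≠ 0 := by positivity
    field_simp
  have hinv : Tendsto (fun Q : ℕ => (Q : ℝ) ^ 2 / ((fareyIn m α β J Q).card : ℝ)) atTop
      (𝓝 (C m / 2 * (β - α))⁻¹) :=
    (hcard.inv₀ hlim.ne').congr fun Q => inv_div _ _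
  refine isPairCorrelationFunction_of_tendsto (c := C m / 4) (continuous_g m hm) (g_nonneg m hm)
    ?_ hN (by positivity) ?_ ?_
  · intro Q x hx
    obtain ⟨y, hy, rfl⟩ := Finset.mem_image.1 hx
    have hy' := hJ' (Finset.mem_filter.1 hy).2
    exact ⟨div_nonneg (by linarith [hy'.1]) hL.le, (div_le_one hL).2 (by linarith [hy'.2])⟩
  -- Distinct fractions differ by at least `1/Q²`, and eventually `N` exceeds half of its asymptotic
  -- size `(C m / 2)(β - α) Q²`. This is where the separation constant `C m / 4` comes from.
  · have h1 : C m / 4 * (β - α) < C m / 2 * (β - α) := by nlinarith [mul_pos hC hL]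
    filter_upwards [hcard.eventually (Ioi_mem_nhds h1), eventually_gt_atTop 0] with Q hQ hQ0 x hx y
      hy hxy
    obtain ⟨u, hu, rfl⟩ := Finset.mem_image.1 hx
    obtain ⟨v, hv, rfl⟩ := Finset.mem_image.1 hy
    have huv : u ≠ v := fun h => hxy (by rw [h])
    have h2 := inv_sq_le_abs_sub_of_mem_farey (Finset.mem_filter.1 hu).1
      (Finset.mem_filter.1 hv).1 huv
    have hQ2 : (0 : ℝ) < (Q : ℝ) ^ 2 := by positivity
    have hQ' : C m / 4 * (β - α) < ((fareyIn m α β J Q).card : ℝ) / (Q : ℝ) ^ 2 := hQ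
    rw [lt_div_iff₀ hQ2] at hQ'
    have hNpos : (0 : ℝ) < (fareyIn m α β J Q).card := lt_trans (by positivity) hQ'
    rw [← sub_div, abs_div, abs_of_pos hL, sub_sub_sub_cancel_right]
    refine le_trans ?_ (div_le_div_of_nonneg_right h2 hL.le)
    rw [div_div (1 : ℝ), div_le_div_iff₀ hNpos (by positivity)]
    linarith
  · intro t ht
    have hx : Tendsto (fun Q : ℕ => (β - α) * t * ((Q : ℝ) ^ 2 / ((fareyIn m α β J Q).card : ℝ)))
        atTop (𝓝 (2 * t / C m)) := by
      have h1 := hinv.const_mul ((β - α) * t)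
      have h2 : (β - α) * t * (C m / 2 * (β - α))⁻¹ = 2 * t / C m := by field_simp
      rwa [h2] at h1
    have hM := tendsto_apply_of_monotone
      (M := fun Q x => 1 / (Q : ℝ) ^ 2 *
        (((gapPairs m Q x).filter fun z => z.1 ∈ J ∧ z.2 ∈ J).card : ℝ))
      (f := fun x => gapDensity m x * (β - α)) (x₀ := 2 * t / C m)
      (fun Q x y hxy => by
        have := Finset.card_le_card (Finset.filter_subset_filter
          (fun z : ℝ × ℝ => z.1 ∈ J ∧ z.2 ∈ J) (gapPairs_mono m Q hxy))
        simp only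
        gcongr)
      (fun x hx => tendsto_card_gapPairs_filter_both m hm hx hα hαβ hβ hJ hJ')
      (by positivity) ((continuous_gapDensity m).mul continuous_const).continuousAt hx
    have h1 := hinv.mul hM
    -- The length `β - α` cancels between the number of pairs and the number of points, so the limit
    -- does not depend on `J`.
    have h2 : (C m / 2 * (β - α))⁻¹ * (gapDensity m (2 * t / C m) * (β - α)) =
        ∫ s in (0 : ℝ)..t, g m s := by
      rw [integral_g m hm ht.le]
      field_simp
    rw [h2] at h1
    refine h1.congr' ?_
    filter_upwards [hN.eventually_gt_atTop 0, eventually_gt_atTop 0] with Q hQN hQ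
    rw [card_nearPairs_fareyIn hαβ hQ t (by exact_mod_cast hQN)]
    have hQ2 : (Q : ℝ) ^ 2 ≠ 0 := by positivity
    field_simp

end Interval

lemma fareyIn_zero_one (m : ℕ) : fareyIn m 0 1 (Set.Icc 0 1) = farey m := by
  funext Q
  ext y
  simp only [fareyIn, Finset.mem_image, Finset.mem_filter, sub_zero, div_one]
  constructor
  · rintro ⟨x, h, rfl⟩; exact h.1
  · intro h
    exact ⟨y, ⟨h, (farey_pos_le_one h).1.le, (farey_pos_le_one h).2⟩, rfl⟩

end FareyPair

end

theorem theorem1 (m : ℕ) (hm : 0 < m) :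
    -- the pair correlation function exists and equals `g m`
    FareyPair.IsPairCorrelationFunction (FareyPair.farey m) (FareyPair.g m) ∧
    -- effective asymptotic for the number of pairs with gap at most `x / Q²`
    (∀ δ : ℝ, 0 < δ → ∀ K : ℝ, 1 ≤ K → ∃ A : ℝ, ∀ Q : ℕ, 1 ≤ Q → ∀ x : ℝ, 1 ≤ x → x ≤ K →
      |(FareyPair.gapCount m Q x : ℝ) - FareyPair.gapDensity m x * (Q : ℝ) ^ 2| ≤
        A * (Q : ℝ) ^ ((3 : ℝ) / 2 + δ)) ∧
    -- the same function arises for every subinterval `J` of `[0, 1]`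
    (∀ (α β : ℝ) (J : Set ℝ), 0 ≤ α → α < β → β ≤ 1 →
      Set.Ioo α β ⊆ J → J ⊆ Set.Icc α β →
      FareyPair.IsPairCorrelationFunction (FareyPair.fareyIn m α β J) (FareyPair.g m)) := by
  refine ⟨?_, fun δ hδ K _ => FareyPair.exists_abs_gapCount_sub_le_rpow m hm hδ K,
    fun α β J hα hαβ hβ hJ hJ' =>
      FareyPair.isPairCorrelationFunction_fareyIn m hm hα hαβ hβ hJ hJ'⟩
  rw [← FareyPair.fareyIn_zero_one]
  exact FareyPair.isPairCorrelationFunction_fareyIn m hm le_rfl one_pos le_rfl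
    Set.Ioo_subset_Icc_self subset_rfl
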